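/- Let $R$ be a commutative noetherian ring and let $M$ be an (unbounded) complex of $R$-modules; $\simeq$ denotes isomorphism in the derived category, so $X\not\simeq 0$ means that $X$ has nonzero homology. For a commutative ring $A$, let $E_A(N)$ denote the injective envelope of an $A$-module $N$, and for a complex $X$ of $A$-modules put $D_A(X)=\mathrm{Hom}_A(X,\bigoplus_{\mathfrak m\in\mathrm{Max}A}E_A(A/\mathfrak m))$. For $\mathfrak m\in\mathrm{Max}R$ put $D_{\mathfrak m}(X)=\mathrm{Hom}_R(X,E_R(R/\mathfrak m))$, and let $M^{\sim}=\prod_{\mathfrak m\in\mathrm{Max}R}D_{\mathfrak m}(D_{\mathfrak m}(M))$. For $\mathfrak p\in\mathrm{Spec}R$ let $k(\mathfrak p)=R_{\mathfrak p}/\mathfrak pR_{\mathfrak p}$, and let ${}^{\mathfrak p}M=D_{R_{\mathfrak p}}(D_R(M)_{\mathfrak p})$ be the co-localization, a complex of $R_{\mathfrak p}$-modules. Define $$\mathrm{supp}_RM=\{\mathfrak p\in\mathrm{Spec}R: k(\mathfrak p)\otimes^{\mathrm L}_RM\not\simeq0\},\qquad \mathrm{cosupp}_RM=\{\mathfrak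 p\in\mathrm{Spec}R:\mathrm{RHom}_R(R/\mathfrak p,{}^{\mathfrak p}M)\not\simeq0\},$$ and in the same way over $R_{\mathfrak p}$. (A) For every $\mathfrak p\in\mathrm{Spec}R$ the following are equivalent: 1. $\mathfrak p\in\mathrm{cosupp}_RM$; 2. $\mathrm{RHom}_R(D_R(M),k(\mathfrak p))\not\simeq0$; 3. $\mathfrak p\in\mathrm{supp}_RD_R(M)$; 4. $k(\mathfrak p)\otimes^{\mathrm L}_{R_{\mathfrak p}}{}^{\mathfrak p}M\not\simeq0$; 5. $\mathfrak pR_{\mathfrak p}\in\mathrm{cosupp}_{R_{\mathfrak p}}({}^{\mathfrak p}M)$. (B) If in addition $R$ is semi-local (it has only finitely many maximal ideals), then for every $\mathfrak p\in\mathrm{Spec}R$ the conditions 1–5 are also equivalent to each of the following: 6. $\mathrm{RHom}_R(k(\mathfrak p),M^{\sim})\not\simeq0$; 7. $\mathrm{RHom}_R(\coprod_{\mathfrak m\in\mathrm{Max}R}D_{\mathfrak m}(M),k(\mathfrak p))\not\simeq0$; 8. $\mathfrak p\in\mathrm{supp}_RD_{\mathfrak m}(M)$ for some $\mathfrak m\in\mathrm{Max}R$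 with $\mathfrak p\subseteq\mathfrak m$; 9. $k(\mathfrak p)\otimes^{\mathrm L}_{R_{\mathfrak p}}\mathrm{RHom}_R(R_{\mathfrak p},M^{\sim})\not\simeq0$. (C) $M\not\simeq0$ if and only if $\mathrm{cosupp}_RM\neq\emptyset$. -/

import Mathlib

open CategoryTheory Limits

universe u

namespace DerivedModule

/-! ### Injective envelopes -/

section Envelope

variable {R : Type u} [CommRing R]

/-- `i : N → E` is an injective envelope: `E` is injective, `i` is injective, and every nonzero
submodule of `E` meets the image of `i` nontrivially. -/
structure IsInjectiveEnvelope {N E : Type u} [AddCommGroup N] [Module R N] [AddCommGroup E]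
    [Module R E] (i : N →ₗ[R] E) : Prop where
  injective : Function.Injective i
  injective_module : Module.Injective R E
  essential (U : Submodule R E) : U ⊓ LinearMap.range i = ⊥ → U = ⊥

theorem exists_maximal_submodule {I : Type u} [AddCommGroup I] [Module R I]
    (P : Submodule R I → Prop) (A : Submodule R I) (hA : P A)
    (hP : ∀ c : Set (Submodule R I), (∀ B ∈ c, P B) → IsChain (· ≤ ·) c → c.Nonempty → P (sSup c)) :
    ∃ B, A ≤ B ∧ Maximal P B := by
  refine zorn_le_nonempty₀ {B | P B} ?_ A hA
  intro c hc hchain B hB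
  exact ⟨sSup c, hP c hc hchain ⟨B, hB⟩, fun z hz => le_sSup hz⟩

theorem exists_injectiveEnvelope (N : Type u) [AddCommGroup N] [Module R N] :
    ∃ (E : ModuleCat.{u} R) (i : N →ₗ[R] E), IsInjectiveEnvelope i := by
  let I : ModuleCat.{u} R := Injective.under (ModuleCat.of R N)
  have hI : Module.Injective R I :=
    Module.injective_module_of_injective_object R I
      (inj := inferInstanceAs (Injective (Injective.under (ModuleCat.of R N))))
  let j : N →ₗ[R] I := (Injective.ι (ModuleCat.of R N)).hom
  have hj : Function.Injective j := (ModuleCat.mono_iff_injective _).1 inferInstance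
  -- a maximal essential extension of the image inside `I`
  obtain ⟨E, hjE, hE⟩ := exists_maximal_submodule (R := R) (I := I)
    (fun B => LinearMap.range j ≤ B ∧ ∀ U ≤ B, U ⊓ LinearMap.range j = ⊥ → U = ⊥)
    (LinearMap.range j) ⟨le_rfl, fun U hU h => by rwa [inf_eq_left.2 hU] at h⟩ (by
      rintro c hc hchain ⟨B, hB⟩
      refine ⟨(hc B hB).1.trans (le_sSup hB), fun U hU h => ?_⟩
      rw [Submodule.eq_bot_iff]
      intro x hx
      obtain ⟨B', hB', hxB'⟩ := (Submodule.mem_sSup_of_directed ⟨B, hB⟩ hchain.directedOn).1 (hU hx)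
      have := (hc B' hB').2 (R ∙ x) (by simpa using hxB') (by
        rw [eq_bot_iff, ← h]
        exact inf_le_inf_right _ (by simpa using hx))
      simpa using this)
  -- a maximal complement of `E`
  obtain ⟨C, -, hC⟩ := exists_maximal_submodule (R := R) (I := I)
    (fun B => B ⊓ E = ⊥) ⊥ (by simp) (by
      rintro c hc hchain hne
      rw [Submodule.eq_bot_iff]
      rintro x ⟨hx, hxE⟩
      obtain ⟨B', hB', hxB'⟩ := (Submodule.mem_sSup_of_directed hne hchain.directedOn).1 hx
      have : x ∈ B' ⊓ E := ⟨hxB', hxE⟩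
      rw [hc B' hB'] at this
      simpa using this)
  have hCE : ∀ x ∈ C, x ∈ E → x = 0 := by
    intro x hx hxE
    have : x ∈ C ⊓ E := ⟨hx, hxE⟩
    rw [hC.1] at this
    simpa using this
  let q : E →ₗ[R] I ⧸ C := C.mkQ ∘ₗ E.subtype
  have hq : Function.Injective q := by
    rw [← LinearMap.ker_eq_bot, Submodule.eq_bot_iff]
    intro x hx
    have : (x : I) ∈ C := by simpa [q] using hx
    exact Subtype.ext (hCE _ this x.2)
  have hqess : ∀ U : Submodule R (I ⧸ C), (∀ e : E, q e ∈ U → e = 0) → U = ⊥ := by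
    intro U hU
    have h1 : Submodule.comap C.mkQ U ⊓ E = ⊥ := by
      rw [Submodule.eq_bot_iff]
      rintro x ⟨hx, hxE⟩
      exact congrArg Subtype.val (hU ⟨x, hxE⟩ hx)
    have h2 : C ≤ Submodule.comap C.mkQ U := by
      intro x hx
      have : C.mkQ x = 0 := by simpa using hx
      simp only [Submodule.mem_comap, this, zero_mem]
    have h3 := hC.2 h1 h2
    rw [Submodule.eq_bot_iff]
    intro y hy
    obtain ⟨x, rfl⟩ := C.mkQ_surjective y
    have : x ∈ C := h3 hy
    simpa using this
  obtain ⟨g, hg⟩ := hI.out q hq E.subtype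
  have hginj : Function.Injective g := by
    rw [← LinearMap.ker_eq_bot]
    apply hqess
    intro e he
    rw [LinearMap.mem_ker, hg] at he
    exact Subtype.ext he
  have hgE : LinearMap.range g ≤ E := by
    apply hE.2
    · refine ⟨?_, ?_⟩
      · rintro _ ⟨n, rfl⟩
        exact ⟨q ⟨j n, hjE ⟨n, rfl⟩⟩, hg _⟩
      · intro U hU h
        have h1 : U ⊓ E = ⊥ := by
          apply hE.1.2 _ inf_le_right
          rw [eq_bot_iff, ← h]
          exact inf_le_inf_right _ inf_le_left
        have h2 : Submodule.comap g U = ⊥ := by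
          apply hqess
          intro e he
          have : (e : I) ∈ U ⊓ E := ⟨by simpa [hg] using he, e.2⟩
          rw [h1] at this
          exact Subtype.ext (by simpa using this)
        rw [Submodule.eq_bot_iff]
        intro x hx
        obtain ⟨y, rfl⟩ := hU hx
        have : y ∈ Submodule.comap g U := hx
        rw [h2, Submodule.mem_bot] at this
        rw [this, map_zero]
    · intro e he
      exact ⟨q ⟨e, he⟩, hg _⟩
  let r : I →ₗ[R] E := (g ∘ₗ C.mkQ).codRestrict E (fun x => hgE ⟨_, rfl⟩)
  have hr : ∀ e : E, r e = e := fun e => Subtype.ext (hg e)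
  refine ⟨ModuleCat.of R E, j.codRestrict E (fun n => hjE ⟨n, rfl⟩), ⟨?_, ⟨?_⟩, ?_⟩⟩
  · intro a b hab
    exact hj (congrArg Subtype.val hab)
  · intro X Y _ _ _ _ f hf k
    obtain ⟨l, hl⟩ := hI.out f hf (E.subtype ∘ₗ k)
    refine ⟨r ∘ₗ l, fun x => ?_⟩
    rw [LinearMap.comp_apply, hl]
    exact hr _
  · intro U hU
    have h1 : Submodule.map E.subtype U = ⊥ := by
      apply hE.1.2 _ (Submodule.map_subtype_le _ _)
      rw [Submodule.eq_bot_iff]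
      rintro _ ⟨⟨x, hx, rfl⟩, n, hn⟩
      have : x ∈ U ⊓ LinearMap.range (j.codRestrict E (fun n => hjE ⟨n, rfl⟩)) :=
        ⟨hx, n, Subtype.ext hn⟩
      rw [hU, Submodule.mem_bot] at this
      rw [this, map_zero]
    rw [Submodule.eq_bot_iff]
    intro x hx
    have : (x : I) ∈ Submodule.map E.subtype U := ⟨x, hx, rfl⟩
    rw [h1, Submodule.mem_bot] at this
    exact Subtype.ext this

end Envelope
/-! ### K-injective resolutions of unbounded complexes -/

section Resolution

variable {R : Type u} [CommRing R]

theorem comm_apply {K L : CochainComplex (ModuleCat.{u} R) ℤ} (f : K ⟶ L) (i j : ℤ)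
    (x : K.X i) : f.f j (K.d i j x) = L.d i j (f.f i x) := by
  rw [← ModuleCat.comp_apply, ← f.comm, ModuleCat.comp_apply]

theorem d_d_apply (K : CochainComplex (ModuleCat.{u} R) ℤ) (i j k : ℤ) (x : K.X i) :
    K.d j k (K.d i j x) = 0 := by
  rw [← ModuleCat.comp_apply, K.d_comp_d]
  rfl

/-- A complex of injective objects with zero differential is K-injective. -/
theorem isKInjective_of_d_eq_zero (J : CochainComplex (ModuleCat.{u} R) ℤ)
    [∀ n, Injective (J.X n)] (hJ : ∀ i j, J.d i j = 0) : J.IsKInjective where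
  nonempty_homotopy_zero {K} f hK := by
    have key : ∀ p : ℤ, ∃ g : K.X (p + 1) ⟶ J.X p, K.d p (p + 1) ≫ g = f.f p := by
      intro p
      have hex := (K.exactAt_iff' (p - 1) p (p + 1) (by simp) (by simp)).1 (hK p)
      have hzero : K.d (p - 1) p ≫ f.f p = 0 := by rw [← f.comm, hJ, comp_zero]
      exact ⟨hex.descToInjective (f.f p) hzero, hex.comp_descToInjective _ _⟩
    choose g hg using key
    refine ⟨(CochainComplex.HomComplex.Cochain.equivHomotopy f 0).symm
      ⟨CochainComplex.HomComplex.Cochain.mk (fun p q h =>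
        K.d p p ≫ 0 + eqToHom (by congr 1; omega) ≫ g q), ?_⟩⟩
    ext p
    rw [CochainComplex.HomComplex.Cochain.ofHom_v, CochainComplex.HomComplex.Cochain.add_v,
      CochainComplex.HomComplex.δ_v (-1) 0 (by omega) _ p p (by omega) (p - 1) (p + 1) rfl rfl]
    simp [hJ, hg]

theorem exists_kInjective_embedding (X : CochainComplex (ModuleCat.{u} R) ℤ) :
    ∃ (I : CochainComplex (ModuleCat.{u} R) ℤ) (f : X ⟶ I), I.IsKInjective ∧
      (∀ n, Function.Injective (f.f n)) ∧
      ∀ (i j : ℤ) (_ : i + 1 = j) (x : X.X j) (y : I.X i),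
        f.f j x = I.d i j y → ∃ x' : X.X i, x = X.d i j x' := by
  let J : CochainComplex (ModuleCat.{u} R) ℤ :=
    { X := fun n => Injective.under (X.opcycles n)
      d := fun _ _ => 0 }
  let f : X ⟶ J :=
    { f := fun n => X.pOpcycles n ≫ Injective.ι _
      comm' := fun i j _ => by simp [J] }
  have : ∀ n, Injective (J.X n) := fun n => inferInstanceAs (Injective (Injective.under _))
  have : J.IsKInjective := isKInjective_of_d_eq_zero J (fun _ _ => rfl)
  have := (CochainComplex.cm5b.homotopyEquiv X J).symm.isKInjective
  refine ⟨_, CochainComplex.cm5b.i f, this, fun n => ?_, ?_⟩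
  · exact (ModuleCat.mono_iff_injective _).1 inferInstance
  · intro i j hij x y hxy
    have h1 : f.f j x = 0 := by
      have h2 : ((CochainComplex.cm5b.i f).f j ≫ (CochainComplex.cm5b.p X J).f j) x = 0 := by
        rw [ModuleCat.comp_apply, hxy, ← ModuleCat.comp_apply, ← HomologicalComplex.Hom.comm]
        simp [J]
      rwa [← HomologicalComplex.comp_f, CochainComplex.cm5b.fac] at h2
    have h3 : X.pOpcycles j x = 0 := by
      apply (ModuleCat.mono_iff_injective (Injective.ι (X.opcycles j))).1 inferInstance
      simpa [f] using h1
    obtain rfl : (ComplexShape.up ℤ).prev j = i := by simp; omega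
    obtain ⟨x', hx'⟩ := ((X.sc j).moduleCat_pOpcycles_eq_zero_iff x).1 h3
    exact ⟨x', hx'.symm⟩


/-- A sequence `J 0 ⟶ J 1 ⟶ J 2 ⟶ ⋯` of complexes which resolves `J 0` by K-injective complexes
`J 1, J 2, …` and stays exact on homology. -/
structure Tower (X : CochainComplex (ModuleCat.{u} R) ℤ) where
  J : ℕ → CochainComplex (ModuleCat.{u} R) ℤ
  e : J 0 = X
  t (k : ℕ) : J k ⟶ J (k + 1)
  t_comp_t (k : ℕ) : t k ≫ t (k + 1) = 0
  isKInjective (k : ℕ) : (J (k + 1)).IsKInjective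
  mono (i j : ℤ) (_ : i + 1 = j) (x : (J 0).X j) (y : (J 1).X i) :
    (t 0).f j x = (J 1).d i j y → ∃ x' : (J 0).X i, x = (J 0).d i j x'
  exact (k : ℕ) (i j l : ℤ) (_ : i + 1 = j) (_ : j + 1 = l) (z : (J (k + 1)).X j)
    (y : (J (k + 2)).X i) :
    (J (k + 1)).d j l z = 0 → (t (k + 1)).f j z = (J (k + 2)).d i j y →
      ∃ (v : (J k).X j) (w : (J (k + 1)).X i), (J k).d j l v = 0 ∧
        z = (t k).f j v + (J (k + 1)).d i j w

theorem exists_tower (X : CochainComplex (ModuleCat.{u} R) ℤ) : Nonempty (Tower X) := by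
  choose I f hI hf hf' using exists_kInjective_embedding (R := R)
  let C : ℕ → CochainComplex (ModuleCat.{u} R) ℤ := fun k =>
    Nat.rec (motive := fun _ => CochainComplex (ModuleCat.{u} R) ℤ) X (fun _ D => cokernel (f D)) k
  let J : ℕ → CochainComplex (ModuleCat.{u} R) ℤ := fun k =>
    Nat.casesOn (motive := fun _ => CochainComplex (ModuleCat.{u} R) ℤ) k X (fun n => I (C n))
  let p : ∀ k, J k ⟶ C k := fun k =>
    Nat.casesOn (motive := fun k => J k ⟶ C k) k (𝟙 X) (fun n => cokernel.π (f (C n)))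
  have hfp : ∀ k, f (C k) ≫ p (k + 1) = 0 := fun k => cokernel.condition (f (C k))
  have hfp' : ∀ k n (c : (C k).X n), (p (k + 1)).f n ((f (C k)).f n c) = 0 := by
    intro k n c
    have := congrArg (fun g => g.f n) (hfp k)
    exact congrArg (fun g => g c) this
  have hsurj : ∀ k n, Function.Surjective ((p k).f n) := by
    intro k n
    rw [← ModuleCat.epi_iff_surjective]
    cases k with
    | zero => change Epi ((𝟙 X : X ⟶ X).f n); infer_instance
    | succ k => change Epi ((cokernel.π (f (C k))).f n); infer_instance
  have hexact : ∀ k n (z : (I (C k)).X n), (p (k + 1)).f n z = 0 →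
      ∃ c : (C k).X n, (f (C k)).f n c = z := by
    intro k n z hz
    have hS : (ShortComplex.mk _ _ (cokernel.condition (f (C k)))).Exact :=
      ShortComplex.exact_cokernel _
    have := hS.map (HomologicalComplex.eval _ _ n)
    exact (ShortComplex.moduleCat_exact_iff _).1 this z hz
  have hcyc : ∀ k (j l : ℤ) (_ : j + 1 = l) (v : (C k).X j), (C k).d j l v = 0 →
      ∃ u : (J k).X j, (J k).d j l u = 0 ∧ (p k).f j u = v := by
    intro k j l hjl v hv
    cases k with
    | zero => exact ⟨v, hv, rfl⟩
    | succ k =>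
      obtain ⟨u', hu'⟩ := hsurj (k + 1) j v
      have h1 : (p (k + 1)).f l ((J (k + 1)).d j l u') = 0 := by
        rw [← ModuleCat.comp_apply, ← (p (k + 1)).comm, ModuleCat.comp_apply, hu', hv]
      obtain ⟨c, hc⟩ := hexact k l _ h1
      obtain ⟨c', hc'⟩ := hf' (C k) j l hjl c u' hc
      refine ⟨u' - (f (C k)).f j c', ?_, ?_⟩
      · rw [map_sub, ← hc, hc']
        exact sub_eq_zero.2 (comm_apply (f (C k)) j l c')
      · rw [map_sub, hu', hfp', sub_zero]
  refine ⟨{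
    J := J
    e := rfl
    t := fun k => p k ≫ f (C k)
    t_comp_t := fun k => ?_
    isKInjective := fun k => hI (C k)
    mono := fun i j hij x y h => hf' X i j hij x y h
    exact := ?_ }⟩
  · rw [Category.assoc, reassoc_of% (hfp k), zero_comp, comp_zero]
  · intro k i j l hij hjl z y hz hy
    obtain ⟨c, hc⟩ := hf' (C (k + 1)) i j hij ((p (k + 1)).f j z) y hy
    obtain ⟨w, hw⟩ := hsurj (k + 1) i c
    have h1 : (p (k + 1)).f j (z - (J (k + 1)).d i j w) = 0 := by
      rw [map_sub, ← ModuleCat.comp_apply ((J (k + 1)).d i j), ← (p (k + 1)).comm,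
        ModuleCat.comp_apply, hw, hc, sub_self]
    obtain ⟨v, hv⟩ := hexact k j _ h1
    have h2 : (C k).d j l v = 0 := by
      apply hf (C k) l
      have h3 : (J (k + 1)).d j l ((f (C k)).f j v) = 0 := by
        rw [hv, map_sub, hz, d_d_apply, sub_zero]
      rw [comm_apply, map_zero]
      exact h3
    obtain ⟨q, hq, hq'⟩ := hcyc k j l hjl v h2
    refine ⟨q, w, hq, ?_⟩
    rw [HomologicalComplex.comp_f, ModuleCat.comp_apply, hq', hv]
    exact (sub_add_cancel _ _).symm


/-- Positions `(k, m)` with `m + k = n`. -/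
@[ext]
structure Pos (n : ℤ) where
  k : ℕ
  m : ℤ
  h : m + k = n

namespace Tower

variable {X : CochainComplex (ModuleCat.{u} R) ℤ} (T : Tower X)

/-- The product of the modules of the tower (without `J 0`) in total degree `n`. -/
abbrev Tot (n : ℤ) : Type u := ∀ s : Pos n, (T.J (s.k + 1)).X s.m

/-- The part of the total differential that raises the index in the tower. -/
def totUp {n n' : ℤ} (hn : n + 1 = n') : (s : Pos n') → T.Tot n →ₗ[R] (T.J (s.k + 1)).X s.m
  | ⟨0, _, _⟩ => 0
  | ⟨k + 1, m, h⟩ => ((T.t (k + 1)).f m).hom ∘ₗ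
      LinearMap.proj (R := R) (φ := fun s : Pos n => (T.J (s.k + 1)).X s.m)
        ⟨k, m, by push_cast at h; omega⟩

/-- The total differential. -/
def totD {n n' : ℤ} (hn : n + 1 = n') : T.Tot n →ₗ[R] T.Tot n' :=
  LinearMap.pi fun s => ((s.k : ℤ).negOnePow : ℤ) • (((T.J (s.k + 1)).d (s.m - 1) s.m).hom ∘ₗ
    LinearMap.proj (R := R) (φ := fun s : Pos n => (T.J (s.k + 1)).X s.m)
      ⟨s.k, s.m - 1, by have := s.h; omega⟩) + T.totUp hn s

theorem totD_zero {n n' : ℤ} (hn : n + 1 = n') (z : T.Tot n) (m : ℤ) (h : m + (0 : ℕ) = n')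
    (m' : ℤ) (hm : m' + 1 = m) :
    T.totD hn z ⟨0, m, h⟩ = (T.J 1).d m' m (z ⟨0, m', by omega⟩) := by
  obtain rfl : m' = m - 1 := by omega
  simp [totD, totUp]

theorem totD_succ {n n' : ℤ} (hn : n + 1 = n') (z : T.Tot n) (k : ℕ) (m : ℤ)
    (h : m + (k + 1 : ℕ) = n') (m' : ℤ) (hm : m' + 1 = m) :
    T.totD hn z ⟨k + 1, m, h⟩ =
      (((k + 1 : ℕ) : ℤ).negOnePow : ℤ) • (T.J (k + 2)).d m' m (z ⟨k + 1, m', by omega⟩) +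
        (T.t (k + 1)).f m (z ⟨k, m, by push_cast at h; omega⟩) := by
  obtain rfl : m' = m - 1 := by omega
  rfl

theorem t_t_apply (k : ℕ) (n : ℤ) (x : (T.J k).X n) : (T.t (k + 1)).f n ((T.t k).f n x) = 0 := by
  rw [← ModuleCat.comp_apply, ← HomologicalComplex.comp_f, T.t_comp_t]
  rfl

theorem totD_totD {n n' n'' : ℤ} (hn : n + 1 = n') (hn' : n' + 1 = n'') (z : T.Tot n) :
    T.totD hn' (T.totD hn z) = 0 := by
  funext ⟨k, m, h⟩
  cases k with
  | zero =>
    rw [T.totD_zero hn' _ m h (m - 1) (by omega), T.totD_zero hn _ (m - 1) _ (m - 1 - 1) (by omega),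
      d_d_apply]
    rfl
  | succ k =>
    rw [T.totD_succ hn' _ k m h (m - 1) (by omega),
      T.totD_succ hn _ k (m - 1) _ (m - 1 - 1) (by omega)]
    cases k with
    | zero =>
      rw [T.totD_zero hn _ m _ (m - 1) (by omega), map_add, map_zsmul, d_d_apply, comm_apply]
      simp
    | succ k =>
      rw [T.totD_succ hn _ k m _ (m - 1) (by omega), map_add, map_zsmul, d_d_apply, map_add,
        t_t_apply, map_zsmul, comm_apply]
      have : (((k + 1 + 1 : ℕ) : ℤ).negOnePow : ℤ) = - (((k + 1 : ℕ) : ℤ).negOnePow : ℤ) := by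
        push_cast
        rw [Int.negOnePow_succ]
        simp
      simp only [this, smul_zero, zero_add, add_zero, neg_smul]
      exact neg_add_cancel _

/-- The total complex of a tower. -/
noncomputable def tot : CochainComplex (ModuleCat.{u} R) ℤ where
  X n := ModuleCat.of R (T.Tot n)
  d i j := if h : i + 1 = j then ModuleCat.ofHom (T.totD h) else 0
  shape i j hij := by
    rw [dif_neg]
    simpa using hij
  d_comp_d' i j k hij hjk := by
    simp only [ComplexShape.up_Rel] at hij hjk
    rw [dif_pos hij, dif_pos hjk]
    ext z
    exact congrFun (T.totD_totD hij hjk z) _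

theorem tot_d {i j : ℤ} (h : i + 1 = j) : T.tot.d i j = ModuleCat.ofHom (T.totD h) :=
  dif_pos h

/-- The components of the map from `J 0` to the total complex. -/
def augF {n : ℤ} : (s : Pos n) → (T.J 0).X n →ₗ[R] (T.J (s.k + 1)).X s.m
  | ⟨0, m, h⟩ => ((T.t 0).f m).hom ∘ₗ
      (eqToHom (by congr 1; simpa using h.symm) : (T.J 0).X n ⟶ (T.J 0).X m).hom
  | ⟨_ + 1, _, _⟩ => 0

theorem augF_zero {n : ℤ} (h : n + (0 : ℕ) = n) (x : (T.J 0).X n) :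
    T.augF ⟨0, n, h⟩ x = (T.t 0).f n x := by
  simp [augF]

/-- The map from `J 0` to the total complex. -/
noncomputable def aug : T.J 0 ⟶ T.tot where
  f n := ModuleCat.ofHom (LinearMap.pi fun s => T.augF s)
  comm' i j hij := by
    simp only [ComplexShape.up_Rel] at hij
    rw [T.tot_d hij]
    ext x
    funext ⟨k, m, h⟩
    change T.totD hij (fun s => T.augF s x) _ = T.augF _ ((T.J 0).d i j x)
    cases k with
    | zero =>
      obtain rfl : m = j := by simpa using h
      rw [T.totD_zero hij _ m h i hij, augF_zero, augF_zero, comm_apply]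
    | succ k =>
      rw [T.totD_succ hij _ k m h (m - 1) (by omega)]
      cases k with
      | zero =>
        obtain rfl : m = i := by push_cast at h; omega
        rw [augF_zero, t_t_apply]
        simp [augF]
      | succ k => simp [augF]

end Tower

theorem quasiIso_of_elements {K L : CochainComplex (ModuleCat.{u} R) ℤ} (f : K ⟶ L)
    (h₁ : ∀ (i j k : ℤ), i + 1 = j → j + 1 = k → ∀ (x : K.X j) (y : L.X i),
      K.d j k x = 0 → f.f j x = L.d i j y → ∃ x' : K.X i, x = K.d i j x')
    (h₂ : ∀ (i j k : ℤ), i + 1 = j → j + 1 = k → ∀ (z : L.X j), L.d j k z = 0 →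
      ∃ (x : K.X j) (y : L.X i), K.d j k x = 0 ∧ z = f.f j x + L.d i j y) : QuasiIso f := by
  have hπ : ∀ A : ModuleCat.{u} R, Epi (ModuleCat.freeDesc (R := R) (M := A) (↾fun a : A => a)) := by
    intro A
    rw [ModuleCat.epi_iff_surjective]
    exact fun a => ⟨ModuleCat.freeMk a, by simp⟩
  refine ⟨fun j => ?_⟩
  rw [quasiIsoAt_iff_isIso_homologyMap]
  have hm : Mono (HomologicalComplex.homologyMap f j) := by
    rw [HomologicalComplex.mono_homologyMap_iff_up_to_refinements f (j - 1) j (j + 1) (by simp)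
      (by simp)]
    intro A x hx y hxy
    have := fun a : A => h₁ (j - 1) j (j + 1) (by omega) rfl (x a) (y a)
      (congrArg (fun g => g a) hx) (congrArg (fun g => g a) hxy)
    choose x' hx' using this
    refine ⟨_, _, hπ A, ModuleCat.freeDesc (↾x'), ?_⟩
    ext a
    simp [hx']
  have he : Epi (HomologicalComplex.homologyMap f j) := by
    rw [HomologicalComplex.epi_homologyMap_iff_up_to_refinements f (j - 1) j (j + 1) (by simp)
      (by simp)]
    intro A z hz
    have := fun a : A => h₂ (j - 1) j (j + 1) (by omega) rfl (z a)
      (congrArg (fun g => g a) hz)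
    choose x y hx hy using this
    refine ⟨_, _, hπ A, ModuleCat.freeDesc (↾x), ?_, ModuleCat.freeDesc (↾y), ?_⟩
    · ext a
      simp [hx]
    · ext a
      simp [hy]
  exact isIso_of_mono_of_epi _

namespace Tower

variable {X : CochainComplex (ModuleCat.{u} R) ℤ} (T : Tower X)

theorem aug_apply_zero {n : ℤ} (x : (T.J 0).X n) (h : n + (0 : ℕ) = n) :
    (show T.Tot n from T.aug.f n x) ⟨0, n, h⟩ = (T.t 0).f n x :=
  T.augF_zero h x

theorem aug_apply_succ {n : ℤ} (x : (T.J 0).X n) (k : ℕ) (m : ℤ) (h : m + (k + 1 : ℕ) = n) :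
    (show T.Tot n from T.aug.f n x) ⟨k + 1, m, h⟩ = 0 :=
  rfl

theorem quasiIso_aug : QuasiIso T.aug := by
  apply quasiIso_of_elements
  · intro i j k hij hjk x y hx hxy
    rw [T.tot_d hij] at hxy
    apply T.mono i j hij x ((show T.Tot i from y) ⟨0, i, by simp⟩)
    rw [← T.aug_apply_zero x (by simp), ← T.totD_zero hij _ j (by simp) i hij]
    exact congrFun hxy _
  · intro i j l hij hjl z hz
    rw [T.tot_d hjl] at hz
    let z' : T.Tot j := z
    have hz' : ∀ s, T.totD hjl z' s = 0 := fun s => congrFun hz s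
    let St (k : ℕ) : Type u := ∀ (m : ℤ), m + k = j → (T.J k).X m
    let Inv (k : ℕ) (W : St k) : Prop := ∀ (m m' : ℤ) (h : m + k = j) (_ : m + 1 = m'),
      (T.J (k + 1)).d m m' (z' ⟨k, m, h⟩ - (T.t k).f m (W m h)) = 0
    have step : ∀ (k : ℕ) (W : St k), Inv k W → ∃ (V : St k) (W' : St (k + 1)),
        (∀ m m' h, m + 1 = m' → (T.J k).d m m' (V m h) = 0) ∧ Inv (k + 1) W' ∧
        ∀ m h m' h', z' ⟨k, m, h⟩ = (T.t k).f m (W m h + V m h) +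
          ((k : ℤ).negOnePow : ℤ) • (T.J (k + 1)).d m' m (W' m' h') := by
      intro k W hW
      have hs : ((k : ℤ).negOnePow : ℤ) * ((k : ℤ).negOnePow : ℤ) = 1 := by
        rw [← Units.val_mul, Int.units_mul_self, Units.val_one]
      have hs' : (((k + 1 : ℕ) : ℤ).negOnePow : ℤ) = -((k : ℤ).negOnePow : ℤ) := by
        push_cast
        rw [Int.negOnePow_succ]
        simp
      set σ : ℤ := ((k : ℤ).negOnePow : ℤ)
      have hm₀ : (j - k) + (k : ℤ) = j := by omega
      have hD := hz' ⟨k + 1, j - k, by push_cast; omega⟩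
      rw [T.totD_succ hjl z' k (j - k) _ (j - k - 1) (by omega), hs'] at hD
      have hr := hW (j - k) (j - k + 1) hm₀ rfl
      obtain ⟨v, w, hv, hvw⟩ := T.exact k (j - k - 1) (j - k) (j - k + 1) (by omega) rfl
        (z' ⟨k, j - k, hm₀⟩ - (T.t k).f (j - k) (W (j - k) hm₀))
        (σ • z' ⟨k + 1, j - k - 1, by push_cast; omega⟩) hr (by
          rw [map_sub, t_t_apply, sub_zero, map_zsmul]
          rw [neg_smul, neg_add_eq_zero] at hD
          exact hD.symm)
      have hzk : z' ⟨k, j - k, hm₀⟩ = (T.t k).f (j - k) (W (j - k) hm₀ + v) +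
          (T.J (k + 1)).d (j - k - 1) (j - k) w := by
        rw [map_add, add_assoc, ← hvw]
        abel
      refine ⟨fun m h => (show j - k = m by omega) ▸ v,
        fun m h => (show j - k - 1 = m by push_cast at h; omega) ▸ (σ • w), ?_, ?_, ?_⟩
      · intro m m' h hm
        obtain rfl : m = j - k := by omega
        obtain rfl : m' = j - k + 1 := by omega
        exact hv
      · intro m m' h hm
        obtain rfl : m = j - k - 1 := by push_cast at h; omega
        obtain rfl : m' = j - k := by omega
        change (T.J (k + 1 + 1)).d _ _ (_ - (T.t (k + 1)).f (j - k - 1) (σ • w)) = 0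
        rw [hzk, map_add, t_t_apply, zero_add, neg_smul, neg_add_eq_zero, comm_apply] at hD
        rw [map_sub, map_zsmul, map_zsmul, ← hD, smul_smul, hs, one_smul]
        exact sub_self _
      · intro m h m' h'
        obtain rfl : m = j - k := by omega
        obtain rfl : m' = j - k - 1 := by push_cast at h'; omega
        change _ = (T.t k).f (j - k) (W (j - k) hm₀ + v) + σ • (T.J (k + 1)).d _ _ (σ • w)
        rw [map_zsmul, smul_smul, hs, one_smul]
        exact hzk
    choose! V W' hV hW' hVW using step
    let S : ∀ k, {W : St k // Inv k W} := fun k => Nat.rec (motive := fun k => {W : St k // Inv k W})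
      ⟨fun _ _ => 0, by
        intro m m' h hm
        obtain rfl : m = j := by simpa using h
        have := hz' ⟨0, m', by omega⟩
        rw [T.totD_zero hjl z' m' _ m hm] at this
        rw [map_zero, sub_zero]
        exact this⟩
      (fun k W => ⟨W' k W.1, hW' k W.1 W.2⟩) k
    let F : ∀ k, St k := fun k m h => (S k).1 m h + V k (S k).1 m h
    refine ⟨F 0 j (by simp), fun s => F (s.k + 1) s.m (by have := s.h; push_cast; omega), ?_, ?_⟩
    · change (T.J 0).d j l (0 + V 0 (S 0).1 j _) = 0
      rw [zero_add]
      exact hV 0 _ (S 0).2 _ _ _ hjl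
    · rw [T.tot_d hij]
      funext ⟨k, m, h⟩
      change z' _ = (show T.Tot j from T.aug.f j _) _ + T.totD hij _ _
      have hF : ∀ m h m' h', m' + 1 = m → z' ⟨k, m, h⟩ = (T.t k).f m (F k m h) +
          ((k : ℤ).negOnePow : ℤ) • (T.J (k + 1)).d m' m (F (k + 1) m' h') := by
        intro m h m' h' hm
        have e : (T.J (k + 1)).d m' m (F (k + 1) m' h') =
            (T.J (k + 1)).d m' m (W' k (S k).1 m' h') := by
          refine (map_add ((T.J (k + 1)).d m' m).hom _ _).trans ?_
          refine (congrArg₂ _ rfl (hV (k + 1) _ (S (k + 1)).2 _ _ _ hm)).trans (add_zero _)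
        rw [e]
        exact hVW k (S k).1 (S k).2 m h m' h'
      rw [hF m h (m - 1) (by push_cast; omega) (by omega)]
      cases k with
      | zero =>
        obtain rfl : m = j := by simpa using h
        rw [aug_apply_zero, T.totD_zero hij _ m h (m - 1) (by omega)]
        simp
      | succ k =>
        rw [aug_apply_succ, T.totD_succ hij _ k m h (m - 1) (by omega), zero_add]
        exact add_comm _ _

open CochainComplex.HomComplex in
theorem δ_apply {K L : CochainComplex (ModuleCat.{u} R) ℤ} {n m : ℤ} (hnm : n + 1 = m)
    (z : Cochain K L n) (p q : ℤ) (hpq : p + m = q) (q₁ q₂ : ℤ) (hq₁ : q₁ + 1 = q)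
    (hq₂ : p + 1 = q₂) (x : K.X p) :
    (δ n m z).v p q hpq x = L.d q₁ q (z.v p q₁ (by omega) x) +
      (m.negOnePow : ℤ) • z.v q₂ q (by omega) (K.d p q₂ x) := by
  rw [δ_v _ _ hnm z p q hpq q₁ q₂ (by omega) hq₂, Units.smul_def]
  simp

open CochainComplex.HomComplex in
theorem isKInjective_tot : T.tot.IsKInjective where
  nonempty_homotopy_zero {K} φ hK := by
    have := T.isKInjective
    let f' (p : ℤ) (x : K.X p) : T.Tot p := φ.f p x
    let F (k : ℕ) : Cochain K (T.J (k + 1)) (-(k : ℤ)) := Cochain.mk fun p q h =>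
      φ.f p ≫ ModuleCat.ofHom
        (LinearMap.proj (R := R) (φ := fun s : Pos p => (T.J (s.k + 1)).X s.m)
          ⟨k, q, by omega⟩)
    have hσ (k : ℕ) : ((k : ℤ).negOnePow : ℤ) * ((k : ℤ).negOnePow : ℤ) = 1 := by
      rw [← Units.val_mul, Int.units_mul_self, Units.val_one]
    have hσ' (k : ℕ) : (((k + 1 : ℕ) : ℤ).negOnePow : ℤ) = -((k : ℤ).negOnePow : ℤ) := by
      push_cast
      rw [Int.negOnePow_succ]
      simp
    have hφ (p p' : ℤ) (hp : p + 1 = p') (x : K.X p) (s : Pos p') :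
        T.totD hp (f' p x) s = f' p' (K.d p p' x) s := by
      have h1 := comm_apply φ p p' x
      rw [T.tot_d hp] at h1
      exact congrFun h1.symm s
    have hFv (k : ℕ) (p q : ℤ) (h : p + -(k : ℤ) = q) (x : K.X p) :
      (F k).v p q h x = f' p x ⟨k, q, by omega⟩ := rfl
    have hF0 : δ (-((0 : ℕ) : ℤ)) (-((0 : ℕ) : ℤ) + 1) (F 0) = 0 := by
      ext p q hpq x
      have h1 := hφ p (p + 1) rfl x ⟨0, q, by push_cast at hpq ⊢; omega⟩
      rw [T.totD_zero _ _ q _ (q - 1) (by omega)] at h1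
      refine (δ_apply (by simp) (F 0) p q hpq (q - 1) (p + 1) (by omega) rfl x).trans ?_
      rw [hFv, hFv, ← h1]
      simp
    have hF (k : ℕ) : δ (-((k + 1 : ℕ) : ℤ)) (-(k : ℤ)) (F (k + 1)) =
        (k : ℤ).negOnePow • (F k).comp (Cochain.ofHom (T.t (k + 1))) (add_zero _) := by
      ext p q hpq x
      have h1 := hφ p (p + 1) rfl x ⟨k + 1, q, by push_cast; omega⟩
      rw [T.totD_succ _ _ k q _ (q - 1) (by omega)] at h1
      refine (δ_apply (by push_cast; omega) (F (k + 1)) p q hpq (q - 1) (p + 1) (by omega)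
        rfl x).trans ?_
      rw [hFv, hFv, ← h1, Int.negOnePow_neg, smul_add, smul_smul, hσ', mul_neg, hσ]
      rw [Cochain.units_smul_v, Cochain.comp_zero_cochain_v, Cochain.ofHom_v, Units.smul_def]
      simp [hFv]
    let St (k : ℕ) : Type u := {G : Cochain K (T.J (k + 1)) (-(k : ℤ)) //
      δ (-(k : ℤ)) (-(k : ℤ) + 1) G = 0 ∧ G.comp (Cochain.ofHom (T.t (k + 1))) (add_zero _) =
        (F k).comp (Cochain.ofHom (T.t (k + 1))) (add_zero _)}
    have step (k : ℕ) (G : St k) : ∃ H : Cochain K (T.J (k + 1)) (-((k + 1 : ℕ) : ℤ)),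
        (k : ℤ).negOnePow • δ (-((k + 1 : ℕ) : ℤ)) (-(k : ℤ)) H = G.1 := by
      obtain ⟨H, hH⟩ := CochainComplex.IsKInjective.eq_δ_of_cocycle
        (Cocycle.mk G.1 _ rfl G.2.1) hK (-((k + 1 : ℕ) : ℤ)) (by push_cast; omega)
      refine ⟨(k : ℤ).negOnePow • H, ?_⟩
      rw [δ_units_smul, smul_smul, Int.units_mul_self, one_smul]
      exact hH
    choose H hH using step
    let next (k : ℕ) (G : St k) : St (k + 1) :=
      ⟨F (k + 1) - (H k G).comp (Cochain.ofHom (T.t (k + 1))) (add_zero _), by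
        have e : -((k + 1 : ℕ) : ℤ) + 1 = -(k : ℤ) := by push_cast; omega
        have h1 := hH k G
        have h2 : δ (-((k + 1 : ℕ) : ℤ)) (-(k : ℤ)) (H k G) = (k : ℤ).negOnePow • G.1 := by
          rw [← h1, smul_smul, Int.units_mul_self, one_smul]
        rw [e, δ_sub, hF, δ_comp_ofHom, h2, Cochain.units_smul_comp, G.2.2, sub_self], by
        rw [Cochain.sub_comp, Cochain.comp_assoc_of_second_is_zero_cochain, ← Cochain.ofHom_comp,
          T.t_comp_t]
        simp⟩
    let S : ∀ k, St k := fun k => Nat.rec (motive := St) ⟨F 0, hF0, rfl⟩ next k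
    let h : Cochain K T.tot (-1) := Cochain.mk fun p q hpq => ModuleCat.ofHom
      (LinearMap.pi fun s : Pos q =>
        ((H s.k (S s.k)).v p s.m (by have := s.h; push_cast; omega)).hom)
    refine ⟨(Cochain.equivHomotopy φ 0).symm ⟨h, ?_⟩⟩
    ext p x
    let g (p q : ℤ) (hpq : p + -1 = q) (x : K.X p) : T.Tot q := fun s =>
      (H s.k (S s.k)).v p s.m (by have := s.h; push_cast; omega) x
    have h2 (s : Pos p) : f' p x s =
        T.totD (show p - 1 + 1 = p by omega) (g p (p - 1) (by omega) x) s
          + g (p + 1) p (by omega) (K.d p (p + 1) x) s := by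
      obtain ⟨k, m, hs⟩ := s
      have h3 := congrArg (fun G : Cochain K (T.J (k + 1)) (-(k : ℤ)) => G.v p m (by omega) x)
        (hH k (S k))
      replace h3 := ((congrArg (fun y => ((k : ℤ).negOnePow : ℤ) • y)
        (δ_apply (by push_cast; omega) (H k (S k)) p m (by omega) (m - 1) (p + 1) (by omega)
          rfl x)).symm.trans h3)
      simp only [Int.negOnePow_neg, smul_add, smul_smul, hσ, one_smul] at h3
      cases k with
      | zero =>
        rw [T.totD_zero _ _ m _ (m - 1) (by omega)]
        simp only [Nat.cast_zero, Int.negOnePow_zero, Units.val_one, one_smul] at h3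
        exact h3.symm
      | succ k =>
        rw [T.totD_succ _ _ k m _ (m - 1) (by omega)]
        refine Eq.trans ?_ (add_right_comm _ _ _)
        refine Eq.trans (sub_add_cancel (f' p x ⟨k + 1, m, hs⟩) ((T.t (k + 1)).f m
          (g p (p - 1) (by omega) x ⟨k, m, by push_cast at hs; omega⟩))).symm ?_
        have h4 : (S (k + 1)).1.v p m (by omega) x = f' p x ⟨k + 1, m, hs⟩ - (T.t (k + 1)).f m
            (g p (p - 1) (by omega) x ⟨k, m, by push_cast at hs; omega⟩) := by
          change (F (k + 1) - (H k (S k)).comp (Cochain.ofHom (T.t (k + 1))) (add_zero _)).v p m _ x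
            = _
          rw [Cochain.sub_v, Cochain.comp_zero_cochain_v, Cochain.ofHom_v]
          rfl
        exact congrArg₂ _ (h4.symm.trans h3.symm) rfl
    have h1 := δ_apply (show (-1 : ℤ) + 1 = 0 by omega) h p p (by omega) (p - 1) (p + 1) (by omega)
      rfl x
    rw [T.tot_d (show p - 1 + 1 = p by omega), Int.negOnePow_zero, Units.val_one, one_smul] at h1
    rw [Cochain.add_v, Cochain.ofHom_zero, Cochain.zero_v, add_zero]
    refine Eq.trans ?_ h1.symm
    funext s
    exact h2 s

end Tower

/-- Every complex of modules has a K-injective resolution. -/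
theorem exists_kInjectiveResolution (X : CochainComplex (ModuleCat.{u} R) ℤ) :
    ∃ (I : CochainComplex (ModuleCat.{u} R) ℤ) (i : X ⟶ I), I.IsKInjective ∧ QuasiIso i := by
  obtain ⟨T⟩ := exists_tower X
  have := T.quasiIso_aug
  exact ⟨T.tot, eqToHom T.e.symm ≫ T.aug, T.isKInjective_tot, inferInstance⟩

end Resolution

/-! ### Hom complexes and derived functors -/

noncomputable section Definitions

variable {R : Type u} [CommRing R]

/-- The injective envelope `E(N)` of an `R`-module `N`. -/
def injectiveEnvelope (N : ModuleCat.{u} R) : ModuleCat.{u} R :=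
  (exists_injectiveEnvelope (R := R) N).choose

/-- A module, viewed as a complex concentrated in degree `0`. -/
abbrev asComplex (N : ModuleCat.{u} R) : CochainComplex (ModuleCat.{u} R) ℤ :=
  (HomologicalComplex.single (ModuleCat.{u} R) (ComplexShape.up ℤ) 0).obj N

open CochainComplex.HomComplex in
/-- The `R`-complex `Hom_R(X, Y)`. Its degree `n` term is `∏ p, Hom_R(X^p, Y^(p+n))`. -/
def homComplex (X Y : CochainComplex (ModuleCat.{u} R) ℤ) : CochainComplex (ModuleCat.{u} R) ℤ where
  X n := ModuleCat.of R (Cochain X Y n)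
  d i j := ModuleCat.ofHom (δ_hom R X Y i j)
  shape i j hij := by
    exact ModuleCat.hom_ext (LinearMap.ext fun z => δ_shape i j hij z)
  d_comp_d' i j k _ _ := by
    exact ModuleCat.hom_ext (LinearMap.ext fun z => δ_δ i j k z)

/-- A K-injective resolution of the complex `Y`. -/
def kInjectiveResolution (Y : CochainComplex (ModuleCat.{u} R) ℤ) :
    CochainComplex (ModuleCat.{u} R) ℤ :=
  (exists_kInjectiveResolution Y).choose

/-- `RHom_R(X, Y)`, computed by a K-injective resolution of `Y`. -/
def RHom (X Y : CochainComplex (ModuleCat.{u} R) ℤ) : CochainComplex (ModuleCat.{u} R) ℤ :=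
  homComplex X (kInjectiveResolution Y)

instance coextendScalars_additive {S : Type u} [CommRing S] (f : R →+* S) :
    (ModuleCat.coextendScalars.{u, u, u} f).Additive where
  map_add := by
    intros
    rfl

/-- `RHom_R(S, Y)` as a complex of `S`-modules, for an `R`-algebra `S`: the functor `Hom_R(S, -)`
from `R`-modules to `S`-modules applied to a K-injective resolution of `Y`. -/
def RHomAlgebra (S : Type u) [CommRing S] [Algebra R S] (Y : CochainComplex (ModuleCat.{u} R) ℤ) :
    CochainComplex (ModuleCat.{u} S) ℤ :=
  ((ModuleCat.coextendScalars.{u, u, u} (algebraMap R S)).mapHomologicalComplex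
    (ComplexShape.up ℤ)).obj (kInjectiveResolution Y)

/-- `N ⊗ᴸ_R Y` for an `R`-module `N` and an `R`-complex `Y`: the total tensor product of a
projective resolution of `N` with `Y`. -/
def derivedTensor (N : ModuleCat.{u} R) (Y : CochainComplex (ModuleCat.{u} R) ℤ) :
    CochainComplex (ModuleCat.{u} R) ℤ :=
  HomologicalComplex.tensorObj (projectiveResolution N).cochainComplex Y

/-- Restriction of scalars of a complex along `R → S`. -/
abbrev restrict (R : Type u) [CommRing R] {S : Type u} [CommRing S] [Algebra R S]
    (Y : CochainComplex (ModuleCat.{u} S) ℤ) : CochainComplex (ModuleCat.{u} R) ℤ :=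
  ((ModuleCat.restrictScalars (algebraMap R S)).mapHomologicalComplex (ComplexShape.up ℤ)).obj Y

/-- The localization `S⁻¹M` of a complex. -/
abbrev localize (S : Submonoid R) (M : CochainComplex (ModuleCat.{u} R) ℤ) :
    CochainComplex (ModuleCat.{u} (Localization S)) ℤ :=
  ((ModuleCat.localizedModuleFunctor.{u} S).mapHomologicalComplex (ComplexShape.up ℤ)).obj M

/-! ### Duality, co-localization, support and cosupport -/

/-- `D_m(M) = Hom_R(M, E(R/m))`. -/
def localDual (m : MaximalSpectrum R) (M : CochainComplex (ModuleCat.{u} R) ℤ) :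
    CochainComplex (ModuleCat.{u} R) ℤ :=
  homComplex M (asComplex (injectiveEnvelope (ModuleCat.of R (R ⧸ m.asIdeal))))

open scoped DirectSum in
/-- `D_R(M) = Hom_R(M, ⨁_m E(R/m))`, the sum being over all maximal ideals of `R`. -/
def dual (M : CochainComplex (ModuleCat.{u} R) ℤ) : CochainComplex (ModuleCat.{u} R) ℤ :=
  homComplex M (asComplex (ModuleCat.of R
    (⨁ m : MaximalSpectrum R, injectiveEnvelope (ModuleCat.of R (R ⧸ m.asIdeal)))))

/-- `M^∼ = ∏_m D_m(D_m(M))`, the product being over all maximal ideals of `R`. -/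
def tilde (M : CochainComplex (ModuleCat.{u} R) ℤ) : CochainComplex (ModuleCat.{u} R) ℤ :=
  ∏ᶜ fun m : MaximalSpectrum R => localDual m (localDual m M)

/-- The co-localization `D_{S⁻¹R}(S⁻¹ D_R(M))` of `M` relative to `S`. -/
def colocalize (S : Submonoid R) (M : CochainComplex (ModuleCat.{u} R) ℤ) :
    CochainComplex (ModuleCat.{u} (Localization S)) ℤ :=
  dual (localize S (dual M))

/-- The co-localization `ᵖM` of `M` relative to `R ∖ p`. -/
abbrev colocalizeAt (p : PrimeSpectrum R) (M : CochainComplex (ModuleCat.{u} R) ℤ) :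
    CochainComplex (ModuleCat.{u} (Localization.AtPrime p.asIdeal)) ℤ :=
  colocalize p.asIdeal.primeCompl M

/-- The residue field `k(p) = R_p / pR_p` as a module over `R`. -/
abbrev residueModule (p : PrimeSpectrum R) : ModuleCat.{u} R :=
  ModuleCat.of R p.asIdeal.ResidueField

/-- The residue field `k(p) = R_p / pR_p` as a module over `R_p`. -/
abbrev residueModuleAt (p : PrimeSpectrum R) : ModuleCat.{u} (Localization.AtPrime p.asIdeal) :=
  ModuleCat.of (Localization.AtPrime p.asIdeal) p.asIdeal.ResidueField

/-- The small support `{p | k(p) ⊗ᴸ_R M ≄ 0}`. -/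
def smallSupport (M : CochainComplex (ModuleCat.{u} R) ℤ) : Set (PrimeSpectrum R) :=
  {p | ¬ (derivedTensor (residueModule p) M).Acyclic}

/-- The small cosupport `{p | RHom_R(R/p, ᵖM) ≄ 0}`. -/
def smallCosupport (M : CochainComplex (ModuleCat.{u} R) ℤ) : Set (PrimeSpectrum R) :=
  {p | ¬ (RHom (asComplex (ModuleCat.of R (R ⧸ p.asIdeal)))
    (restrict R (colocalizeAt p M))).Acyclic}

end Definitions

end DerivedModule

open DerivedModule

/-! Every condition in the theorem says that some derived Hom or derived tensor product is nonzero.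
Each is rewritten as the failure of `HomVanish X Y`, the vanishing of all morphisms from `X` to
shifts of `Y` in a derived category. Conditions 1, 2 and 3 then all become RHom(D(M), k(p)) ≄ 0.

Two facts about an injective module `E` drive the translation. If `E` is a cogenerator, Hom(X, E) is
acyclic exactly when X is, so N ⊗ᴸ X ≃ 0 is the same as RHom(N, Hom(X, E)) ≃ 0. And RHom(X, Hom(N,
E)) agrees with RHom(N, Hom(X, E)), both being bilinear maps. If N is a field K over R and Hom(K, E)
is nonzero, this Hom is a nonzero K-vector space and detects the same objects as K itself. Hence
RHom(X, K) ≃ 0 iff RHom(K, Hom(X, E)) ≃ 0, and iff K ⊗ᴸ X ≃ 0 (`homVanish_field_iff`,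
`acyclic_derivedTensor_field_iff`). Applied over R_p, together with the adjunction between
localization and restriction, this gives `mem_smallCosupport_iff` and `mem_smallSupport_iff`.

Conditions 4 and 5 need a symmetry over a noetherian local ring with residue field k: RHom(k, Y) ≃ 0
iff RHom(Y, k) ≃ 0 (`homVanish_residueField_comm`). Neither side changes if Y is replaced by its
iterated cone W on generators of the maximal ideal. Powers of these generators act as zero on W, and
dévissage along the quotients A/q, q prime, shows that each side then forces W ≃ 0.

For (C), D is faithful, so it suffices that X ≃ 0 when RHom(X, k(q)) ≃ 0 for all q
(`acyclic_of_forall_homVanish_residueModule`). Noetherian induction on q makes every x outside q act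
injectively on the homology of R/q ⊗ᴸ X. A nonzero class would then be detected by an injective
module over R_q containing k(q), whereas the dual of R/q ⊗ᴸ X with values in that module is acyclic.

For (B), finitely many maximal ideals turn D(M), M^∼ and the coproduct into finite biproducts, so
all conditions are checked one maximal ideal at a time; those not containing p contribute nothing.
-/

namespace DerivedModule

/-! ### Vanishing of graded morphism groups in pretriangulated categories -/

section HomVanish

open Pretriangulated

universe v' u'

variable {C : Type u'} [Category.{v'} C] [HasZeroObject C] [HasShift C ℤ] [Preadditive C]
  [∀ n : ℤ, (shiftFunctor C n).Additive] [Pretriangulated C]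

/-- All morphisms from `X` to the shifts of `Y` vanish. -/
def HomVanish (X Y : C) : Prop :=
  ∀ (n : ℤ) (f : X ⟶ Y⟦n⟧), f = 0

namespace HomVanish

theorem of_iso {X X' Y Y' : C} (e : X ≅ X') (e' : Y ≅ Y') (h : HomVanish X Y) :
    HomVanish X' Y' := by
  intro n f
  have := h n (e.hom ≫ f ≫ e'.inv⟦n⟧')
  rw [← cancel_epi e.hom, ← cancel_mono (e'.inv⟦n⟧'), Category.assoc, this]
  simp

theorem iff_of_iso {X X' Y Y' : C} (e : X ≅ X') (e' : Y ≅ Y') :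
    HomVanish X Y ↔ HomVanish X' Y' :=
  ⟨of_iso e e', of_iso e.symm e'.symm⟩

theorem shift_right {X Y : C} (h : HomVanish X Y) (a : ℤ) : HomVanish X (Y⟦a⟧) := by
  intro n f
  have := h (a + n) (f ≫ (shiftFunctorAdd C a n).inv.app Y)
  rw [← cancel_mono ((shiftFunctorAdd C a n).inv.app Y), this, zero_comp]

theorem shift_left {X Y : C} (h : HomVanish X Y) (a : ℤ) : HomVanish (X⟦a⟧) Y := by
  intro n f
  have h1 := h.shift_right n (-a) (((shiftEquiv C a).unitIso.app X).hom ≫ f⟦-a⟧')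
  apply (shiftFunctor C (-a)).map_injective
  rw [Functor.map_zero]
  exact (cancel_epi ((shiftEquiv C a).unitIso.app X).hom).1 (h1.trans comp_zero.symm)

theorem obj₂_left {T : Triangle C} (hT : T ∈ distTriang C) {W : C} (h₁ : HomVanish T.obj₁ W)
    (h₃ : HomVanish T.obj₃ W) : HomVanish T.obj₂ W := by
  intro n f
  obtain ⟨g, rfl⟩ := T.yoneda_exact₂ hT f (h₁ n _)
  rw [h₃ n g, comp_zero]

theorem obj₃_left {T : Triangle C} (hT : T ∈ distTriang C) {W : C} (h₁ : HomVanish T.obj₁ W)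
    (h₂ : HomVanish T.obj₂ W) : HomVanish T.obj₃ W :=
  obj₂_left (T := T.rotate) (rot_of_distTriang _ hT) h₂ (h₁.shift_left 1)

theorem obj₂_right {T : Triangle C} (hT : T ∈ distTriang C) {W : C} (h₁ : HomVanish W T.obj₁)
    (h₃ : HomVanish W T.obj₃) : HomVanish W T.obj₂ := by
  intro n f
  -- Shifting a triangle by n multiplies its maps by (-1)ⁿ; here the sign is harmless, and in the
  -- factorization lemmas below it is absorbed into the factor.
  obtain ⟨g, hg⟩ : ∃ g : W ⟶ T.obj₁⟦n⟧, f = g ≫ (n.negOnePow • T.mor₁⟦n⟧') :=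
    ((Triangle.shiftFunctor C n).obj T).coyoneda_exact₂ (T.shift_distinguished hT n) f (h₃ n _)
  rw [hg, h₁ n g, zero_comp]

theorem obj₃_right {T : Triangle C} (hT : T ∈ distTriang C) {W : C} (h₁ : HomVanish W T.obj₁)
    (h₂ : HomVanish W T.obj₂) : HomVanish W T.obj₃ :=
  obj₂_right (T := T.rotate) (rot_of_distTriang _ hT) h₂ (h₁.shift_right 1)

theorem exists_eq_mor₁_comp {T : Triangle C} (hT : T ∈ distTriang C) {W : C}
    (h₃ : HomVanish T.obj₃ W) {n : ℤ} (f : T.obj₁ ⟶ W⟦n⟧) : ∃ g, f = T.mor₁ ≫ g :=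
  T.invRotate.yoneda_exact₂ (inv_rot_of_distTriang _ hT) f ((h₃.shift_left (-1)) n _)

theorem exists_eq_comp_mor₂ {T : Triangle C} (hT : T ∈ distTriang C) {W : C}
    (h₁ : HomVanish W T.obj₁) {n : ℤ} (f : W ⟶ T.obj₃⟦n⟧) : ∃ g, f = g ≫ T.mor₂⟦n⟧' := by
  obtain ⟨g, hg⟩ : ∃ g : W ⟶ T.obj₂⟦n⟧, f = g ≫ (n.negOnePow • T.mor₂⟦n⟧') :=
    ((Triangle.shiftFunctor C n).obj T.rotate).coyoneda_exact₂
    (T.rotate.shift_distinguished (rot_of_distTriang _ hT) n) f ((h₁.shift_right 1) n _)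
  refine ⟨n.negOnePow • g, hg.trans ?_⟩
  simp

theorem exists_eq_comp_mor₁ {T : Triangle C} (hT : T ∈ distTriang C) {W : C}
    (h₃ : HomVanish W T.obj₃) {n : ℤ} (f : W ⟶ T.obj₂⟦n⟧) : ∃ g, f = g ≫ T.mor₁⟦n⟧' := by
  obtain ⟨g, hg⟩ : ∃ g : W ⟶ T.obj₁⟦n⟧, f = g ≫ (n.negOnePow • T.mor₁⟦n⟧') :=
    ((Triangle.shiftFunctor C n).obj T).coyoneda_exact₂
    (T.shift_distinguished hT n) f (h₃ n _)
  refine ⟨n.negOnePow • g, hg.trans ?_⟩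
  simp

end HomVanish

end HomVanish

/-! ### Acyclicity of Hom complexes -/

section Acyclic

variable {R : Type u} [CommRing R]

theorem acyclic_iff (K : CochainComplex (ModuleCat.{u} R) ℤ) :
    K.Acyclic ↔ ∀ (i j k : ℤ), i + 1 = j → j + 1 = k → ∀ x : K.X j, K.d j k x = 0 →
      ∃ y : K.X i, K.d i j y = x := by
  constructor
  · intro h i j k hij hjk x hx
    have h1 := (K.exactAt_iff' i j k (by simp; omega) (by simp; omega)).1 (h j)
    exact (ShortComplex.moduleCat_exact_iff _).1 h1 x hx
  · intro h j
    rw [K.exactAt_iff' (j - 1) j (j + 1) (by simp) (by simp), ShortComplex.moduleCat_exact_iff]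
    exact h (j - 1) j (j + 1) (by omega) rfl

open CochainComplex.HomComplex

theorem acyclic_homComplex_iff (X Y : CochainComplex (ModuleCat.{u} R) ℤ) :
    (homComplex X Y).Acyclic ↔ ∀ (m n k : ℤ), m + 1 = n → n + 1 = k → ∀ z : Cochain X Y n,
      δ n k z = 0 → ∃ w : Cochain X Y m, δ m n w = z :=
  acyclic_iff _

/-- The degree n cohomology of the Hom complex is the group of homotopy classes of maps X ⟶ Y⟦n⟧. -/
theorem acyclic_homComplex_iff_quotient (X Y : CochainComplex (ModuleCat.{u} R) ℤ) :
    (homComplex X Y).Acyclic ↔ ∀ (n : ℤ)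
      (f : (HomotopyCategory.quotient _ _).obj X ⟶ (HomotopyCategory.quotient _ _).obj (Y⟦n⟧)),
        f = 0 := by
  rw [acyclic_homComplex_iff]
  constructor
  · intro h n f
    obtain ⟨c, rfl⟩ := (CohomologyClass.toHom_bijective X Y n).2 f
    obtain ⟨z, rfl⟩ := c.mk_surjective
    rw [CohomologyClass.toHom_mk_eq_zero_iff]
    obtain ⟨w, hw⟩ := h (n - 1) n (n + 1) (by omega) rfl z.1 (z.δ_eq_zero _)
    exact ⟨n - 1, by omega, w, hw⟩
  · intro h m n k hm hk z hz
    have h1 := h n (CohomologyClass.toHom (CohomologyClass.mk (Cocycle.mk z k hk hz)))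
    rw [CohomologyClass.toHom_mk_eq_zero_iff, mem_coboundaries_iff _ m hm] at h1
    exact h1

end Acyclic

/-! ### Hom complexes and morphisms in the derived category -/

section Derived

variable {R : Type u} [CommRing R]

attribute [local instance] HasDerivedCategory.standard

open DerivedCategory

theorem homVanish_Q_iff (X Y : CochainComplex (ModuleCat.{u} R) ℤ) :
    HomVanish (Q.obj X) (Q.obj Y) ↔ ∀ (n : ℤ) (f : Qh.obj ((HomotopyCategory.quotient _ _).obj X) ⟶
      Qh.obj ((HomotopyCategory.quotient _ _).obj (Y⟦n⟧))), f = 0 := by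
  refine forall_congr' fun n => ?_
  let e := (quotientCompQhIso (ModuleCat.{u} R)).app X
  let e' := (quotientCompQhIso (ModuleCat.{u} R)).app (Y⟦n⟧) ≪≫ (Q.commShiftIso n).app Y
  exact (Iso.homCongr e e').forall_congr (fun f => by simp [Iso.homCongr]) |>.symm

/-- Into a K-injective complex, homotopy classes of maps and morphisms in the derived category
coincide. -/
theorem acyclic_homComplex_of_isKInjective_iff (X Y : CochainComplex (ModuleCat.{u} R) ℤ)
    [Y.IsKInjective] : (homComplex X Y).Acyclic ↔ HomVanish (Q.obj X) (Q.obj Y) := by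
  rw [homVanish_Q_iff, acyclic_homComplex_iff_quotient]
  refine forall_congr' fun n => ?_
  exact (Equiv.ofBijective _ (CochainComplex.IsKInjective.Qh_map_bijective _ _)).forall_congr
    (fun f => by
      rw [Equiv.ofBijective_apply, ← (CochainComplex.IsKInjective.Qh_map_bijective _ _).1.eq_iff,
        Functor.map_zero])

theorem acyclic_homComplex_of_isKProjective_iff (X Y : CochainComplex (ModuleCat.{u} R) ℤ)
    [X.IsKProjective] : (homComplex X Y).Acyclic ↔ HomVanish (Q.obj X) (Q.obj Y) := by
  rw [homVanish_Q_iff, acyclic_homComplex_iff_quotient]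
  refine forall_congr' fun n => ?_
  exact (Equiv.ofBijective _ (CochainComplex.IsKProjective.Qh_map_bijective _ _)).forall_congr
    (fun f => by
      rw [Equiv.ofBijective_apply, ← (CochainComplex.IsKProjective.Qh_map_bijective _ _).1.eq_iff,
        Functor.map_zero])

theorem kInjectiveResolution_spec (Y : CochainComplex (ModuleCat.{u} R) ℤ) :
    ∃ i : Y ⟶ kInjectiveResolution Y, (kInjectiveResolution Y).IsKInjective ∧ QuasiIso i :=
  (exists_kInjectiveResolution Y).choose_spec

instance (Y : CochainComplex (ModuleCat.{u} R) ℤ) : (kInjectiveResolution Y).IsKInjective :=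
  (kInjectiveResolution_spec Y).choose_spec.1

noncomputable def toKInjectiveResolution (Y : CochainComplex (ModuleCat.{u} R) ℤ) :
    Y ⟶ kInjectiveResolution Y :=
  (kInjectiveResolution_spec Y).choose

instance (Y : CochainComplex (ModuleCat.{u} R) ℤ) : QuasiIso (toKInjectiveResolution Y) :=
  (kInjectiveResolution_spec Y).choose_spec.2

theorem homVanish_iff_of_quasiIso {X X' Y Y' : CochainComplex (ModuleCat.{u} R) ℤ}
    (f : X ⟶ X') (g : Y ⟶ Y') [QuasiIso f] [QuasiIso g] :
    HomVanish (Q.obj X) (Q.obj Y) ↔ HomVanish (Q.obj X') (Q.obj Y') :=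
  HomVanish.iff_of_iso (asIso (Q.map f)) (asIso (Q.map g))

theorem acyclic_RHom_iff (X Y : CochainComplex (ModuleCat.{u} R) ℤ) :
    (RHom X Y).Acyclic ↔ HomVanish (Q.obj X) (Q.obj Y) := by
  rw [RHom, acyclic_homComplex_of_isKInjective_iff]
  exact (homVanish_iff_of_quasiIso (𝟙 X) (toKInjectiveResolution Y)).symm

end Derived

end DerivedModule

namespace DerivedModule

/-! ### Duality with values in an injective module -/

section ToModule

variable {R : Type u} [CommRing R]

open CochainComplex.HomComplex

/-- Cochains of degree `n` with values in a module `E`, as linear maps on the terms in degree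
`-n`. -/
noncomputable def evalCochain {X : CochainComplex (ModuleCat.{u} R) ℤ} {E : ModuleCat.{u} R} {n : ℤ}
    (p : ℤ) (hp : p + n = 0) : Cochain X (asComplex E) n →ₗ[R] X.X p →ₗ[R] E where
  toFun z := (z.v p 0 hp ≫ (HomologicalComplex.singleObjXSelf (.up ℤ) 0 E).hom).hom
  map_add' _ _ := by
    rw [Cochain.add_v, Preadditive.add_comp, ModuleCat.hom_add]
  map_smul' _ _ := by
    rw [Cochain.smul_v, Linear.smul_comp, ModuleCat.hom_smul, RingHom.id_apply]

/-- The cochain with values in the module `E` given by a family of linear maps. -/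
noncomputable def mkCochain {X : CochainComplex (ModuleCat.{u} R) ℤ} {E : ModuleCat.{u} R} {n : ℤ}
    (f : ∀ p : ℤ, p + n = 0 → (X.X p →ₗ[R] E)) : Cochain X (asComplex E) n :=
  Cochain.mk fun p q hpq => if h : q = 0 then
    ModuleCat.ofHom (f p (by omega)) ≫ (HomologicalComplex.singleObjXIsoOfEq (.up ℤ) 0 E q h).inv
  else 0

variable {X : CochainComplex (ModuleCat.{u} R) ℤ} {E : ModuleCat.{u} R} {n : ℤ}

theorem evalCochain_mkCochain (f : ∀ p : ℤ, p + n = 0 → (X.X p →ₗ[R] E)) (p : ℤ)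
    (hp : p + n = 0) : evalCochain p hp (mkCochain f) = f p hp := by
  change ((mkCochain f).v p 0 hp ≫ _).hom = _
  rw [mkCochain, Cochain.mk_v, dif_pos rfl]
  simp [HomologicalComplex.singleObjXSelf]

theorem evalCochain_ext {z z' : Cochain X (asComplex E) n}
    (h : ∀ p hp, evalCochain p hp z = evalCochain p hp z') : z = z' := by
  refine Cochain.ext _ _ fun p q hpq => ?_
  by_cases hq : q = 0
  · subst hq
    exact (cancel_mono (HomologicalComplex.singleObjXSelf (.up ℤ) 0 E).hom).1
      (ModuleCat.hom_ext (h p hpq))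
  · exact (HomologicalComplex.isZero_single_obj_X _ _ _ _ hq).eq_of_tgt _ _

theorem evalCochain_δ {m : ℤ} (hm : n + 1 = m) (z : Cochain X (asComplex E) n) (p p' : ℤ)
    (hp : p + m = 0) (hp' : p + 1 = p') :
    evalCochain p hp (δ n m z) =
      (m.negOnePow : ℤ) • (evalCochain p' (by omega) z ∘ₗ (X.d p p').hom) := by
  apply LinearMap.ext
  intro x
  change (((δ n m z).v p 0 hp ≫ (HomologicalComplex.singleObjXSelf (.up ℤ) 0 E).hom) : _ ⟶ _) x = _
  rw [δ_v _ _ hm z p 0 hp (-1) p' (by omega) hp', HomologicalComplex.single_obj_d, comp_zero,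
    zero_add, Units.smul_def]
  rw [Linear.smul_comp, Category.assoc]
  rfl

/-- A degree n cochain into a module placed in degree 0 is one linear map on the term in degree -n,
and its differential is precomposition with d up to sign. Acyclicity is thus exactness of the
contravariant Hom sequence. -/
theorem acyclic_homComplex_asComplex_iff :
    (homComplex X (asComplex E)).Acyclic ↔ ∀ (i j k : ℤ), i + 1 = j → j + 1 = k →
      ∀ f : X.X j →ₗ[R] E, f ∘ₗ (X.d i j).hom = 0 →
        ∃ g : X.X k →ₗ[R] E, g ∘ₗ (X.d j k).hom = f := by
  rw [acyclic_homComplex_iff]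
  constructor
  · intro h i j k hij hjk f hf
    obtain ⟨w, hw⟩ := h (-k) (-j) (-i) (by omega) (by omega) (mkCochain fun p hp =>
      f ∘ₗ (LinearEquiv.refl R _).toLinearMap ∘ₗ
        ((X.XIsoOfEq (show p = j by omega)).hom).hom) (by
        refine evalCochain_ext fun p hp => ?_
        obtain rfl : p = i := by omega
        rw [evalCochain_δ (by omega) _ _ j _ (by omega), evalCochain_mkCochain]
        simp [hf])
    refine ⟨((-j).negOnePow : ℤ) • evalCochain k (by omega) w, ?_⟩
    have h1 := congrArg (evalCochain j (by omega)) hw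
    rw [evalCochain_δ (by omega) _ _ k _ (by omega), evalCochain_mkCochain] at h1
    rw [LinearMap.smul_comp, h1]
    simp
  · intro h m n k hm hk z hz
    obtain ⟨g, hg⟩ := h (-k) (-n) (-m) (by omega) (by omega) (evalCochain (-n) (by omega) z) (by
      have h1 := congrArg (evalCochain (-k) (by omega)) hz
      rw [evalCochain_δ (by omega) _ _ (-n) _ (by omega), map_zero] at h1
      have h2 := congrArg (fun t => (k.negOnePow : ℤ) • t) h1
      simp only [smul_smul, smul_zero] at h2
      rwa [← Units.val_mul, Int.units_mul_self, Units.val_one, one_smul] at h2)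
    refine ⟨mkCochain fun p hp => (n.negOnePow : ℤ) • g ∘ₗ
      ((X.XIsoOfEq (show p = -m by omega)).hom).hom, evalCochain_ext fun p hp => ?_⟩
    obtain rfl : p = -n := by omega
    rw [evalCochain_δ hm _ _ (-m) _ (by omega), evalCochain_mkCochain, LinearMap.smul_comp,
      smul_smul, ← Units.val_mul, Int.units_mul_self, Units.val_one, one_smul, ← hg]
    simp

/-- A map killing boundaries kills cycles, so it descends to the quotient by the cycles; d embeds
this quotient in the next term, and injectivity of `E` extends the map. -/
theorem acyclic_homComplex_asComplex (hE : Module.Injective R E) (hX : X.Acyclic) :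
    (homComplex X (asComplex E)).Acyclic := by
  rw [acyclic_homComplex_asComplex_iff]
  rw [acyclic_iff] at hX
  intro i j k hij hjk f hf
  have hker : LinearMap.ker (X.d j k).hom ≤ LinearMap.ker f := by
    intro x hx
    obtain ⟨y, rfl⟩ := hX i j k hij hjk x hx
    exact LinearMap.congr_fun hf y
  let f' : (X.X j ⧸ LinearMap.ker (X.d j k).hom) →ₗ[R] E := Submodule.liftQ _ f hker
  let d' : (X.X j ⧸ LinearMap.ker (X.d j k).hom) →ₗ[R] X.X k := Submodule.liftQ _ (X.d j k).hom le_rfl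
  obtain ⟨g, hg⟩ := hE.out d' (LinearMap.ker_eq_bot.1 (Submodule.ker_liftQ_eq_bot' _ _ rfl)) f'
  exact ⟨g, LinearMap.ext fun x => hg (Submodule.Quotient.mk x)⟩

/-- A module `E` is a cogenerator: homomorphisms into `E` separate the points of every module. -/
def IsCogenerator (E : ModuleCat.{u} R) : Prop :=
  ∀ (N : Type u) [AddCommGroup N] [Module R N] (x : N), x ≠ 0 → ∃ f : N →ₗ[R] E, f x ≠ 0

theorem IsCogenerator.exists_of_notMem (hE : IsCogenerator E) {N : Type u} [AddCommGroup N]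
    [Module R N] (B : Submodule R N) (x : N) (hx : x ∉ B) :
    ∃ f : N →ₗ[R] E, (∀ y ∈ B, f y = 0) ∧ f x ≠ 0 := by
  obtain ⟨f, hf⟩ := hE (N ⧸ B) (B.mkQ x) (by simpa using hx)
  exact ⟨f ∘ₗ B.mkQ, fun y hy => by simp [(Submodule.Quotient.mk_eq_zero B).2 hy], hf⟩

/-- A cycle that is not a boundary is separated from the boundaries by a map f to `E`. Acyclicity of
the dual factors f through d, so f kills the cycle. -/
theorem acyclic_of_acyclic_homComplex_asComplex (hE : IsCogenerator E)
    (hX : (homComplex X (asComplex E)).Acyclic) : X.Acyclic := by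
  rw [acyclic_homComplex_asComplex_iff] at hX
  rw [acyclic_iff]
  intro i j k hij hjk x hx
  by_contra! hne
  obtain ⟨f, hf, hfx⟩ := hE.exists_of_notMem (LinearMap.range (X.d i j).hom) x
    (fun ⟨y, hy⟩ => hne y hy)
  obtain ⟨g, rfl⟩ := hX i j k hij hjk f (LinearMap.ext fun y => hf _ ⟨y, rfl⟩)
  apply hfx
  change g (X.d j k x) = 0
  rw [hx, map_zero]

theorem acyclic_homComplex_asComplex_iff_acyclic (hE : Module.Injective R E)
    (hE' : IsCogenerator E) : (homComplex X (asComplex E)).Acyclic ↔ X.Acyclic :=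
  ⟨acyclic_of_acyclic_homComplex_asComplex hE', acyclic_homComplex_asComplex hE⟩

end ToModule

end DerivedModule

namespace DerivedModule

/-! ### Tensor-Hom adjunction and symmetry via bilinear maps -/

section Bilinear

variable {R : Type u} [CommRing R]

open CochainComplex.HomComplex

/-- Families of bilinear maps `P^a × X^b → E` for `a + b + n = 0`. -/
abbrev BilinearCochain (P X : CochainComplex (ModuleCat.{u} R) ℤ) (E : ModuleCat.{u} R) (n : ℤ) :
    Type u :=
  ∀ s : {s : ℤ × ℤ // s.1 + s.2 + n = 0}, (P.X s.1.1 →ₗ[R] X.X s.1.2 →ₗ[R] E)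

variable {P X : CochainComplex (ModuleCat.{u} R) ℤ} {E : ModuleCat.{u} R}

namespace BilinearCochain

/-- A component of a family of bilinear maps. -/
abbrev app {n : ℤ} (φ : BilinearCochain P X E n) (a b : ℤ) (h : a + b + n = 0) :
    P.X a →ₗ[R] X.X b →ₗ[R] E :=
  φ ⟨(a, b), h⟩

/-- The family of bilinear maps with given components. -/
abbrev mk {n : ℤ} (f : ∀ a b : ℤ, a + b + n = 0 → (P.X a →ₗ[R] X.X b →ₗ[R] E)) :
    BilinearCochain P X E n :=
  fun s => f s.1.1 s.1.2 s.2

theorem ext_app {n : ℤ} {φ ψ : BilinearCochain P X E n}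
    (h : ∀ a b hab (x : P.X a) (y : X.X b), φ.app a b hab x y = ψ.app a b hab x y) : φ = ψ := by
  funext ⟨⟨a, b⟩, hab⟩
  exact LinearMap.ext fun x => LinearMap.ext fun y => h a b hab x y

end BilinearCochain

/-- The differential on families of bilinear maps. -/
def bilinearδ {n m : ℤ} (hm : n + 1 = m) (φ : BilinearCochain P X E n) : BilinearCochain P X E m :=
  -- (-1)^a is the Koszul sign of the tensor product differential; (-1)^m comes from precomposing a
  -- cochain with the differential of its source.
  .mk fun a b h => (m.negOnePow : ℤ) • ((φ.app (a + 1) b (by omega)).comp (P.d a (a + 1)).hom +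
    (a.negOnePow : ℤ) • (φ.app a (b + 1) (by omega)).compl₂ (X.d b (b + 1)).hom)

theorem bilinearδ_apply {n m : ℤ} (hm : n + 1 = m) (φ : BilinearCochain P X E n) (a b : ℤ)
    (h : a + b + m = 0) (x : P.X a) (y : X.X b) :
    (bilinearδ hm φ).app a b h x y = (m.negOnePow : ℤ) • (φ.app (a + 1) b (by omega) (P.d a (a + 1) x) y +
      (a.negOnePow : ℤ) • φ.app a (b + 1) (by omega) x (X.d b (b + 1) y)) :=
  rfl

open HomologicalComplex in
/-- Homomorphisms from a tensor product of complexes to a module. -/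
noncomputable def tensorCochainEquiv (n : ℤ) :
    Cochain (tensorObj P X) (asComplex E) n ≃ₗ[R] BilinearCochain P X E n where
  toFun z := .mk fun a b h => TensorProduct.curry
    (evalCochain (a + b) h z ∘ₗ (ιTensorObj P X a b (a + b) rfl).hom)
  map_add' z z' := by
    refine BilinearCochain.ext_app fun a b h x y => ?_
    simp
  map_smul' r z := by
    refine BilinearCochain.ext_app fun a b h x y => ?_
    simp
  invFun φ := mkCochain fun p hp => (mapBifunctorDesc fun a b h =>
    ModuleCat.ofHom (TensorProduct.lift (φ.app a b (by
      change a + b = p at h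
      omega)))).hom
  left_inv z := by
    refine evalCochain_ext fun p hp => ?_
    rw [evalCochain_mkCochain]
    refine (congrArg ModuleCat.Hom.hom ?_ : _ = (ModuleCat.ofHom (evalCochain p hp z)).hom)
    refine mapBifunctor.hom_ext fun a b h => ?_
    obtain rfl : a + b = p := h
    rw [ι_mapBifunctorDesc]
    refine ModuleCat.hom_ext (TensorProduct.ext' fun x y => ?_)
    rfl
  right_inv φ := by
    refine BilinearCochain.ext_app fun a b h x y => ?_
    refine (LinearMap.congr_fun (evalCochain_mkCochain (X := tensorObj P X) (E := E)
      (fun p hp => (mapBifunctorDesc fun a b h => ModuleCat.ofHom (TensorProduct.lift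
        (φ.app a b (by
          change a + b = p at h
          omega)))).hom) (a + b) h)
      (ιTensorObj P X a b (a + b) rfl (TensorProduct.tmul R x y))).trans ?_
    have h1 : ιTensorObj P X a b (a + b) rfl ≫ _ = _ :=
      ι_mapBifunctorDesc (K₁ := P) (K₂ := X) (c := .up ℤ)
      (F := MonoidalCategory.curriedTensor _) (fun a' b' (h' : a' + b' = a + b) =>
        ModuleCat.ofHom (TensorProduct.lift (φ.app a' b' (by omega)))) a b rfl
    exact congrArg (fun t => ModuleCat.Hom.hom t (TensorProduct.tmul R x y)) h1

open HomologicalComplex in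
theorem tensorCochainEquiv_δ {n m : ℤ} (hm : n + 1 = m)
    (z : Cochain (tensorObj P X) (asComplex E) n) :
    tensorCochainEquiv m (δ n m z) = bilinearδ hm (tensorCochainEquiv n z) := by
  refine BilinearCochain.ext_app fun a b h x y => ?_
  rw [bilinearδ_apply]
  change evalCochain (a + b) h (δ n m z) (ιTensorObj P X a b (a + b) rfl (TensorProduct.tmul R x y))
    = _
  rw [evalCochain_δ hm z (a + b) (a + b + 1) h rfl, LinearMap.smul_apply, LinearMap.comp_apply]
  congr 1
  have h1 : ιTensorObj P X a b (a + b) rfl ≫ (tensorObj P X).d (a + b) (a + b + 1) =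
      MonoidalCategory.whiskerRight (P.d a (a + 1)) (X.X b) ≫
        ιTensorObj P X (a + 1) b (a + b + 1) (by omega) +
      a.negOnePow • MonoidalCategory.whiskerLeft (P.X a) (X.d b (b + 1)) ≫
        ιTensorObj P X a (b + 1) (a + b + 1) (by omega) := by
    rw [mapBifunctor.d_eq, Preadditive.comp_add, mapBifunctor.ι_D₁, mapBifunctor.ι_D₂,
      mapBifunctor.d₁_eq _ _ _ _ (show (ComplexShape.up ℤ).Rel a (a + 1) from rfl) _ _
        (show a + 1 + b = a + b + 1 by omega),
      mapBifunctor.d₂_eq _ _ _ _ _ (show (ComplexShape.up ℤ).Rel b (b + 1) from rfl) _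
        (show a + (b + 1) = a + b + 1 by omega)]
    congr 1
    exact one_smul _ _
  have h2 := congrArg (fun t => ModuleCat.Hom.hom t (TensorProduct.tmul R x y)) h1
  have h3 : (tensorObj P X).d (a + b) (a + b + 1)
      (ιTensorObj P X a b (a + b) rfl (TensorProduct.tmul R x y)) =
      ιTensorObj P X (a + 1) b (a + b + 1) (by omega)
        (TensorProduct.tmul R (P.d a (a + 1) x) y) +
      (a.negOnePow : ℤ) • ιTensorObj P X a (b + 1) (a + b + 1) (by omega)
        (TensorProduct.tmul R x (X.d b (b + 1) y)) := by
    refine h2.trans ?_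
    rw [Units.smul_def]
    rfl
  have key : ∀ (p : ℤ) (hp : p + n = 0) (a' b' : ℤ) (h' : a' + b' = p) (x' : P.X a') (y' : X.X b'),
      evalCochain p hp z (ιTensorObj P X a' b' p h' (TensorProduct.tmul R x' y')) =
        (tensorCochainEquiv n z).app a' b' (by omega) x' y' := by
    rintro p hp a' b' rfl x' y'
    rfl
  refine (congrArg (evalCochain (a + b + 1) (by omega) z) h3).trans ?_
  rw [map_add, map_zsmul, key, key]

/-- Homomorphisms from `P` to a complex `Hom(X, E)` for a module `E`. -/
noncomputable def homCochainEquiv (n : ℤ) :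
    Cochain P (homComplex X (asComplex E)) n ≃ₗ[R] BilinearCochain P X E n where
  toFun z := .mk fun a b h => (evalCochain (X := X) (E := E) b (by omega)) ∘ₗ (z.v a (a + n) rfl).hom
  map_add' z z' := by
    refine BilinearCochain.ext_app fun a b h x y => ?_
    exact LinearMap.congr_fun ((evalCochain (X := X) (E := E) (n := a + n) b (by omega)).map_add
      (show Cochain X (asComplex E) (a + n) from (z.v a (a + n) rfl).hom x)
      (show Cochain X (asComplex E) (a + n) from (z'.v a (a + n) rfl).hom x)) y
  map_smul' r z := by
    refine BilinearCochain.ext_app fun a b h x y => ?_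
    exact LinearMap.congr_fun ((evalCochain (X := X) (E := E) (n := a + n) b (by omega)).map_smul r
      (show Cochain X (asComplex E) (a + n) from (z.v a (a + n) rfl).hom x)) y
  invFun φ := Cochain.mk fun a q hq => ModuleCat.ofHom
    { toFun := fun x => mkCochain fun b hb => φ.app a b (by omega) x
      map_add' := fun x x' => evalCochain_ext fun b hb => by
        simp only [map_add, evalCochain_mkCochain]
      map_smul' := fun r x => evalCochain_ext fun b hb => by
        simp only [map_smul, evalCochain_mkCochain, RingHom.id_apply] }
  left_inv z := by
    refine Cochain.ext _ _ fun a q hq => ?_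
    subst hq
    refine ModuleCat.hom_ext (LinearMap.ext fun x => evalCochain_ext fun b hb => ?_)
    exact evalCochain_mkCochain _ _ _
  right_inv φ := by
    funext s
    exact LinearMap.ext fun x => evalCochain_mkCochain _ _ _

theorem homCochainEquiv_apply {n : ℤ} (z : Cochain P (homComplex X (asComplex E)) n) (a b q : ℤ)
    (h : a + b + n = 0) (hq : a + n = q) (x : P.X a) :
    (homCochainEquiv n z).app a b h x =
      evalCochain (X := X) (E := E) b (by omega) (z.v a q hq x) := by
  subst hq
  rfl

theorem homCochainEquiv_δ {n m : ℤ} (hm : n + 1 = m)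
    (z : Cochain P (homComplex X (asComplex E)) n) :
    homCochainEquiv m (δ n m z) = bilinearδ hm (homCochainEquiv n z) := by
  refine BilinearCochain.ext_app fun a b h x y => ?_
  rw [bilinearδ_apply, homCochainEquiv_apply _ a b (a + m) h rfl,
    homCochainEquiv_apply z (a + 1) b (a + m) _ (by omega),
    homCochainEquiv_apply z a (b + 1) (a + n) _ rfl]
  have h1 : (δ n m z).v a (a + m) rfl x =
      δ (a + n) (a + m) (show Cochain X (asComplex E) (a + n) from z.v a (a + n) rfl x) +
      (m.negOnePow : ℤ) • (show Cochain X (asComplex E) (a + m) from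
        z.v (a + 1) (a + m) (by omega) (P.d a (a + 1) x)) :=
    Tower.δ_apply hm z a (a + m) rfl (a + n) (a + 1) (by omega) rfl x
  -- The inner Hom complex contributes the sign (-1)^(a+m) and the outer one (-1)^m, which is what
  -- `bilinearδ` prescribes.
  rw [h1, map_add, map_zsmul, evalCochain_δ (by omega) _ b (b + 1) _ rfl, LinearMap.add_apply,
    LinearMap.smul_apply, LinearMap.smul_apply, smul_add, smul_smul, add_comm,
    Int.negOnePow_add, ← Units.val_mul, mul_comm]
  rfl

/-- Exchanging the arguments of a family of bilinear maps. -/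
def bilinearSwap (n : ℤ) : BilinearCochain P X E n ≃ₗ[R] BilinearCochain X P E n where
  -- The sign (-1)^(ab) makes the exchange of arguments commute with the differentials.
  toFun φ := .mk fun b a h => ((a * b).negOnePow : ℤ) • (φ.app a b (by omega)).flip
  map_add' φ ψ := by
    refine BilinearCochain.ext_app fun b a h y x => ?_
    exact smul_add ((a * b).negOnePow : ℤ) (φ.app a b (by omega) x y) (ψ.app a b (by omega) x y)
  map_smul' r φ := by
    refine BilinearCochain.ext_app fun b a h y x => ?_
    exact smul_comm ((a * b).negOnePow : ℤ) r (φ.app a b (by omega) x y)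
  invFun φ := .mk fun a b h => ((a * b).negOnePow : ℤ) • (φ.app b a (by omega)).flip
  left_inv φ := by
    refine BilinearCochain.ext_app fun a b h x y => ?_
    change ((a * b).negOnePow : ℤ) • ((a * b).negOnePow : ℤ) • φ.app a b h x y = _
    rw [smul_smul, ← Units.val_mul, Int.units_mul_self, Units.val_one, one_smul]
  right_inv φ := by
    refine BilinearCochain.ext_app fun a b h x y => ?_
    change ((b * a).negOnePow : ℤ) • ((b * a).negOnePow : ℤ) • φ.app a b h x y = _
    rw [smul_smul, ← Units.val_mul, Int.units_mul_self, Units.val_one, one_smul]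

theorem bilinearSwap_δ {n m : ℤ} (hm : n + 1 = m) (φ : BilinearCochain P X E n) :
    bilinearSwap m (bilinearδ hm φ) = bilinearδ hm (bilinearSwap n φ) := by
  refine BilinearCochain.ext_app fun b a h y x => ?_
  rw [bilinearδ_apply]
  change ((a * b).negOnePow : ℤ) • (bilinearδ hm φ).app a b (by omega) x y =
    (m.negOnePow : ℤ) • (((a * (b + 1)).negOnePow : ℤ) • φ.app a (b + 1) (by omega) x (X.d b (b + 1) y) +
      (b.negOnePow : ℤ) • ((((a + 1) * b).negOnePow : ℤ) •
        φ.app (a + 1) b (by omega) (P.d a (a + 1) x) y))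
  rw [bilinearδ_apply]
  simp only [smul_add, smul_smul, ← Units.val_mul, mul_add, add_mul, Int.negOnePow_add, one_mul,
    mul_one]
  rw [add_comm]
  congr 3
  · exact mul_left_comm _ _ _
  · rw [mul_left_comm b.negOnePow, Int.units_mul_self, mul_one, mul_comm]

/-- The exactness of the sequence of families of bilinear maps. -/
def BilinearExact (P X : CochainComplex (ModuleCat.{u} R) ℤ) (E : ModuleCat.{u} R) : Prop :=
  ∀ (m n k : ℤ) (hm : m + 1 = n) (hk : n + 1 = k) (φ : BilinearCochain P X E n),
    bilinearδ hk φ = 0 → ∃ ψ : BilinearCochain P X E m, bilinearδ hm ψ = φ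

theorem acyclic_homComplex_tensorObj_iff_bilinearExact :
    (homComplex (HomologicalComplex.tensorObj P X) (asComplex E)).Acyclic ↔
      BilinearExact P X E := by
  rw [acyclic_homComplex_iff]
  refine forall_congr' fun m => forall_congr' fun n => forall_congr' fun k =>
    forall_congr' fun hm => forall_congr' fun hk =>
      (tensorCochainEquiv n).toEquiv.forall_congr fun z => imp_congr ?_ ?_
  · rw [← (tensorCochainEquiv k).map_eq_zero_iff, tensorCochainEquiv_δ hk]
    rfl
  · refine (tensorCochainEquiv m).toEquiv.exists_congr fun w => ?_
    rw [← (tensorCochainEquiv n).injective.eq_iff, tensorCochainEquiv_δ hm]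
    rfl

theorem acyclic_homComplex_homComplex_iff_bilinearExact :
    (homComplex P (homComplex X (asComplex E))).Acyclic ↔ BilinearExact P X E := by
  rw [acyclic_homComplex_iff]
  refine forall_congr' fun m => forall_congr' fun n => forall_congr' fun k =>
    forall_congr' fun hm => forall_congr' fun hk =>
      (homCochainEquiv n).toEquiv.forall_congr fun z => imp_congr ?_ ?_
  · rw [← (homCochainEquiv k).map_eq_zero_iff, homCochainEquiv_δ hk]
    rfl
  · refine (homCochainEquiv m).toEquiv.exists_congr fun w => ?_
    rw [← (homCochainEquiv n).injective.eq_iff, homCochainEquiv_δ hm]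
    rfl

theorem BilinearExact.swap_iff : BilinearExact P X E ↔ BilinearExact X P E := by
  refine forall_congr' fun m => forall_congr' fun n => forall_congr' fun k =>
    forall_congr' fun hm => forall_congr' fun hk =>
      (bilinearSwap n).toEquiv.forall_congr fun z => imp_congr ?_ ?_
  · rw [← (bilinearSwap k).map_eq_zero_iff, bilinearSwap_δ hk]
    rfl
  · refine (bilinearSwap m).toEquiv.exists_congr fun w => ?_
    rw [← (bilinearSwap n).injective.eq_iff, bilinearSwap_δ hm]
    rfl

/-- No resolution is involved: both sides are exactness of one and the same complex of bilinear
maps, up to the sign of `bilinearSwap`. -/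
theorem acyclic_homComplex_homComplex_swap :
    (homComplex P (homComplex X (asComplex E))).Acyclic ↔
      (homComplex X (homComplex P (asComplex E))).Acyclic := by
  rw [acyclic_homComplex_homComplex_iff_bilinearExact, BilinearExact.swap_iff,
    acyclic_homComplex_homComplex_iff_bilinearExact]

theorem acyclic_homComplex_tensorObj_iff :
    (homComplex (HomologicalComplex.tensorObj P X) (asComplex E)).Acyclic ↔
      (homComplex P (homComplex X (asComplex E))).Acyclic := by
  rw [acyclic_homComplex_tensorObj_iff_bilinearExact,
    acyclic_homComplex_homComplex_iff_bilinearExact]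

end Bilinear

end DerivedModule

namespace DerivedModule

/-! ### K-injectivity and invariance of Hom under quasi-isomorphisms -/

section Precomposition

variable {R : Type u} [CommRing R]

open CochainComplex.HomComplex

/-- A chain map is a cocycle of degree 0, and a cochain bounding it is a null homotopy. -/
theorem isKInjective_of_acyclic_homComplex (J : CochainComplex (ModuleCat.{u} R) ℤ)
    (h : ∀ K : CochainComplex (ModuleCat.{u} R) ℤ, K.Acyclic → (homComplex K J).Acyclic) :
    J.IsKInjective where
  nonempty_homotopy_zero {K} f hK := by
    obtain ⟨w, hw⟩ := (acyclic_homComplex_iff K J).1 (h K hK) (-1) 0 1 rfl rfl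
      (Cochain.ofHom f) (by simp)
    exact ⟨(Cochain.equivHomotopy f 0).symm ⟨w, by rw [hw]; simp⟩⟩

theorem acyclic_homComplex_of_isKInjective {K J : CochainComplex (ModuleCat.{u} R) ℤ}
    [J.IsKInjective] (hK : K.Acyclic) : (homComplex K J).Acyclic :=
  (acyclic_homComplex_iff K J).2 fun m _ k hm hk z hz =>
    CochainComplex.IsKInjective.eq_δ_of_cocycle (Cocycle.mk z k hk hz) hK m hm

/-- Precomposition with a morphism of complexes, as a morphism of Hom complexes. -/
noncomputable def homComplexPrecomp {X' X : CochainComplex (ModuleCat.{u} R) ℤ} (f : X' ⟶ X)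
    (J : CochainComplex (ModuleCat.{u} R) ℤ) : homComplex X J ⟶ homComplex X' J where
  f n := ModuleCat.ofHom
    { toFun := fun z : Cochain X J n => (Cochain.ofHom f).comp z (zero_add n)
      map_add' := fun _ _ => Cochain.comp_add _ _ _ _
      map_smul' := fun _ _ => Cochain.comp_smul _ _ _ _ }
  comm' _ j _ := ModuleCat.hom_ext (LinearMap.ext fun z => δ_ofHom_comp f z j)

attribute [local instance] HasDerivedCategory.standard

open DerivedCategory

/-- Since J is K-injective, cohomology classes of the Hom complexes are morphisms in the derived
category, where f is invertible. -/
instance quasiIso_homComplexPrecomp {X' X : CochainComplex (ModuleCat.{u} R) ℤ} (f : X' ⟶ X)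
    [QuasiIso f] (J : CochainComplex (ModuleCat.{u} R) ℤ) [J.IsKInjective] :
    QuasiIso (homComplexPrecomp f J) := by
  let q := HomotopyCategory.quotient (ModuleCat.{u} R) (.up ℤ)
  have : IsIso (Qh.map (q.map f)) :=
    (NatIso.isIso_map_iff (quotientCompQhIso (ModuleCat.{u} R)) f).2 inferInstance
  have hpre (n : ℤ) (z : Cocycle X J n) :
      CohomologyClass.toHom (CohomologyClass.mk (z.precomp f)) =
        q.map f ≫ CohomologyClass.toHom (CohomologyClass.mk z) := by
    rw [CohomologyClass.toHom_mk, CohomologyClass.toHom_mk, Cocycle.equivHomShift_symm_precomp,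
      Functor.map_comp]
  apply quasiIso_of_elements
  · intro i j k hij hjk x y hx hxy
    have h1 : CohomologyClass.toHom (CohomologyClass.mk ((Cocycle.mk (F := X) (G := J)
        x k hjk hx).precomp f)) = 0 := by
      rw [CohomologyClass.toHom_mk_eq_zero_iff, mem_coboundaries_iff _ i hij]
      exact ⟨y, hxy.symm⟩
    rw [hpre] at h1
    have h2 := congrArg (fun t => Qh.map t) h1
    simp only [Functor.map_comp, Functor.map_zero] at h2
    have h3 := (cancel_epi (Qh.map (q.map f))).1 (h2.trans comp_zero.symm)
    rw [← Qh.map_zero] at h3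
    have h4 := (CochainComplex.IsKInjective.Qh_map_bijective _ _).1 h3
    rw [CohomologyClass.toHom_mk_eq_zero_iff, mem_coboundaries_iff _ i hij] at h4
    obtain ⟨w, hw⟩ := h4
    exact ⟨w, hw.symm⟩
  · intro i j k hij hjk z hz
    obtain ⟨g, hg⟩ := (CochainComplex.IsKInjective.Qh_map_bijective (q.obj X) (J⟦j⟧)).2
      (inv (Qh.map (q.map f)) ≫ Qh.map (CohomologyClass.toHom (CohomologyClass.mk
        (Cocycle.mk (F := X') (G := J) z k hjk hz))))
    obtain ⟨c, rfl⟩ := (CohomologyClass.toHom_bijective X J j).2 g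
    obtain ⟨x, rfl⟩ := c.mk_surjective
    rw [IsIso.eq_inv_comp, ← Functor.map_comp, ← hpre] at hg
    have h1 := (CochainComplex.IsKInjective.Qh_map_bijective _ _).1 hg
    rw [← sub_eq_zero, ← map_sub, ← CohomologyClass.mk_sub,
      CohomologyClass.toHom_mk_eq_zero_iff, mem_coboundaries_iff _ i hij] at h1
    obtain ⟨w, hw⟩ := h1
    refine ⟨x.1, -w, x.δ_eq_zero k, ?_⟩
    have h2 : δ i j (-w) = (show Cochain X' J j from z) -
        (Cochain.ofHom f).comp x.1 (zero_add j) := by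
      rw [δ_neg, hw]
      exact neg_sub _ _
    exact sub_eq_iff_eq_add'.1 h2.symm

end Precomposition

/-! ### Derived duality with an injective module -/

section Duality

variable {R : Type u} [CommRing R]

attribute [local instance] HasDerivedCategory.standard

open DerivedCategory

/-- The projective resolution of a module, as a complex with a quasi-isomorphism to it. -/
noncomputable def ofProjectiveResolution (N : ModuleCat.{u} R) :
    (projectiveResolution N).cochainComplex ⟶ asComplex N :=
  (projectiveResolution N).π'

instance (N : ModuleCat.{u} R) : QuasiIso (ofProjectiveResolution N) :=
  inferInstanceAs (QuasiIso (projectiveResolution N).π')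

theorem homVanish_asComplex_iff (N : ModuleCat.{u} R) (Y : CochainComplex (ModuleCat.{u} R) ℤ) :
    HomVanish (Q.obj (asComplex N)) (Q.obj Y) ↔
      (homComplex (projectiveResolution N).cochainComplex Y).Acyclic := by
  rw [acyclic_homComplex_of_isKProjective_iff]
  exact (homVanish_iff_of_quasiIso (ofProjectiveResolution N) (𝟙 Y)).symm

theorem isKInjective_asComplex {E : ModuleCat.{u} R} (hE : Module.Injective R E) :
    (asComplex E).IsKInjective := by
  refine isKInjective_of_acyclic_homComplex _ fun K hK => acyclic_homComplex_asComplex hE hK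

/-- With P a projective resolution of N, the dual of P ⊗ Y is Hom(P, Hom(Y, E)), and P is
K-projective. -/
theorem acyclic_derivedTensor_iff {E : ModuleCat.{u} R} (hE : Module.Injective R E)
    (hE' : IsCogenerator E) (N : ModuleCat.{u} R) (Y : CochainComplex (ModuleCat.{u} R) ℤ) :
    (derivedTensor N Y).Acyclic ↔
      HomVanish (Q.obj (asComplex N)) (Q.obj (homComplex Y (asComplex E))) := by
  rw [derivedTensor, ← acyclic_homComplex_asComplex_iff_acyclic hE hE',
    acyclic_homComplex_tensorObj_iff, homVanish_asComplex_iff]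

theorem isZero_Q_obj {X : CochainComplex (ModuleCat.{u} R) ℤ} (hX : X.Acyclic) :
    IsZero (Q.obj X) := by
  rw [acyclic_iff] at hX
  have : QuasiIso (0 : X ⟶ X) := quasiIso_of_elements _
    (fun i j k hij hjk x _ hx _ => by
      obtain ⟨y, hy⟩ := hX i j k hij hjk x hx
      exact ⟨y, hy.symm⟩)
    (fun i j k hij hjk z hz => by
      obtain ⟨y, hy⟩ := hX i j k hij hjk z hz
      exact ⟨0, y, map_zero _, by simp [hy]⟩)
  have h : IsIso (Q.map (0 : X ⟶ X)) := inferInstance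
  rw [Functor.map_zero, isIsoZero_iff_source_target_isZero] at h
  exact h.1

theorem homVanish_of_acyclic_right (X : CochainComplex (ModuleCat.{u} R) ℤ)
    {Y : CochainComplex (ModuleCat.{u} R) ℤ} (hY : Y.Acyclic) :
    HomVanish (Q.obj X) (Q.obj Y) :=
  fun _ _ => ((shiftFunctor _ _).map_isZero (isZero_Q_obj hY)).eq_of_tgt _ _

theorem homVanish_of_acyclic_left {X : CochainComplex (ModuleCat.{u} R) ℤ} (hX : X.Acyclic)
    (Y : CochainComplex (ModuleCat.{u} R) ℤ) : HomVanish (Q.obj X) (Q.obj Y) :=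
  fun _ _ => (isZero_Q_obj hX).eq_of_src _ _

/-- For K acyclic, exchanging arguments turns Hom(K, Hom(P, E)) into Hom(P, Hom(K, E)); here Hom(K,
E) is acyclic and P is K-projective. -/
theorem isKInjective_homComplex_asComplex {P : CochainComplex (ModuleCat.{u} R) ℤ}
    [P.IsKProjective] {E : ModuleCat.{u} R} (hE : Module.Injective R E) :
    (homComplex P (asComplex E)).IsKInjective := by
  refine isKInjective_of_acyclic_homComplex _ fun K hK => ?_
  rw [acyclic_homComplex_homComplex_swap, acyclic_homComplex_of_isKProjective_iff]
  exact homVanish_of_acyclic_right _ (acyclic_homComplex_asComplex hE hK)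

/-- Replacing N by a projective resolution P changes Hom(N, E) only by a quasi-isomorphism and makes
it K-injective, so the underived exchange of arguments applies. -/
theorem homVanish_homComplex_swap {E : ModuleCat.{u} R} (hE : Module.Injective R E)
    (N : ModuleCat.{u} R) (X : CochainComplex (ModuleCat.{u} R) ℤ) :
    HomVanish (Q.obj X) (Q.obj (homComplex (asComplex N) (asComplex E))) ↔
      HomVanish (Q.obj (asComplex N)) (Q.obj (homComplex X (asComplex E))) := by
  have := isKInjective_asComplex hE
  have := isKInjective_homComplex_asComplex (P := (projectiveResolution N).cochainComplex) hE
  rw [homVanish_iff_of_quasiIso (𝟙 X) (homComplexPrecomp (ofProjectiveResolution N) (asComplex E)),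
    ← acyclic_homComplex_of_isKInjective_iff, acyclic_homComplex_homComplex_swap,
    homVanish_asComplex_iff]

end Duality

end DerivedModule

namespace DerivedModule

/-! ### Hom between modules placed in degree 0 -/

section SingleHom

variable {R : Type u} [CommRing R]

open CochainComplex.HomComplex

/-- Cochains of degree `0` between modules are linear maps. -/
noncomputable def cochainAsComplexEquiv (N E : ModuleCat.{u} R) :
    Cochain (asComplex N) (asComplex E) 0 ≃ₗ[R] (N →ₗ[R] E) :=
  LinearEquiv.ofBijective ((LinearMap.lcomp R E
      (HomologicalComplex.singleObjXSelf (.up ℤ) 0 N).inv.hom) ∘ₗ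
      evalCochain (X := asComplex N) (E := E) 0 (add_zero 0)) (by
    constructor
    · rw [← LinearMap.ker_eq_bot, LinearMap.ker_eq_bot']
      intro z hz
      refine evalCochain_ext fun p hp => ?_
      obtain rfl : p = 0 := by omega
      rw [map_zero]
      refine LinearMap.ext fun x => ?_
      have h1 := LinearMap.congr_fun hz ((HomologicalComplex.singleObjXSelf (.up ℤ) 0 N).hom x)
      have h2 : (HomologicalComplex.singleObjXSelf (.up ℤ) 0 N).inv
          ((HomologicalComplex.singleObjXSelf (.up ℤ) 0 N).hom x) = x := by
        rw [← ModuleCat.comp_apply, Iso.hom_inv_id, ModuleCat.id_apply]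
      rw [← h2]
      exact h1
    · intro f
      refine ⟨mkCochain fun p hp => f ∘ₗ
        (HomologicalComplex.singleObjXIsoOfEq (.up ℤ) 0 N p (by omega)).hom.hom, ?_⟩
      rw [LinearMap.comp_apply, evalCochain_mkCochain]
      refine LinearMap.ext fun x => congrArg f ?_
      change (HomologicalComplex.singleObjXSelf (.up ℤ) 0 N).hom
        ((HomologicalComplex.singleObjXSelf (.up ℤ) 0 N).inv x) = x
      rw [← ModuleCat.comp_apply, Iso.inv_hom_id, ModuleCat.id_apply])

theorem subsingleton_cochain_asComplex (N E : ModuleCat.{u} R) {n : ℤ} (hn : n ≠ 0) :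
    Subsingleton (Cochain (asComplex N) (asComplex E) n) := by
  refine ⟨fun z z' => Cochain.ext _ _ fun p q hpq => ?_⟩
  by_cases hp : p = 0
  · exact (HomologicalComplex.isZero_single_obj_X _ _ _ _ (by omega)).eq_of_tgt _ _
  · exact (HomologicalComplex.isZero_single_obj_X _ _ _ _ hp).eq_of_src _ _

theorem nonempty_homComplex_asComplex_iso (N E : ModuleCat.{u} R) :
    Nonempty (homComplex (asComplex N) (asComplex E) ≅ asComplex (ModuleCat.of R (N →ₗ[R] E))) := by
  set K := homComplex (asComplex N) (asComplex E) with hK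
  have hz : ∀ n : ℤ, n ≠ 0 → IsZero (K.X n) := fun n hn => by
    have := subsingleton_cochain_asComplex N E hn
    exact ModuleCat.isZero_of_subsingleton (ModuleCat.of R (Cochain (asComplex N) (asComplex E) n))
  have h1 : K.IsStrictlyGE 0 := by
    rw [CochainComplex.isStrictlyGE_iff]
    exact fun i hi => hz i (by omega)
  have h2 : K.IsStrictlyLE 0 := by
    rw [CochainComplex.isStrictlyLE_iff]
    exact fun i hi => hz i (by omega)
  obtain ⟨A, ⟨e⟩⟩ := K.exists_iso_single 0
  let e₀ : K.X 0 ≅ A := (HomologicalComplex.eval _ _ 0).mapIso e ≪≫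
    HomologicalComplex.singleObjXSelf (.up ℤ) 0 A
  let e₁ : K.X 0 ≅ ModuleCat.of R (N →ₗ[R] E) := (cochainAsComplexEquiv N E).toModuleIso
  exact ⟨e ≪≫ (HomologicalComplex.single _ _ 0).mapIso (e₀.symm ≪≫ e₁)⟩

attribute [local instance] HasDerivedCategory.standard

open DerivedCategory

/-- Hom-tensor symmetry: morphisms from `X` to `Hom(N, E)` in the derived category. -/
theorem homVanish_linearMap_iff {E : ModuleCat.{u} R} (hE : Module.Injective R E)
    (N : ModuleCat.{u} R) (X : CochainComplex (ModuleCat.{u} R) ℤ) :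
    HomVanish (Q.obj X) (Q.obj (asComplex (ModuleCat.of R (N →ₗ[R] E)))) ↔
      HomVanish (Q.obj (asComplex N)) (Q.obj (homComplex X (asComplex E))) := by
  obtain ⟨e⟩ := nonempty_homComplex_asComplex_iso N E
  rw [← homVanish_homComplex_swap hE]
  exact HomVanish.iff_of_iso (Iso.refl _) (Q.mapIso e.symm)

end SingleHom

/-! ### Retracts and finite biproducts -/

section Retracts

universe v' u'

variable {C : Type u'} [Category.{v'} C] [HasShift C ℤ] [Preadditive C]

theorem HomVanish.of_retract_right {X Y Y' : C} (i : Y ⟶ Y') (r : Y' ⟶ Y) (hir : i ≫ r = 𝟙 Y)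
    (h : HomVanish X Y') : HomVanish X Y := by
  intro n f
  rw [← Category.comp_id f, ← (shiftFunctor C n).map_id Y, ← hir, (shiftFunctor C n).map_comp,
    ← Category.assoc, h n (f ≫ i⟦n⟧'), zero_comp]

theorem HomVanish.of_retract_left {X X' Y : C} (i : X ⟶ X') (r : X' ⟶ X) (hir : i ≫ r = 𝟙 X)
    (h : HomVanish X' Y) : HomVanish X Y := by
  intro n f
  rw [← Category.id_comp f, ← hir, Category.assoc, h n (r ≫ f), comp_zero]

theorem HomVanish.iff_forall_right {ι : Type*} [Fintype ι] {X B : C} {Y : ι → C}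
    (i : ∀ j, Y j ⟶ B) (p : ∀ j, B ⟶ Y j) (hip : ∀ j, i j ≫ p j = 𝟙 _)
    (hsum : ∑ j, p j ≫ i j = 𝟙 B) [∀ n : ℤ, (shiftFunctor C n).Additive] :
    HomVanish X B ↔ ∀ j, HomVanish X (Y j) := by
  refine ⟨fun h j => h.of_retract_right (i j) (p j) (hip j), fun h n f => ?_⟩
  rw [← Category.comp_id f, ← (shiftFunctor C n).map_id B, ← hsum, Functor.map_sum,
    Preadditive.comp_sum]
  refine Finset.sum_eq_zero fun j _ => ?_
  rw [(shiftFunctor C n).map_comp, ← Category.assoc, h j n (f ≫ (p j)⟦n⟧'), zero_comp]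

theorem HomVanish.iff_forall_left {ι : Type*} [Fintype ι] {X B : C} {Y : ι → C}
    (i : ∀ j, Y j ⟶ B) (p : ∀ j, B ⟶ Y j) (hip : ∀ j, i j ≫ p j = 𝟙 _)
    (hsum : ∑ j, p j ≫ i j = 𝟙 B) :
    HomVanish B X ↔ ∀ j, HomVanish (Y j) X := by
  refine ⟨fun h j => h.of_retract_left (i j) (p j) (hip j), fun h n f => ?_⟩
  rw [← Category.id_comp f, ← hsum, Preadditive.sum_comp]
  refine Finset.sum_eq_zero fun j _ => ?_
  rw [Category.assoc, h j n (i j ≫ f), comp_zero]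

end Retracts

/-! ### Vanishing of morphisms into vector spaces -/

section VectorSpaces

variable {R : Type u} [CommRing R]

attribute [local instance] HasDerivedCategory.standard

open DerivedCategory CochainComplex.HomComplex

/-- The functor `N ↦ (J → N)`. -/
def powerFunctor (R : Type u) [CommRing R] (J : Type u) : ModuleCat.{u} R ⥤ ModuleCat.{u} R where
  obj N := ModuleCat.of R (J → N)
  map f := ModuleCat.ofHom (f.hom.compLeft J)

instance (J : Type u) : (powerFunctor R J).Additive where
  map_add := rfl

instance (J : Type u) : (powerFunctor R J).PreservesHomology := by
  refine Functor.preservesHomology_of_map_exact _ fun S hS => ?_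
  rw [ShortComplex.moduleCat_exact_iff] at hS ⊢
  intro x hx
  choose y hy using fun j => hS (x j) (congrFun hx j)
  exact ⟨y, funext hy⟩

/-- The complex of products. -/
abbrev powerComplex (J : Type u) (Y : CochainComplex (ModuleCat.{u} R) ℤ) :
    CochainComplex (ModuleCat.{u} R) ℤ :=
  ((powerFunctor R J).mapHomologicalComplex _).obj Y

theorem acyclic_homComplex_powerComplex {J : Type u} {X Y : CochainComplex (ModuleCat.{u} R) ℤ}
    (h : (homComplex X Y).Acyclic) : (homComplex X (powerComplex J Y)).Acyclic := by
  rw [acyclic_homComplex_iff] at h ⊢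
  intro m n k hm hk z hz
  let π (j : J) : powerComplex J Y ⟶ Y :=
    { f := fun p => ModuleCat.ofHom (LinearMap.proj j) }
  have h1 (j : J) := h m n k hm hk (z.comp (Cochain.ofHom (π j)) (add_zero n)) (by
    rw [δ_comp_ofHom, hz, Cochain.zero_comp])
  choose w hw using h1
  let W : Cochain X (powerComplex J Y) m := Cochain.mk fun p q hpq =>
    ModuleCat.ofHom (LinearMap.pi fun j => ((w j).v p q hpq).hom)
  have hW (j : J) : W.comp (Cochain.ofHom (π j)) (add_zero m) = w j := by
    refine Cochain.ext _ _ fun p q hpq => ?_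
    rw [Cochain.comp_zero_cochain_v, Cochain.ofHom_v]
    rfl
  refine ⟨W, Cochain.ext _ _ fun p q hpq => ModuleCat.hom_ext (LinearMap.ext fun x =>
    funext fun j => ?_)⟩
  have h2 : (δ m n W).comp (Cochain.ofHom (π j)) (add_zero n) =
      z.comp (Cochain.ofHom (π j)) (add_zero n) := by
    rw [← δ_comp_ofHom, hW, hw]
  have h3 := congrArg (fun t => t.v p q hpq) h2
  simp only [Cochain.comp_zero_cochain_v, Cochain.ofHom_v] at h3
  exact congrArg (fun t => ModuleCat.Hom.hom t x) h3

/-- Powers of modules are exact and preserve K-injectivity, so the power of a K-injective resolution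
of Y resolves the power of Y. -/
theorem homVanish_powerComplex {J : Type u} {X Y : CochainComplex (ModuleCat.{u} R) ℤ}
    (h : HomVanish (Q.obj X) (Q.obj Y)) : HomVanish (Q.obj X) (Q.obj (powerComplex J Y)) := by
  have hI : (powerComplex J (kInjectiveResolution Y)).IsKInjective :=
    isKInjective_of_acyclic_homComplex _ fun K hK =>
      acyclic_homComplex_powerComplex (acyclic_homComplex_of_isKInjective hK)
  rw [homVanish_iff_of_quasiIso (𝟙 X) (((powerFunctor R J).mapHomologicalComplex _).map
    (toKInjectiveResolution Y)), ← acyclic_homComplex_of_isKInjective_iff]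
  refine acyclic_homComplex_powerComplex ?_
  rwa [acyclic_homComplex_of_isKInjective_iff,
    ← homVanish_iff_of_quasiIso (𝟙 X) (toKInjectiveResolution Y)]

theorem homVanish_asComplex_of_retract {X : CochainComplex (ModuleCat.{u} R) ℤ}
    {N N' : ModuleCat.{u} R} (i : N →ₗ[R] N') (r : N' →ₗ[R] N) (hir : r ∘ₗ i = LinearMap.id)
    (h : HomVanish (Q.obj X) (Q.obj (asComplex N'))) :
    HomVanish (Q.obj X) (Q.obj (asComplex N)) := by
  refine h.of_retract_right (Q.map ((HomologicalComplex.single _ _ 0).map (ModuleCat.ofHom i)))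
    (Q.map ((HomologicalComplex.single _ _ 0).map (ModuleCat.ofHom r))) ?_
  rw [← Functor.map_comp, ← Functor.map_comp, ← ModuleCat.ofHom_comp, hir]
  simp

/-- K is a retract of W, and W is a retract of a power of K. The power replaces the direct sum given
by a basis, because morphisms out of X commute with products but in general not with infinite sums.
-/
theorem homVanish_vectorSpace_iff (K : Type u) [Field K] [Algebra R K] (W : Type u)
    [AddCommGroup W] [Module R W] [Module K W] [IsScalarTower R K W] [Nontrivial W]
    (X : CochainComplex (ModuleCat.{u} R) ℤ) :
    HomVanish (Q.obj X) (Q.obj (asComplex (ModuleCat.of R W))) ↔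
      HomVanish (Q.obj X) (Q.obj (asComplex (ModuleCat.of R K))) := by
  constructor
  · intro h
    obtain ⟨w, hw⟩ := exists_ne (0 : W)
    obtain ⟨r, hr⟩ := LinearMap.exists_leftInverse_of_injective (LinearMap.toSpanSingleton K W w)
      (LinearMap.ker_eq_bot.2 (smul_left_injective K hw))
    exact homVanish_asComplex_of_retract (N' := ModuleCat.of R W)
      ((LinearMap.toSpanSingleton K W w).restrictScalars R) (r.restrictScalars R)
      (LinearMap.ext fun x => LinearMap.congr_fun hr x) h
  · intro h
    let b := Module.Basis.ofVectorSpace K W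
    let J := Module.Basis.ofVectorSpaceIndex K W
    let i : W →ₗ[K] (J → K) := Finsupp.lcoeFun ∘ₗ b.repr.toLinearMap
    have hi : Function.Injective i := DFunLike.coe_injective.comp b.repr.injective
    obtain ⟨r, hr⟩ := LinearMap.exists_leftInverse_of_injective i (LinearMap.ker_eq_bot.2 hi)
    have h1 := homVanish_powerComplex (J := J) h
    have h2 : HomVanish (Q.obj X) (Q.obj (asComplex (ModuleCat.of R (J → K)))) :=
      h1.of_iso (Iso.refl _) (Q.mapIso ((HomologicalComplex.singleMapHomologicalComplex
        (powerFunctor R J) (.up ℤ) 0).app (ModuleCat.of R K)))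
    exact homVanish_asComplex_of_retract (N' := ModuleCat.of R (J → K)) (i.restrictScalars R)
      (r.restrictScalars R) (LinearMap.ext fun x => LinearMap.congr_fun hr x) h2

end VectorSpaces

end DerivedModule

namespace DerivedModule

/-! ### Injective envelopes and the cogenerator ⨁ E(R/m) -/

section InjectiveModules

variable {R : Type u} [CommRing R]

/-- The condition on annihilators defines the map on the cyclic submodule Rx ≅ R/ann(x); injectivity
extends it to N. -/
theorem exists_linearMap_apply_eq {E : ModuleCat.{u} R} (hE : Module.Injective R E) {N : Type u}
    [AddCommGroup N] [Module R N] (x : N) (e : E) (h : ∀ r : R, r • x = 0 → r • e = 0) :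
    ∃ f : N →ₗ[R] E, f x = e := by
  let g : (R ⧸ LinearMap.ker (LinearMap.toSpanSingleton R N x)) →ₗ[R] E :=
    Submodule.liftQ _ (LinearMap.toSpanSingleton R E e) fun r hr => h r hr
  let i : (R ⧸ LinearMap.ker (LinearMap.toSpanSingleton R N x)) →ₗ[R] N :=
    Submodule.liftQ _ (LinearMap.toSpanSingleton R N x) le_rfl
  obtain ⟨f, hf⟩ := hE.out i (LinearMap.ker_eq_bot.1 (Submodule.ker_liftQ_eq_bot' _ _ rfl)) g
  refine ⟨f, ?_⟩
  have h1 : f ((1 : R) • x) = (1 : R) • e := hf (Submodule.Quotient.mk 1)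
  simpa using h1

open scoped DirectSum in
/-- Over a noetherian ring, direct sums of injective modules are injective. -/
theorem injective_directSum [IsNoetherianRing R] {ι : Type u} (E : ι → ModuleCat.{u} R)
    (hE : ∀ i, Module.Injective R (E i)) : Module.Injective R (⨁ i, E i) := by
  classical
  refine Module.Baer.injective fun I g => ?_
  -- By Baer's criterion only ideals matter. The ideal is finitely generated, so its image has only
  -- finitely many nonzero coordinates, and each coordinate extends separately.
  obtain ⟨s, hs⟩ : ∃ s : Finset ι, ∀ x : I, ∀ i ∉ s, g x i = 0 := by
    obtain ⟨t, ht⟩ := (IsNoetherian.noetherian (⊤ : Submodule R I))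
    refine ⟨t.biUnion fun x => (g x).support, fun x i hi => ?_⟩
    have hx : x ∈ Submodule.span R (t : Set I) := ht ▸ Submodule.mem_top
    induction hx using Submodule.span_induction with
    | mem x hx =>
      by_contra h
      exact hi (Finset.mem_biUnion.2 ⟨x, hx, DFinsupp.mem_support_iff.2 h⟩)
    | zero => rw [map_zero]; rfl
    | add x y _ _ hx hy => rw [map_add, DirectSum.add_apply, hx, hy, add_zero]
    | smul r x _ hx => rw [map_smul, DirectSum.smul_apply, hx, smul_zero]
  choose h hh using fun i => (Module.Baer.of_injective (hE i)) I (DirectSum.component R ι _ i ∘ₗ g)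
  refine ⟨∑ i ∈ s, DirectSum.lof R ι (fun i => E i) i ∘ₗ h i, fun x hx => ?_⟩
  refine DirectSum.ext_component R fun j => ?_
  rw [LinearMap.sum_apply, map_sum]
  have h1 (i : ι) : DirectSum.component R ι (fun i => E i) j ((DirectSum.lof R ι (fun i => E i) i ∘ₗ h i) x) =
      if i = j then g ⟨x, hx⟩ j else 0 := by
    split_ifs with hij
    · subst hij
      rw [LinearMap.comp_apply, hh i x hx, DirectSum.component.lof_self]
      rfl
    · rw [LinearMap.comp_apply, DirectSum.component.of, dif_neg hij]
  rw [Finset.sum_congr rfl fun i _ => h1 i, Finset.sum_ite_eq']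
  split_ifs with hj
  · rfl
  · exact (hs ⟨x, hx⟩ j hj).symm

/-- The embedding of a module into its injective envelope. -/
noncomputable def toInjectiveEnvelope (N : ModuleCat.{u} R) : N →ₗ[R] injectiveEnvelope N :=
  (exists_injectiveEnvelope (R := R) N).choose_spec.choose

theorem isInjectiveEnvelope_toInjectiveEnvelope (N : ModuleCat.{u} R) :
    IsInjectiveEnvelope (toInjectiveEnvelope N) :=
  (exists_injectiveEnvelope (R := R) N).choose_spec.choose_spec

theorem injective_injectiveEnvelope (N : ModuleCat.{u} R) :
    Module.Injective R (injectiveEnvelope N) :=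
  (isInjectiveEnvelope_toInjectiveEnvelope N).injective_module

/-- The injective envelope of `R ⧸ m`. -/
noncomputable abbrev localEnvelope (m : MaximalSpectrum R) : ModuleCat.{u} R :=
  injectiveEnvelope (ModuleCat.of R (R ⧸ m.asIdeal))

/-- A socle generator of the injective envelope of `R ⧸ m`. -/
theorem exists_localEnvelope_ne_zero (m : MaximalSpectrum R) :
    ∃ e : localEnvelope m, e ≠ 0 ∧ ∀ r ∈ m.asIdeal, r • e = 0 := by
  have hm := m.isMaximal
  refine ⟨toInjectiveEnvelope (ModuleCat.of R (R ⧸ m.asIdeal)) (1 : R ⧸ m.asIdeal), ?_, ?_⟩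
  · rw [Ne, ← (toInjectiveEnvelope _).map_zero,
      (isInjectiveEnvelope_toInjectiveEnvelope _).injective.eq_iff]
    exact (one_ne_zero : (1 : R ⧸ m.asIdeal) ≠ 0)
  · intro r hr
    rw [← map_smul]
    have : r • (1 : R ⧸ m.asIdeal) = 0 := by
      rw [Algebra.smul_def, mul_one]
      exact Ideal.Quotient.eq_zero_iff_mem.2 hr
    exact (congrArg _ this).trans (map_zero _)

/-- Multiplication by x is injective on R/m, hence on the essential extension. Injectivity of the
envelope gives a left inverse g, and by linearity x • g e = g (x • e) = e. -/
theorem bijective_smul_localEnvelope (m : MaximalSpectrum R) {x : R} (hx : x ∉ m.asIdeal) :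
    Function.Bijective fun e : localEnvelope m => x • e := by
  have hm := m.isMaximal
  have hi : Function.Injective (LinearMap.lsmul R (localEnvelope m) x) := by
    rw [← LinearMap.ker_eq_bot]
    refine (isInjectiveEnvelope_toInjectiveEnvelope _).essential _ ?_
    rw [Submodule.eq_bot_iff]
    rintro _ ⟨h1, y, rfl⟩
    obtain ⟨r, rfl⟩ : ∃ r : R, Ideal.Quotient.mk m.asIdeal r = y := Ideal.Quotient.mk_surjective y
    have h2 : toInjectiveEnvelope (ModuleCat.of R (R ⧸ m.asIdeal))
        (x • Ideal.Quotient.mk m.asIdeal r) = 0 := by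
      rw [map_smul]
      exact h1
    have h3 := (isInjectiveEnvelope_toInjectiveEnvelope _).injective (h2.trans (map_zero _).symm)
    have h4 : x * r ∈ m.asIdeal := by
      rw [← Ideal.Quotient.eq_zero_iff_mem, map_mul]
      rwa [Algebra.smul_def] at h3
    have h5 := (hm.isPrime.mem_or_mem h4).resolve_left hx
    have h6 : Ideal.Quotient.mk m.asIdeal r = 0 := Ideal.Quotient.eq_zero_iff_mem.2 h5
    exact (congrArg _ h6).trans (map_zero _)
  refine ⟨hi, fun e => ?_⟩
  obtain ⟨g, hg⟩ := (injective_injectiveEnvelope _).out _ hi LinearMap.id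
  refine ⟨g e, ?_⟩
  change x • g e = e
  rw [← map_smul]
  exact hg e

open scoped DirectSum in
/-- The injective cogenerator `⨁_m E(R ⧸ m)`. -/
noncomputable abbrev cogenerator (R : Type u) [CommRing R] : ModuleCat.{u} R :=
  ModuleCat.of R (⨁ m : MaximalSpectrum R, injectiveEnvelope (ModuleCat.of R (R ⧸ m.asIdeal)))

theorem injective_cogenerator [IsNoetherianRing R] : Module.Injective R (cogenerator R) :=
  injective_directSum _ fun _ => injective_injectiveEnvelope _

/-- The annihilator of a nonzero x lies in some maximal m, so x can be sent to a nonzero element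
killed by m. -/
theorem isCogenerator_of_exists {E : ModuleCat.{u} R} (hE : Module.Injective R E)
    (h : ∀ m : Ideal R, m.IsMaximal → ∃ e : E, e ≠ 0 ∧ ∀ r ∈ m, r • e = 0) : IsCogenerator E := by
  intro N _ _ x hx
  obtain ⟨m, hm, hxm⟩ := Ideal.exists_le_maximal (LinearMap.ker (LinearMap.toSpanSingleton R N x))
    fun h => hx (by
      have : (1 : R) ∈ LinearMap.ker (LinearMap.toSpanSingleton R N x) := h ▸ Submodule.mem_top
      simpa using this)
  obtain ⟨e, he, hme⟩ := h m hm
  obtain ⟨f, hf⟩ := exists_linearMap_apply_eq hE x e fun r hr => hme r (hxm hr)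
  exact ⟨f, hf ▸ he⟩

theorem isCogenerator_cogenerator [IsNoetherianRing R] : IsCogenerator (cogenerator R) := by
  classical
  refine isCogenerator_of_exists injective_cogenerator fun m hm => ?_
  obtain ⟨e, he, hme⟩ := exists_localEnvelope_ne_zero ⟨m, hm⟩
  refine ⟨DirectSum.lof R (MaximalSpectrum R) (fun m => localEnvelope m) ⟨m, hm⟩ e, fun h => he ?_,
    fun r hr => ?_⟩
  · have h1 := congrArg (DirectSum.component R (MaximalSpectrum R) (fun m => localEnvelope m)
      ⟨m, hm⟩) h
    rw [DirectSum.component.lof_self] at h1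
    exact h1.trans (map_zero _)
  · refine ((DirectSum.lof R (MaximalSpectrum R) (fun m => localEnvelope m) ⟨m, hm⟩).map_smul
      r e).symm.trans ?_
    rw [hme r hr, map_zero]

end InjectiveModules

/-! ### Localization as an exact left adjoint of restriction -/

section Localization

variable {R : Type u} [CommRing R]

/-- An injective module over a localization is injective. -/
theorem injective_restrictScalars_localization (S : Submonoid R) {E : ModuleCat.{u} (Localization S)}
    (hE : Module.Injective (Localization S) E) :
    Module.Injective R ((ModuleCat.restrictScalars (algebraMap R (Localization S))).obj E) where
  out := by
    intro X Y _ _ _ _ f hf g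
    let _ : Module R E := Module.compHom E (algebraMap R (Localization S))
    have : IsScalarTower R (Localization S) E := .of_algebraMap_smul fun _ _ => rfl
    have hu (s : S) : IsUnit (algebraMap R (Module.End R E) s) := by
      rw [Module.End.isUnit_iff]
      have h1 := IsLocalization.map_units (Localization S) s
      have h2 := (Module.End.isUnit_iff _).1 (h1.map (algebraMap (Localization S)
        (Module.End (Localization S) E)))
      exact h2
    let g' : X →ₗ[R] E := ⟨⟨fun x => g x, g.map_add⟩, g.map_smul⟩
    -- S acts invertibly on E, so g extends to the localization of X; localization keeps f
    -- injective, and the extension problem can be solved over the localized ring.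
    let G : LocalizedModule S X →ₗ[Localization S] E :=
      (IsLocalizedModule.lift S (LocalizedModule.mkLinearMap S X) g' hu).extendScalarsOfIsLocalization
        S (Localization S)
    obtain ⟨H, hH⟩ := hE.out (LocalizedModule.map S f) (LocalizedModule.map_injective S f hf) G
    refine ⟨⟨⟨fun y => H (LocalizedModule.mkLinearMap S Y y), fun a b => ?_⟩, fun r a => ?_⟩,
      fun x => ?_⟩
    · rw [map_add, map_add]
      rfl
    · refine (congrArg H (?_ : _ = algebraMap R (Localization S) r •
        LocalizedModule.mkLinearMap S Y a)).trans (H.map_smul _ _)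
      rw [map_smul, algebraMap_smul]
    · have h1 := hH (LocalizedModule.mkLinearMap S X x)
      have h2 : G (LocalizedModule.mkLinearMap S X x) = g x :=
        IsLocalizedModule.lift_apply S (LocalizedModule.mkLinearMap S X) g' hu x
      rw [h2] at h1
      refine Eq.trans ?_ h1
      change H _ = H _
      congr 1
      simp [LocalizedModule.mkLinearMap_apply, LocalizedModule.map_mk]

/-- The universal property of localization of modules. -/
noncomputable def localizedModuleHomEquiv (S : Submonoid R) (X : ModuleCat.{u} R)
    (Y : ModuleCat.{u} (Localization S)) :
    ((ModuleCat.localizedModuleFunctor.{u} S).obj X ⟶ Y) ≃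
      (X ⟶ (ModuleCat.restrictScalars (algebraMap R (Localization S))).obj Y) :=
  Equiv.ofBijective (fun g => ModuleCat.ofHom (X := X)
    (Y := (ModuleCat.restrictScalars (algebraMap R (Localization S))).obj Y)
    { toFun := fun x => g.hom (X.localizedModuleMkLinearMap S x)
      map_add' := fun x y => by
        rw [map_add]
        exact g.hom.map_add _ _
      map_smul' := fun r x => by
        rw [map_smul, ← algebraMap_smul (Localization S) r]
        exact g.hom.map_smul _ _ }) (by
    have hu' (s : S) : Function.Bijective fun y : Y => algebraMap R (Localization S) s • y :=
      (Module.End.isUnit_iff _).1 ((IsLocalization.map_units (Localization S) s).map (algebraMap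
        (Localization S) (Module.End (Localization S) Y)))
    constructor
    · intro g g' h
      refine ModuleCat.hom_ext (LinearMap.ext fun (y : X.localizedModule S) => ?_)
      obtain ⟨⟨x, s⟩, hs⟩ := IsLocalizedModule.surj S (X.localizedModuleMkLinearMap S) y
      refine (hu' s).1 ?_
      change algebraMap R (Localization S) s • g.hom y = algebraMap R (Localization S) s • g'.hom y
      have h1 : algebraMap R (Localization S) s • y = X.localizedModuleMkLinearMap S x := by
        rw [algebraMap_smul]
        exact hs
      refine (g.hom.map_smul _ _).symm.trans (Eq.trans ?_ (g'.hom.map_smul _ _))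
      refine (congrArg g.hom h1).trans (Eq.trans ?_ (congrArg g'.hom h1).symm)
      exact LinearMap.congr_fun (congrArg ModuleCat.Hom.hom h) x
    · intro f
      let _ : Module R Y := Module.compHom Y (algebraMap R (Localization S))
      have : IsScalarTower R (Localization S) Y := .of_algebraMap_smul fun _ _ => rfl
      let f' : X →ₗ[R] Y := ⟨⟨fun x => f.hom x, f.hom.map_add⟩, f.hom.map_smul⟩
      have hu (s : S) : IsUnit (algebraMap R (Module.End R Y) s) :=
        (Module.End.isUnit_iff _).2 (hu' s)
      refine ⟨ModuleCat.ofHom ((IsLocalizedModule.lift S (X.localizedModuleMkLinearMap S) f'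
        hu).extendScalarsOfIsLocalization S (Localization S)),
        ModuleCat.hom_ext (LinearMap.ext fun x => ?_)⟩
      exact IsLocalizedModule.lift_apply S (X.localizedModuleMkLinearMap S) f' hu x)

/-- Localization is left adjoint to restriction of scalars. -/
noncomputable def localizedModuleAdj (S : Submonoid R) :
    ModuleCat.localizedModuleFunctor.{u} S ⊣
      ModuleCat.restrictScalars.{u} (algebraMap R (Localization S)) :=
  Adjunction.mkOfHomEquiv
    { homEquiv := localizedModuleHomEquiv S
      homEquiv_naturality_left_symm := fun {X' X Y} f g => by
        obtain ⟨g, rfl⟩ := (localizedModuleHomEquiv S X Y).surjective g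
        rw [Equiv.symm_apply_apply, Equiv.symm_apply_eq]
        refine ModuleCat.hom_ext (LinearMap.ext fun x => ?_)
        exact congrArg g.hom (IsLocalizedModule.map_apply S (X'.localizedModuleMkLinearMap S)
          (X.localizedModuleMkLinearMap S) f.hom x).symm
      homEquiv_naturality_right := fun f g => rfl }

instance (S : Submonoid R) : (ModuleCat.localizedModuleFunctor.{u} S).PreservesHomology :=
  Functor.preservesHomology_of_map_exact _ fun T hT =>
    ModuleCat.localizedModuleFunctor_map_exact S T hT

instance (A : Type u) [CommRing A] [Algebra R A] :
    (ModuleCat.restrictScalars.{u} (algebraMap R A)).PreservesHomology :=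
  Functor.preservesHomology_of_map_exact _ fun T hT => by
    rw [ShortComplex.moduleCat_exact_iff] at hT ⊢
    exact hT

end Localization

end DerivedModule

namespace DerivedModule

/-! ### Adjunctions of module categories on derived categories -/

section Adjunction

variable {R A : Type u} [CommRing R] [CommRing A]

open CochainComplex.HomComplex

variable {F : ModuleCat.{u} R ⥤ ModuleCat.{u} A} {G : ModuleCat.{u} A ⥤ ModuleCat.{u} R}
  [F.Additive] [G.Additive]

/-- The bijection on cochains induced by an adjunction. -/
def cochainAdjEquiv (adj : F ⊣ G) (X : CochainComplex (ModuleCat.{u} R) ℤ)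
    (Y : CochainComplex (ModuleCat.{u} A) ℤ) (n : ℤ) :
    Cochain ((F.mapHomologicalComplex _).obj X) Y n ≃+
      Cochain X ((G.mapHomologicalComplex _).obj Y) n where
  toFun z := Cochain.mk fun p q hpq => adj.homEquiv _ _ (z.v p q hpq)
  invFun z := Cochain.mk fun p q hpq => (adj.homEquiv _ _).symm (z.v p q hpq)
  left_inv _ := Cochain.ext _ _ fun _ _ _ => (adj.homEquiv _ _).symm_apply_apply _
  right_inv _ := Cochain.ext _ _ fun _ _ _ => (adj.homEquiv _ _).apply_symm_apply _
  map_add' _ _ := Cochain.ext _ _ fun _ _ _ => adj.homAddEquiv_add _ _ _ _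

theorem cochainAdjEquiv_δ (adj : F ⊣ G) (X : CochainComplex (ModuleCat.{u} R) ℤ)
    (Y : CochainComplex (ModuleCat.{u} A) ℤ) {n m : ℤ} (hm : n + 1 = m)
    (z : Cochain ((F.mapHomologicalComplex _).obj X) Y n) :
    cochainAdjEquiv adj X Y m (δ n m z) = δ n m (cochainAdjEquiv adj X Y n z) := by
  refine Cochain.ext _ _ fun p q hpq => ?_
  rw [δ_v _ _ hm _ p q hpq (q - 1) (p + 1) rfl rfl]
  change adj.homEquiv _ _ ((δ n m z).v p q hpq) = adj.homEquiv _ _ _ ≫ G.map (Y.d _ _) +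
    m.negOnePow • X.d _ _ ≫ adj.homEquiv _ _ _
  rw [δ_v _ _ hm z p q hpq (q - 1) (p + 1) rfl rfl]
  have h1 (a b : F.obj (X.X p) ⟶ Y.X q) : adj.homEquiv _ _ (a + m.negOnePow • b) =
      adj.homEquiv _ _ a + m.negOnePow • adj.homEquiv _ _ b := by
    rw [← adj.homAddEquiv_apply, map_add, Units.smul_def, map_zsmul]
    rfl
  refine (h1 _ _).trans (congrArg₂ (fun s t => s + m.negOnePow • t) ?_ ?_)
  · exact adj.homEquiv_naturality_right _ _
  · exact adj.homEquiv_naturality_left _ _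

theorem acyclic_homComplex_map_iff (adj : F ⊣ G) (X : CochainComplex (ModuleCat.{u} R) ℤ)
    (Y : CochainComplex (ModuleCat.{u} A) ℤ) :
    (homComplex X ((G.mapHomologicalComplex _).obj Y)).Acyclic ↔
      (homComplex ((F.mapHomologicalComplex _).obj X) Y).Acyclic := by
  rw [acyclic_homComplex_iff, acyclic_homComplex_iff]
  refine forall_congr' fun m => forall_congr' fun n => forall_congr' fun k =>
    forall_congr' fun hm => forall_congr' fun hk =>
      ((cochainAdjEquiv adj X Y n).toEquiv.forall_congr fun z => imp_congr ?_ ?_).symm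
  · rw [← (cochainAdjEquiv adj X Y k).map_eq_zero_iff, cochainAdjEquiv_δ adj X Y hk]
    rfl
  · refine (cochainAdjEquiv adj X Y m).toEquiv.exists_congr fun w => ?_
    rw [← (cochainAdjEquiv adj X Y n).injective.eq_iff, cochainAdjEquiv_δ adj X Y hm]
    rfl

theorem acyclic_mapHomologicalComplex [F.PreservesHomology]
    {K : CochainComplex (ModuleCat.{u} R) ℤ} (hK : K.Acyclic) :
    ((F.mapHomologicalComplex (.up ℤ)).obj K).Acyclic := fun n => by
  have h := hK n
  rw [HomologicalComplex.exactAt_iff] at h ⊢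
  exact h.map F

/-- Hom(K, G I) is Hom(F K, I), and the exact functor F preserves acyclicity. -/
theorem isKInjective_map_of_adjunction (adj : F ⊣ G) [F.PreservesHomology]
    (I : CochainComplex (ModuleCat.{u} A) ℤ) [I.IsKInjective] :
    CochainComplex.IsKInjective ((G.mapHomologicalComplex (.up ℤ)).obj I) :=
  isKInjective_of_acyclic_homComplex _ fun _ hK => (acyclic_homComplex_map_iff adj _ _).2
    (acyclic_homComplex_of_isKInjective (acyclic_mapHomologicalComplex hK))

attribute [local instance] HasDerivedCategory.standard

open DerivedCategory

theorem homVanish_map_iff_of_isKInjective (adj : F ⊣ G) [F.PreservesHomology]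
    (X : CochainComplex (ModuleCat.{u} R) ℤ) (I : CochainComplex (ModuleCat.{u} A) ℤ)
    [I.IsKInjective] :
    HomVanish (Q.obj X) (Q.obj ((G.mapHomologicalComplex _).obj I)) ↔
      HomVanish (Q.obj ((F.mapHomologicalComplex _).obj X)) (Q.obj I) := by
  have := isKInjective_map_of_adjunction adj I
  rw [← acyclic_homComplex_of_isKInjective_iff, ← acyclic_homComplex_of_isKInjective_iff,
    acyclic_homComplex_map_iff adj]

theorem homVanish_map_iff (adj : F ⊣ G) [F.PreservesHomology] [G.PreservesHomology]
    (X : CochainComplex (ModuleCat.{u} R) ℤ) (Y : CochainComplex (ModuleCat.{u} A) ℤ) :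
    HomVanish (Q.obj X) (Q.obj ((G.mapHomologicalComplex _).obj Y)) ↔
      HomVanish (Q.obj ((F.mapHomologicalComplex _).obj X)) (Q.obj Y) := by
  rw [homVanish_iff_of_quasiIso (𝟙 X) ((G.mapHomologicalComplex _).map (toKInjectiveResolution Y)),
    homVanish_map_iff_of_isKInjective adj,
    ← homVanish_iff_of_quasiIso (𝟙 _) (toKInjectiveResolution Y)]

end Adjunction

end DerivedModule

namespace DerivedModule

/-! ### Koszul cones -/

section KoszulCones

open Pretriangulated

universe v' u'

variable {R : Type u} [CommRing R]
variable {C : Type u'} [Category.{v'} C] [HasZeroObject C] [HasShift C ℤ] [Preadditive C]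
  [Linear R C] [∀ n : ℤ, (shiftFunctor C n).Additive] [∀ n : ℤ, (shiftFunctor C n).Linear R]
  [Pretriangulated C]

theorem smul_id_shift_eq_zero {x : R} {W : C} (h : x • 𝟙 W = 0) (n : ℤ) :
    x • 𝟙 (W⟦n⟧) = 0 := by
  rw [← (shiftFunctor C n).map_id, ← Functor.map_smul, h, Functor.map_zero]

/-- Since s kills the map into the third vertex, s • 𝟙 there factors through `mor₃`, which is killed
by a second factor s. -/
theorem mul_smul_id_eq_zero_of_distinguished {T : Triangle C} (hT : T ∈ distTriang C) {s : R}
    (h₂ : s • T.mor₂ = 0) (h₃ : s • T.mor₃ = 0) : (s * s) • 𝟙 T.obj₃ = 0 := by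
  obtain ⟨w, hw⟩ := T.yoneda_exact₃ hT (s • 𝟙 T.obj₃) (by
    rw [Linear.comp_smul, Category.comp_id, h₂])
  rw [mul_smul, hw, ← Linear.smul_comp, h₃, zero_comp]

/-- If nothing maps from W to the cone, every map from W to a shift of Y is x times another map; but
x acts as zero on W. -/
theorem HomVanish.of_cone_right {Y Z : C} {x : R} {g : Y ⟶ Z} {h : Z ⟶ Y⟦(1 : ℤ)⟧}
    (hT : Triangle.mk (x • 𝟙 Y) g h ∈ distTriang C) {W : C} (hW : x • 𝟙 W = 0)
    (hZ : HomVanish W Z) : HomVanish W Y := by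
  intro n f
  obtain ⟨k, hk⟩ : ∃ k, f = k ≫ (x • 𝟙 Y)⟦n⟧' := HomVanish.exists_eq_comp_mor₁ hT hZ f
  rw [hk, Functor.map_smul, Linear.comp_smul, ← Linear.smul_comp, ← Category.id_comp k,
    ← Linear.smul_comp, hW, zero_comp, zero_comp]

theorem HomVanish.of_cone_left {Y Z : C} {x : R} {g : Y ⟶ Z} {h : Z ⟶ Y⟦(1 : ℤ)⟧}
    (hT : Triangle.mk (x • 𝟙 Y) g h ∈ distTriang C) {W : C} (hW : x • 𝟙 W = 0)
    (hZ : HomVanish Z W) : HomVanish Y W := by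
  intro n f
  obtain ⟨k, hk⟩ : ∃ k, f = (x • 𝟙 Y) ≫ k := HomVanish.exists_eq_mor₁_comp hT hZ f
  rw [hk, Linear.smul_comp, ← Linear.comp_smul, ← Category.comp_id k, ← Linear.comp_smul,
    smul_id_shift_eq_zero hW, comp_zero, comp_zero]

/-- The iterated cones of the multiplications by the elements of a list. -/
theorem exists_koszul_cone (K : C) (L : List R) (hL : ∀ x ∈ L, x • 𝟙 K = 0) (Y : C) :
    ∃ W : C, (∀ x ∈ L, ∃ k : ℕ, x ^ k • 𝟙 W = 0) ∧ (HomVanish K W ↔ HomVanish K Y) ∧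
      (HomVanish W K ↔ HomVanish Y K) := by
  induction L with
  | nil => exact ⟨Y, by simp, Iff.rfl, Iff.rfl⟩
  | cons x L ih =>
    obtain ⟨W, hW, h₁, h₂⟩ := ih fun t ht => hL t (List.mem_cons_of_mem _ ht)
    have hx := hL x List.mem_cons_self
    obtain ⟨Z, g, h, hT⟩ := Pretriangulated.distinguished_cocone_triangle (x • 𝟙 W)
    have key (s : R) (h₁ : s • g = 0) (h₂ : s • h = 0) : (s * s) • 𝟙 Z = 0 :=
      mul_smul_id_eq_zero_of_distinguished hT h₁ h₂
    refine ⟨Z, fun t ht => ?_, ?_, ?_⟩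
    · obtain rfl | ht := List.mem_cons.1 ht
      -- The new element already kills both maps adjacent to its cone, because consecutive maps of a
      -- triangle compose to zero; hence its square kills the cone.
      · refine ⟨2, ?_⟩
        rw [pow_two]
        refine key _ ?_ ?_
        · have : (t • 𝟙 W) ≫ g = 0 := comp_distTriang_mor_zero₁₂ _ hT
          rwa [Linear.smul_comp, Category.id_comp] at this
        · have : h ≫ (t • 𝟙 W)⟦(1 : ℤ)⟧' = 0 := comp_distTriang_mor_zero₃₁ _ hT
          rwa [Functor.map_smul, (shiftFunctor C (1 : ℤ)).map_id, Linear.comp_smul,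
            Category.comp_id] at this
      · obtain ⟨k, hk⟩ := hW t ht
        -- An earlier element with k-th power zero on W kills both adjacent maps by that power, so
        -- the exponent doubles.
        refine ⟨k + k, ?_⟩
        rw [pow_add]
        refine key _ ?_ ?_
        · rw [← Category.id_comp g, ← Linear.smul_comp, hk, zero_comp]
        · rw [← Category.comp_id h, ← Linear.comp_smul, smul_id_shift_eq_zero hk, comp_zero]
    · rw [← h₁]
      exact ⟨fun h => HomVanish.of_cone_right hT hx h,
        fun h => HomVanish.obj₃_right hT h h⟩
    · rw [← h₂]
      exact ⟨fun h => HomVanish.of_cone_left hT hx h,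
        fun h => HomVanish.obj₃_left hT h h⟩

end KoszulCones

/-! ### Dévissage along cyclic modules R/I -/

section Devissage

variable {R : Type u} [CommRing R]

/-- An Oka predicate over a noetherian ring holds for all ideals if it satisfies an inductive
condition on prime ideals. -/
theorem forall_ideal_of_isOka [IsNoetherianRing R] {P : Ideal R → Prop} (hP : Ideal.IsOka P)
    (h : ∀ q : Ideal R, q.IsPrime → (∀ x ∉ q, P (q ⊔ Ideal.span {x})) → P q) (I : Ideal R) :
    P I := by
  by_contra hI
  obtain ⟨J, hJ, hJ'⟩ := wellFounded_gt.has_min {J : Ideal R | ¬ P J} ⟨I, hI⟩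
  -- A maximal counterexample to an Oka predicate is prime, and the inductive condition rules it
  -- out.
  have hmax : Maximal (¬ P ·) J :=
    maximal_iff_forall_gt.2 ⟨hJ, fun K hJK hK => hJ' K hK hJK⟩
  exact hJ (h J (hP.isPrime_of_maximal_not hmax) fun x hx => of_not_not
    (hmax.not_prop_of_gt (Submodule.lt_sup_iff_notMem.2 hx)))

/-- Multiplication by `a`, as a map `R ⧸ J → R ⧸ I`. -/
def quotientSMul (I J : Ideal R) (a : R) (h : ∀ r, r ∈ J ↔ a * r ∈ I) : (R ⧸ J) →ₗ[R] R ⧸ I :=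
  Submodule.mapQ J I (LinearMap.lsmul R R a) fun r hr => (h r).1 hr

/-- The sequence `R ⧸ J → R ⧸ I → R ⧸ (I + (a))` where `J = (I : a)`. -/
abbrev quotientShortComplex (I J : Ideal R) (a : R) (h : ∀ r, r ∈ J ↔ a * r ∈ I) :
    ShortComplex (ModuleCat.{u} R) :=
  ShortComplex.mk (X₁ := ModuleCat.of R (R ⧸ J)) (X₂ := ModuleCat.of R (R ⧸ I))
    (X₃ := ModuleCat.of R (R ⧸ (I ⊔ Ideal.span {a})))
    (ModuleCat.ofHom (quotientSMul I J a h))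
    (ModuleCat.ofHom (Submodule.mapQ I (I ⊔ Ideal.span {a}) LinearMap.id le_sup_left)) (by
      refine ModuleCat.hom_ext (LinearMap.ext fun x => ?_)
      obtain ⟨x, rfl⟩ := Submodule.Quotient.mk_surjective _ x
      exact (Submodule.Quotient.mk_eq_zero _).2 (Submodule.mem_sup_right
        (Ideal.mul_mem_right _ _ (Ideal.mem_span_singleton_self a))))

theorem shortExact_quotientShortComplex (I J : Ideal R) (a : R) (h : ∀ r, r ∈ J ↔ a * r ∈ I) :
    (quotientShortComplex I J a h).ShortExact where
  exact := by
    rw [ShortComplex.moduleCat_exact_iff]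
    intro x hx
    obtain ⟨x, rfl⟩ := Submodule.Quotient.mk_surjective _ x
    have h1 : x ∈ I ⊔ Ideal.span {a} := (Submodule.Quotient.mk_eq_zero _).1 hx
    obtain ⟨i, hi, y, hy, rfl⟩ := Submodule.mem_sup.1 h1
    obtain ⟨r, rfl⟩ := Ideal.mem_span_singleton.1 hy
    refine ⟨Submodule.Quotient.mk r, (Submodule.Quotient.eq _).2 ?_⟩
    change a * r - (i + a * r) ∈ I
    simpa using hi
  mono_f := by
    rw [ModuleCat.mono_iff_injective]
    refine (injective_iff_map_eq_zero (quotientSMul I J a h)).2 fun x hx => ?_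
    obtain ⟨x, rfl⟩ := Submodule.Quotient.mk_surjective _ x
    exact (Submodule.Quotient.mk_eq_zero _).2 ((h x).2 ((Submodule.Quotient.mk_eq_zero _).1 hx))
  epi_g := by
    rw [ModuleCat.epi_iff_surjective]
    intro x
    obtain ⟨x, rfl⟩ := Submodule.Quotient.mk_surjective _ x
    exact ⟨Submodule.Quotient.mk x, rfl⟩

/-- The sequence of linear duals with values in `E`. -/
abbrev dualShortComplex (S : ShortComplex (ModuleCat.{u} R)) (E : ModuleCat.{u} R) :
    ShortComplex (ModuleCat.{u} R) :=
  ShortComplex.mk (X₁ := ModuleCat.of R (S.X₃ →ₗ[R] E)) (X₂ := ModuleCat.of R (S.X₂ →ₗ[R] E))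
    (X₃ := ModuleCat.of R (S.X₁ →ₗ[R] E)) (ModuleCat.ofHom (LinearMap.lcomp R E S.g.hom))
    (ModuleCat.ofHom (LinearMap.lcomp R E S.f.hom)) (by
      refine ModuleCat.hom_ext (LinearMap.ext fun f => LinearMap.ext fun x => ?_)
      change f (S.g (S.f x)) = 0
      rw [S.moduleCat_zero_apply, map_zero])

theorem shortExact_dualShortComplex {S : ShortComplex (ModuleCat.{u} R)} (hS : S.ShortExact)
    {E : ModuleCat.{u} R} (hE : Module.Injective R E) : (dualShortComplex S E).ShortExact where
  exact := by
    rw [ShortComplex.moduleCat_exact_iff]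
    intro (f : S.X₂ →ₗ[R] E) hf
    have hg : Function.Surjective S.g.hom := (ModuleCat.epi_iff_surjective _).1 hS.epi_g
    have hker : LinearMap.ker S.g.hom ≤ LinearMap.ker f := by
      intro x hx
      obtain ⟨y, rfl⟩ := (ShortComplex.moduleCat_exact_iff _).1 hS.exact x hx
      exact LinearMap.congr_fun hf y
    refine ⟨Submodule.liftQ _ f hker ∘ₗ
      (S.g.hom.quotKerEquivOfSurjective hg).symm.toLinearMap, LinearMap.ext fun x => ?_⟩
    change Submodule.liftQ _ f hker ((S.g.hom.quotKerEquivOfSurjective hg).symm (S.g.hom x)) = f x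
    have : (S.g.hom.quotKerEquivOfSurjective hg).symm (S.g.hom x) = Submodule.Quotient.mk x := by
      rw [LinearEquiv.symm_apply_eq]
      rfl
    rw [this]
    rfl
  mono_f := by
    rw [ModuleCat.mono_iff_injective]
    have hg : Function.Surjective S.g.hom := (ModuleCat.epi_iff_surjective _).1 hS.epi_g
    intro f f' hff'
    refine LinearMap.ext fun y => ?_
    obtain ⟨x, rfl⟩ := hg y
    exact LinearMap.congr_fun hff' x
  epi_g := by
    rw [ModuleCat.epi_iff_surjective]
    intro (f : S.X₁ →ₗ[R] E)
    obtain ⟨g, hg⟩ := hE.out S.f.hom ((ModuleCat.mono_iff_injective _).1 hS.mono_f) f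
    exact ⟨g, LinearMap.ext hg⟩

attribute [local instance] HasDerivedCategory.standard

open DerivedCategory Pretriangulated

/-- The triangle in the derived category given by a short exact sequence of modules. -/
noncomputable abbrev moduleTriangle {S : ShortComplex (ModuleCat.{u} R)} (hS : S.ShortExact) :
    Triangle (DerivedCategory (ModuleCat.{u} R)) :=
  triangleOfSES (hS.map_of_exact (HomologicalComplex.single _ (ComplexShape.up ℤ) 0))

theorem moduleTriangle_distinguished {S : ShortComplex (ModuleCat.{u} R)} (hS : S.ShortExact) :
    moduleTriangle hS ∈ distTriang _ :=
  triangleOfSES_distinguished _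

theorem isZero_Q_obj_asComplex (N : ModuleCat.{u} R) [Subsingleton N] :
    IsZero (Q.obj (asComplex N)) :=
  Q.map_isZero ((HomologicalComplex.single _ _ 0).map_isZero (ModuleCat.isZero_of_subsingleton N))

theorem subsingleton_quotient_top : Subsingleton (R ⧸ (⊤ : Ideal R)) :=
  Submodule.Quotient.subsingleton_iff.2 rfl

/-- R/I is an extension of R/(I + (a)) by R/(I : a), so vanishing on both ends gives vanishing in
the middle. -/
theorem isOka_homVanish_quotient (W : DerivedCategory (ModuleCat.{u} R)) :
    Ideal.IsOka fun I : Ideal R => HomVanish (Q.obj (asComplex (ModuleCat.of R (R ⧸ I)))) W where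
  top := fun _ _ => by
    have : Subsingleton (ModuleCat.of R (R ⧸ (⊤ : Ideal R))) := subsingleton_quotient_top
    exact (isZero_Q_obj_asComplex _).eq_of_src _ _
  oka {I a} h₁ h₂ := HomVanish.obj₂_left (moduleTriangle_distinguished
    (shortExact_quotientShortComplex I (I.colon (Ideal.span {a})) a fun r => by
      rw [Ideal.mem_colon_span_singleton, mul_comm])) h₂ h₁

theorem isOka_homVanish_dual_quotient {E : ModuleCat.{u} R} (hE : Module.Injective R E)
    (W : DerivedCategory (ModuleCat.{u} R)) :
    Ideal.IsOka fun I : Ideal R =>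
      HomVanish W (Q.obj (asComplex (ModuleCat.of R ((R ⧸ I) →ₗ[R] E)))) where
  top := fun _ _ => by
    have := subsingleton_quotient_top (R := R)
    have : Subsingleton (ModuleCat.of R ((R ⧸ (⊤ : Ideal R)) →ₗ[R] E)) :=
      inferInstanceAs (Subsingleton ((R ⧸ (⊤ : Ideal R)) →ₗ[R] E))
    exact ((shiftFunctor _ _).map_isZero (isZero_Q_obj_asComplex _)).eq_of_tgt _ _
  oka {I a} h₁ h₂ := HomVanish.obj₂_right (moduleTriangle_distinguished
    (shortExact_dualShortComplex (shortExact_quotientShortComplex I (I.colon (Ideal.span {a})) a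
      fun r => by rw [Ideal.mem_colon_span_singleton, mul_comm]) hE)) h₁ h₂

theorem mem_iff_mul_mem_of_notMem {q : Ideal R} [q.IsPrime] {x : R} (hx : x ∉ q) (r : R) :
    r ∈ q ↔ x * r ∈ q :=
  ⟨fun h => Ideal.mul_mem_left _ _ h, fun h => (‹q.IsPrime›.mem_or_mem h).resolve_left hx⟩

theorem quotientSMul_eq_smul_id (q : Ideal R) (x : R) (h : ∀ r, r ∈ q ↔ x * r ∈ q) :
    quotientSMul q q x h = x • LinearMap.id := by
  refine LinearMap.ext fun r => ?_
  obtain ⟨r, rfl⟩ := Submodule.Quotient.mk_surjective _ r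
  rfl

theorem single_map_smul_id (x : R) (N : ModuleCat.{u} R) :
    (HomologicalComplex.single (ModuleCat.{u} R) (.up ℤ) 0).map (x • 𝟙 N) = x • 𝟙 _ := by
  refine HomologicalComplex.from_single_hom_ext ?_
  rw [HomologicalComplex.single_map_f_self, HomologicalComplex.smul_f_apply,
    HomologicalComplex.id_f, Linear.smul_comp, Linear.comp_smul, Category.id_comp, Iso.hom_inv_id]

theorem Q_map_single_smul_id (x : R) (N : ModuleCat.{u} R) :
    Q.map ((HomologicalComplex.single (ModuleCat.{u} R) (.up ℤ) 0).map
      (ModuleCat.ofHom (x • (LinearMap.id : N →ₗ[R] N)))) = x • 𝟙 _ := by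
  have h : ModuleCat.ofHom (x • (LinearMap.id : N →ₗ[R] N)) = x • 𝟙 N := rfl
  rw [h, single_map_smul_id, Functor.map_smul, Q.map_id]

/-- For x outside the prime q one has (q : x) = q, so R/(q + (x)) is the cone of x on R/q. If it has
no maps to shifts of W, then x acts surjectively on the maps from R/q to them. -/
theorem exists_eq_smul_of_homVanish_quotient {q : Ideal R} [q.IsPrime] {x : R} (hx : x ∉ q)
    {W : DerivedCategory (ModuleCat.{u} R)}
    (h : HomVanish (Q.obj (asComplex (ModuleCat.of R (R ⧸ (q ⊔ Ideal.span {x}))))) W) {n : ℤ}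
    (f : Q.obj (asComplex (ModuleCat.of R (R ⧸ q))) ⟶ W⟦n⟧) : ∃ g, f = x • g := by
  obtain ⟨g, hg⟩ := HomVanish.exists_eq_mor₁_comp (moduleTriangle_distinguished
    (shortExact_quotientShortComplex q q x (mem_iff_mul_mem_of_notMem hx))) h f
  refine ⟨g, hg.trans ?_⟩
  have h1 : Q.map ((HomologicalComplex.single (ModuleCat.{u} R) (.up ℤ) 0).map
      (ModuleCat.ofHom (quotientSMul q q x (mem_iff_mul_mem_of_notMem hx)))) = x • 𝟙 _ := by
    rw [quotientSMul_eq_smul_id]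
    exact Q_map_single_smul_id x (ModuleCat.of R (R ⧸ q))
  exact (congrArg (· ≫ g) h1).trans ((Linear.smul_comp _ _ _ _ _ _).trans
    (congrArg (x • ·) (Category.id_comp _)))

/-- The same divisibility after applying the exact functor Hom(-, E), for maps into the dual of R/q.
-/
theorem exists_eq_smul_of_homVanish_dual_quotient {E : ModuleCat.{u} R} (hE : Module.Injective R E)
    {q : Ideal R} [q.IsPrime] {x : R} (hx : x ∉ q) {W : DerivedCategory (ModuleCat.{u} R)}
    (h : HomVanish W (Q.obj (asComplex (ModuleCat.of R ((R ⧸ (q ⊔ Ideal.span {x})) →ₗ[R] E)))))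
    {n : ℤ} (f : W ⟶ (Q.obj (asComplex (ModuleCat.of R ((R ⧸ q) →ₗ[R] E))))⟦n⟧) :
    ∃ g, f = x • g := by
  obtain ⟨g, hg⟩ := HomVanish.exists_eq_comp_mor₂ (moduleTriangle_distinguished
    (shortExact_dualShortComplex (shortExact_quotientShortComplex q q x
      (mem_iff_mul_mem_of_notMem hx)) hE)) h f
  refine ⟨g, hg.trans ?_⟩
  have h1 : Q.map ((HomologicalComplex.single (ModuleCat.{u} R) (.up ℤ) 0).map
      (ModuleCat.ofHom (LinearMap.lcomp R E (quotientSMul q q x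
        (mem_iff_mul_mem_of_notMem hx))))) = x • 𝟙 _ := by
    have h2 : LinearMap.lcomp R E (quotientSMul q q x (mem_iff_mul_mem_of_notMem hx)) =
        x • LinearMap.id := by
      rw [quotientSMul_eq_smul_id]
      exact LinearMap.ext fun f => LinearMap.ext fun r => f.map_smul _ _
    rw [h2]
    exact Q_map_single_smul_id x (ModuleCat.of R ((R ⧸ q) →ₗ[R] E))
  refine (congrArg (fun t => g ≫ t⟦n⟧') h1).trans ?_
  refine (congrArg (g ≫ ·) ((Functor.map_smul _ _ _).trans
    (congrArg (x • ·) ((shiftFunctor _ n).map_id _)))).trans ?_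
  exact (Linear.comp_smul _ _ _ _ _ _).trans (congrArg (x • ·) (Category.comp_id _))

end Devissage

end DerivedModule

namespace DerivedModule

/-! ### Duality for fields over R -/

section FieldDuality

variable {R : Type u} [CommRing R]

attribute [local instance] HasDerivedCategory.standard

open DerivedCategory

/-- The module structure over `K` on linear maps defined on `K`. -/
abbrev linearMapModule (K : Type u) [Field K] [Algebra R K] (E : Type u) [AddCommGroup E]
    [Module R E] : Module K (K →ₗ[R] E) where
  smul c f := f ∘ₗ LinearMap.mulLeft R c
  one_smul f := LinearMap.ext fun x => congrArg f (one_mul x)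
  mul_smul c c' f := LinearMap.ext fun x => congrArg f (by
    change c * c' * x = c' * (c * x)
    ring)
  smul_zero _ := rfl
  smul_add _ _ _ := rfl
  add_smul c c' f := LinearMap.ext fun x => by
    change f ((c + c') * x) = f (c * x) + f (c' * x)
    rw [add_mul, map_add]
  zero_smul f := LinearMap.ext fun x => by
    change f (0 * x) = 0
    rw [zero_mul, map_zero]

theorem homVanish_linearMap_field_iff (K : Type u) [Field K] [Algebra R K] (E : ModuleCat.{u} R)
    [Nontrivial (K →ₗ[R] E)] (X : CochainComplex (ModuleCat.{u} R) ℤ) :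
    HomVanish (Q.obj X) (Q.obj (asComplex (ModuleCat.of R (K →ₗ[R] E)))) ↔
      HomVanish (Q.obj X) (Q.obj (asComplex (ModuleCat.of R K))) := by
  let _ := linearMapModule (R := R) K E
  have : IsScalarTower R K (K →ₗ[R] E) := .of_algebraMap_smul fun r f => LinearMap.ext fun x => by
    change f (algebraMap R K r * x) = r • f x
    rw [← Algebra.smul_def, map_smul]
  exact homVanish_vectorSpace_iff K (K →ₗ[R] E) X

/-- Hom(K, E) is a nonzero K-vector space, so it may replace K as a target; exchanging arguments
does the rest. -/
theorem homVanish_field_iff (K : Type u) [Field K] [Algebra R K] {E : ModuleCat.{u} R}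
    (hE : Module.Injective R E) [Nontrivial (K →ₗ[R] E)]
    (X : CochainComplex (ModuleCat.{u} R) ℤ) :
    HomVanish (Q.obj X) (Q.obj (asComplex (ModuleCat.of R K))) ↔
      HomVanish (Q.obj (asComplex (ModuleCat.of R K))) (Q.obj (homComplex X (asComplex E))) := by
  rw [← homVanish_linearMap_field_iff K E, ← homVanish_linearMap_iff hE]

theorem IsCogenerator.nontrivial_linearMap {E : ModuleCat.{u} R} (hE : IsCogenerator E)
    (N : Type u) [AddCommGroup N] [Module R N] [Nontrivial N] : Nontrivial (N →ₗ[R] E) := by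
  obtain ⟨x, hx⟩ := exists_ne (0 : N)
  obtain ⟨f, hf⟩ := hE N x hx
  exact ⟨f, 0, fun h => hf (by rw [h, LinearMap.zero_apply])⟩

theorem acyclic_derivedTensor_field_iff [IsNoetherianRing R] (K : Type u) [Field K] [Algebra R K]
    (X : CochainComplex (ModuleCat.{u} R) ℤ) :
    (derivedTensor (ModuleCat.of R K) X).Acyclic ↔
      HomVanish (Q.obj X) (Q.obj (asComplex (ModuleCat.of R K))) := by
  have := (isCogenerator_cogenerator (R := R)).nontrivial_linearMap K
  rw [acyclic_derivedTensor_iff injective_cogenerator isCogenerator_cogenerator,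
    ← homVanish_field_iff K injective_cogenerator]

open CochainComplex.HomComplex in
-- A cycle of a K-injective resolution is a cocycle defined on R; bounding that cocycle bounds the
-- cycle.
theorem acyclic_of_homVanish_ring {Y : CochainComplex (ModuleCat.{u} R) ℤ}
    (h : HomVanish (Q.obj (asComplex (ModuleCat.of R R))) (Q.obj Y)) : Y.Acyclic := by
  have h1 : (kInjectiveResolution Y).Acyclic := by
    rw [homVanish_iff_of_quasiIso (𝟙 _) (toKInjectiveResolution Y),
      ← acyclic_homComplex_of_isKInjective_iff, acyclic_homComplex_iff] at h
    rw [acyclic_iff]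
    intro i j k hij hjk x hx
    let ξ : ModuleCat.of R R ⟶ (kInjectiveResolution Y).X j :=
      ModuleCat.ofHom (LinearMap.toSpanSingleton R _ x)
    have hξ : ξ ≫ (kInjectiveResolution Y).d j k = 0 := by
      refine ModuleCat.hom_ext (LinearMap.ext_ring ?_)
      change (kInjectiveResolution Y).d j k ((1 : R) • x) = 0
      rw [one_smul, hx]
    obtain ⟨w, hw⟩ := h i j k hij hjk (Cochain.fromSingleMk ξ (zero_add j))
      ((Cochain.δ_fromSingleMk ξ (zero_add j) k k (zero_add k)).trans (by
        rw [hξ, Cochain.fromSingleMk_zero]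
        rfl))
    obtain ⟨f, rfl⟩ := Cochain.fromSingleMk_surjective w i (zero_add i)
    have h2 := (Cochain.δ_fromSingleMk f (zero_add i) j j (zero_add j)).symm.trans hw
    have h3 := (Cochain.fromSingleEquiv (zero_add j)).symm.injective h2
    exact ⟨f.hom (1 : R), (congrArg (fun t => ModuleCat.Hom.hom t (1 : R)) h3).trans
      (one_smul R x)⟩
  exact fun n => (quasiIsoAt_iff_exactAt' (toKInjectiveResolution Y) n (h1 n)).1 inferInstance

theorem acyclic_of_homVanish_quotient_bot {Y : CochainComplex (ModuleCat.{u} R) ℤ}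
    (h : HomVanish (Q.obj (asComplex (ModuleCat.of R (R ⧸ (⊥ : Ideal R))))) (Q.obj Y)) :
    Y.Acyclic :=
  acyclic_of_homVanish_ring (h.of_iso (Q.mapIso ((HomologicalComplex.single _ _ 0).mapIso
    (Submodule.quotEquivOfEqBot (⊥ : Ideal R) rfl).toModuleIso)) (Iso.refl _))

end FieldDuality

/-! ### Symmetry of the residue field over a noetherian local ring -/

section LocalRing

variable {A : Type u} [CommRing A]

attribute [local instance] HasDerivedCategory.standard

open DerivedCategory IsLocalRing

theorem exists_mem_notMem_of_ne_maximalIdeal [IsLocalRing A] {L : List A}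
    (hL : Ideal.span {x | x ∈ L} = maximalIdeal A) {q : Ideal A} (hq : q.IsPrime)
    (hqm : q ≠ maximalIdeal A) : ∃ x ∈ L, x ∉ q := by
  by_contra! h
  refine hqm (le_antisymm (le_maximalIdeal hq.ne_top) ?_)
  rw [← hL]
  exact Ideal.span_le.2 h

theorem exists_eq_pow_smul {M : Type*} [AddCommGroup M] [Module A M] {x : A}
    (h : ∀ f : M, ∃ g : M, f = x • g) (k : ℕ) (f : M) : ∃ g : M, f = x ^ k • g := by
  induction k with
  | zero => exact ⟨f, by simp⟩
  | succ k ih =>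
    obtain ⟨g, rfl⟩ := ih
    obtain ⟨g, rfl⟩ := h g
    exact ⟨g, by rw [smul_smul, pow_succ]⟩

variable [IsLocalRing A] [IsNoetherianRing A]

/-- Dévissage reduces the vanishing on A = A/(0) to the A/q. For q not maximal, some generator x
lies outside q; by induction it acts surjectively on maps from A/q to shifts of W, while a power of
it acts as zero. -/
theorem acyclic_of_homVanish_residueField_left {L : List A}
    (hL : Ideal.span {x | x ∈ L} = maximalIdeal A) {W : CochainComplex (ModuleCat.{u} A) ℤ}
    (hW : ∀ x ∈ L, ∃ k : ℕ, x ^ k • 𝟙 (Q.obj W) = 0)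
    (h : HomVanish (Q.obj (asComplex (ModuleCat.of A (ResidueField A)))) (Q.obj W)) :
    W.Acyclic := by
  refine acyclic_of_homVanish_quotient_bot (forall_ideal_of_isOka (isOka_homVanish_quotient _)
    (fun q hq ih => ?_) ⊥)
  by_cases hqm : q = maximalIdeal A
  · subst hqm
    exact h
  · obtain ⟨x, hxL, hxq⟩ := exists_mem_notMem_of_ne_maximalIdeal hL hq hqm
    obtain ⟨k, hk⟩ := hW x hxL
    intro n f
    obtain ⟨g, rfl⟩ := exists_eq_pow_smul (fun f =>
      exists_eq_smul_of_homVanish_quotient hxq (ih x hxq) f) k f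
    rw [← Category.comp_id g, ← Linear.comp_smul, smul_id_shift_eq_zero hk, comp_zero]

/-- The same argument for the duals Hom(A/q, E) as targets, where E is the injective cogenerator.
The induction starts at the dual of the residue field, which is a nonzero vector space over it, and
ends with RHom(A, D(W)) ≃ 0. -/
theorem acyclic_of_homVanish_residueField_right {L : List A}
    (hL : Ideal.span {x | x ∈ L} = maximalIdeal A) {W : CochainComplex (ModuleCat.{u} A) ℤ}
    (hW : ∀ x ∈ L, ∃ k : ℕ, x ^ k • 𝟙 (Q.obj W) = 0)
    (h : HomVanish (Q.obj W) (Q.obj (asComplex (ModuleCat.of A (ResidueField A))))) :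
    W.Acyclic := by
  have hE := injective_cogenerator (R := A)
  have hE' := isCogenerator_cogenerator (R := A)
  rw [← acyclic_homComplex_asComplex_iff_acyclic hE hE']
  refine acyclic_of_homVanish_quotient_bot ((homVanish_linearMap_iff hE _ _).1
    (forall_ideal_of_isOka (isOka_homVanish_dual_quotient hE (Q.obj W)) (fun q hq ih => ?_) ⊥))
  by_cases hqm : q = maximalIdeal A
  · subst hqm
    have := hE'.nontrivial_linearMap (ResidueField A)
    exact (homVanish_linearMap_field_iff (ResidueField A) (cogenerator A) W).2 h
  · obtain ⟨x, hxL, hxq⟩ := exists_mem_notMem_of_ne_maximalIdeal hL hq hqm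
    obtain ⟨k, hk⟩ := hW x hxL
    intro n f
    obtain ⟨g, rfl⟩ := exists_eq_pow_smul (fun f =>
      exists_eq_smul_of_homVanish_dual_quotient hE hxq (ih x hxq) f) k f
    rw [← Category.id_comp g, ← Linear.smul_comp, hk, zero_comp]

/-- Over a noetherian local ring, the derived Hom from the residue field vanishes if and only if
the derived Hom to the residue field vanishes. -/
theorem homVanish_residueField_comm (Y : CochainComplex (ModuleCat.{u} A) ℤ) :
    HomVanish (Q.obj (asComplex (ModuleCat.of A (ResidueField A)))) (Q.obj Y) ↔
      HomVanish (Q.obj Y) (Q.obj (asComplex (ModuleCat.of A (ResidueField A)))) := by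
  obtain ⟨s, hs⟩ := IsNoetherian.noetherian (maximalIdeal A)
  have hL : Ideal.span {x | x ∈ s.toList} = maximalIdeal A := by
    rw [← hs]
    simp only [Finset.mem_toList]
    rfl
  -- The generators of the maximal ideal kill the residue field, so passing to the Koszul cone of Y
  -- affects neither vanishing condition.
  obtain ⟨W', hW', h₁, h₂⟩ := exists_koszul_cone
    (Q.obj (asComplex (ModuleCat.of A (ResidueField A)))) s.toList (fun x hx => by
      refine (Q_map_single_smul_id x (ModuleCat.of A (ResidueField A))).symm.trans ?_
      have : x • (LinearMap.id : ResidueField A →ₗ[A] ResidueField A) = 0 := by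
        refine LinearMap.ext fun y => ?_
        change x • y = 0
        have hxm : x ∈ maximalIdeal A := hL ▸ Ideal.subset_span hx
        rw [Algebra.smul_def, ResidueField.algebraMap_eq, (residue_eq_zero_iff x).2 hxm, zero_mul]
      refine (congrArg (fun t => Q.map ((HomologicalComplex.single (ModuleCat.{u} A) (.up ℤ) 0).map
        (ModuleCat.ofHom t))) this).trans ?_
      rw [ModuleCat.ofHom_zero, Functor.map_zero, Functor.map_zero]) (Q.obj Y)
  obtain ⟨W, ⟨e⟩⟩ : ∃ W, Nonempty (Q.obj W ≅ W') := ⟨_, ⟨Q.objObjPreimageIso W'⟩⟩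
  have hW : ∀ x ∈ s.toList, ∃ k : ℕ, x ^ k • 𝟙 (Q.obj W) = 0 := fun x hx => by
    obtain ⟨k, hk⟩ := hW' x hx
    refine ⟨k, ?_⟩
    rw [← e.hom_inv_id, ← Category.id_comp e.inv, ← Linear.comp_smul, ← Linear.smul_comp, hk,
      zero_comp, comp_zero]
  rw [← h₁, ← h₂, ← HomVanish.iff_of_iso (Iso.refl _) e, ← HomVanish.iff_of_iso e (Iso.refl _)]
  -- Either condition makes W acyclic, and then the other one is automatic.
  exact ⟨fun h => homVanish_of_acyclic_left (acyclic_of_homVanish_residueField_left hL hW h) _,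
    fun h => homVanish_of_acyclic_right _ (acyclic_of_homVanish_residueField_right hL hW h)⟩

end LocalRing

end DerivedModule

namespace DerivedModule

/-! ### Residue fields under localization -/

section LocalizationOfResidueFields

variable {R : Type u} [CommRing R]

instance isLocalizedModule_quotient_residueField (p : Ideal R) [p.IsPrime] :
    IsLocalizedModule p.primeCompl
      (IsScalarTower.toAlgHom R (R ⧸ p) p.ResidueField).toLinearMap where
  map_units s := by
    have hs : algebraMap R p.ResidueField s ≠ 0 := fun h =>
      s.2 (Ideal.algebraMap_residueField_eq_zero.1 h)
    rw [Module.End.isUnit_iff]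
    have h : ⇑(algebraMap R (Module.End R p.ResidueField) s) =
        fun x => algebraMap R p.ResidueField s * x :=
      funext fun x => Algebra.smul_def (s : R) x
    rw [h]
    exact mulLeft_bijective₀ _ hs
  surj y := by
    obtain ⟨⟨a, s⟩, h⟩ := IsLocalization.surj (nonZeroDivisors (R ⧸ p)) y
    obtain ⟨t, ht⟩ := Ideal.Quotient.mk_surjective s.1
    refine ⟨⟨a, ⟨t, fun htp => nonZeroDivisors.ne_zero s.2 ?_⟩⟩, ?_⟩
    · rw [← ht]
      exact Ideal.Quotient.eq_zero_iff_mem.2 htp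
    · change t • y = algebraMap (R ⧸ p) p.ResidueField a
      rw [Algebra.smul_def, mul_comm, ← h, ← ht]
      rfl
  exists_of_eq {x y} h := ⟨1, by rw [p.injective_algebraMap_quotient_residueField h]⟩

variable (p : PrimeSpectrum R)

theorem nonempty_localizedModule_iso :
    Nonempty ((ModuleCat.localizedModuleFunctor.{u} p.asIdeal.primeCompl).obj
      (ModuleCat.of R (R ⧸ p.asIdeal)) ≅ residueModuleAt p) :=
  have := ModuleCat.localizedModule_isLocalizedModule (ModuleCat.of R (R ⧸ p.asIdeal))
    p.asIdeal.primeCompl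
  ⟨LinearEquiv.toModuleIso ((IsLocalizedModule.linearEquiv p.asIdeal.primeCompl
    ((ModuleCat.of R (R ⧸ p.asIdeal)).localizedModuleMkLinearMap p.asIdeal.primeCompl)
    (IsScalarTower.toAlgHom R (R ⧸ p.asIdeal) p.asIdeal.ResidueField).toLinearMap
    ).extendScalarsOfIsLocalization p.asIdeal.primeCompl (Localization.AtPrime p.asIdeal))⟩

theorem nonempty_localize_quotient_iso :
    Nonempty (localize p.asIdeal.primeCompl (asComplex (ModuleCat.of R (R ⧸ p.asIdeal))) ≅
      asComplex (residueModuleAt p)) := by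
  obtain ⟨e⟩ := nonempty_localizedModule_iso p
  exact ⟨(HomologicalComplex.singleMapHomologicalComplex _ (.up ℤ) 0).app _ ≪≫
    (HomologicalComplex.single _ _ 0).mapIso e⟩

theorem nonempty_restrict_residueModuleAt_iso :
    Nonempty (restrict R (asComplex (residueModuleAt p)) ≅ asComplex (residueModule p)) :=
  ⟨(HomologicalComplex.singleMapHomologicalComplex _ (.up ℤ) 0).app _ ≪≫
    (HomologicalComplex.single _ _ 0).mapIso (LinearEquiv.toModuleIso
      (show ((ModuleCat.restrictScalars (algebraMap R (Localization.AtPrime p.asIdeal))).obj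
          (residueModuleAt p)) ≃ₗ[R] p.asIdeal.ResidueField from
      { toFun := id
        invFun := id
        left_inv := fun _ => rfl
        right_inv := fun _ => rfl
        map_add' := fun _ _ => rfl
        map_smul' := fun r (x : p.asIdeal.ResidueField) =>
          algebraMap_smul (Localization.AtPrime p.asIdeal) r x }))⟩

theorem nonempty_residueModule_closedPoint_iso {A : Type u} [CommRing A] [IsLocalRing A] :
    Nonempty (ModuleCat.of A (IsLocalRing.ResidueField A) ≅
      residueModule (IsLocalRing.closedPoint A)) :=
  ⟨LinearEquiv.toModuleIso (LinearEquiv.ofBijective (IsScalarTower.toAlgHom A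
    (A ⧸ IsLocalRing.maximalIdeal A) (IsLocalRing.maximalIdeal A).ResidueField).toLinearMap
    (IsLocalRing.maximalIdeal A).bijective_algebraMap_quotient_residueField)⟩

end LocalizationOfResidueFields

/-! ### Conditions 1–5 -/

section Cosupport

variable {R : Type u} [CommRing R]

attribute [local instance] HasDerivedCategory.standard

open DerivedCategory

/-- Localization is left adjoint to restriction and sends R/p to k(p). -/
theorem homVanish_quotient_restrict_iff (p : PrimeSpectrum R)
    (Y : CochainComplex (ModuleCat.{u} (Localization.AtPrime p.asIdeal)) ℤ) :
    HomVanish (Q.obj (asComplex (ModuleCat.of R (R ⧸ p.asIdeal)))) (Q.obj (restrict R Y)) ↔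
      HomVanish (Q.obj (asComplex (residueModuleAt p))) (Q.obj Y) := by
  obtain ⟨e⟩ := nonempty_localize_quotient_iso p
  rw [homVanish_map_iff (localizedModuleAdj p.asIdeal.primeCompl)]
  exact HomVanish.iff_of_iso (Q.mapIso e) (Iso.refl _)

theorem homVanish_localize_residueModuleAt_iff (p : PrimeSpectrum R)
    (X : CochainComplex (ModuleCat.{u} R) ℤ) :
    HomVanish (Q.obj (localize p.asIdeal.primeCompl X)) (Q.obj (asComplex (residueModuleAt p))) ↔
      HomVanish (Q.obj X) (Q.obj (asComplex (residueModule p))) := by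
  obtain ⟨e⟩ := nonempty_restrict_residueModuleAt_iso p
  rw [← homVanish_map_iff (localizedModuleAdj p.asIdeal.primeCompl)]
  exact HomVanish.iff_of_iso (Iso.refl _) (Q.mapIso e)

variable [IsNoetherianRing R]

theorem homVanish_field_dual_iff (K : Type u) [Field K] [Algebra R K]
    (X : CochainComplex (ModuleCat.{u} R) ℤ) :
    HomVanish (Q.obj (asComplex (ModuleCat.of R K))) (Q.obj (dual X)) ↔
      HomVanish (Q.obj X) (Q.obj (asComplex (ModuleCat.of R K))) := by
  have := (isCogenerator_cogenerator (R := R)).nontrivial_linearMap K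
  exact (homVanish_field_iff K injective_cogenerator X).symm

theorem homVanish_residueModuleAt_dual_localize_iff (p : PrimeSpectrum R)
    (X : CochainComplex (ModuleCat.{u} R) ℤ) :
    HomVanish (Q.obj (asComplex (residueModuleAt p)))
        (Q.obj (dual (localize p.asIdeal.primeCompl X))) ↔
      HomVanish (Q.obj X) (Q.obj (asComplex (residueModule p))) := by
  have : IsNoetherianRing (Localization.AtPrime p.asIdeal) :=
    IsLocalization.isNoetherianRing p.asIdeal.primeCompl _ inferInstance
  rw [← homVanish_localize_residueModuleAt_iff]
  exact homVanish_field_dual_iff p.asIdeal.ResidueField _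

/-- RHom_R(R/p, ᵖM) becomes RHom over R_p from k(p) into the dual of D(M)_p. Field duality over R_p
and the localization adjunction turn its vanishing into that of RHom_R(D(M), k(p)). -/
theorem mem_smallCosupport_iff (p : PrimeSpectrum R) (M : CochainComplex (ModuleCat.{u} R) ℤ) :
    p ∈ smallCosupport M ↔
      ¬ HomVanish (Q.obj (dual M)) (Q.obj (asComplex (residueModule p))) := by
  rw [← homVanish_residueModuleAt_dual_localize_iff, ← homVanish_quotient_restrict_iff,
    ← acyclic_RHom_iff]
  rfl

theorem mem_smallSupport_iff (p : PrimeSpectrum R) (X : CochainComplex (ModuleCat.{u} R) ℤ) :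
    p ∈ smallSupport X ↔ ¬ HomVanish (Q.obj X) (Q.obj (asComplex (residueModule p))) := by
  rw [← acyclic_derivedTensor_field_iff]
  rfl

/-- Field duality compares the tensor product with morphisms into k(p); the symmetry over the local
ring R_p converts these into morphisms from k(p). -/
theorem acyclic_derivedTensor_residueModuleAt_iff (p : PrimeSpectrum R)
    (Y : CochainComplex (ModuleCat.{u} (Localization.AtPrime p.asIdeal)) ℤ) :
    (derivedTensor (residueModuleAt p) Y).Acyclic ↔
      HomVanish (Q.obj (asComplex (residueModuleAt p))) (Q.obj Y) := by
  have : IsNoetherianRing (Localization.AtPrime p.asIdeal) :=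
    IsLocalization.isNoetherianRing p.asIdeal.primeCompl _ inferInstance
  exact (acyclic_derivedTensor_field_iff p.asIdeal.ResidueField Y).trans
    (homVanish_residueField_comm Y).symm

/-- With k the residue field, the symmetry is applied on both sides of duality: RHom(D(Y), k),
RHom(k, D(Y)), RHom(Y, k) and RHom(k, Y) vanish together. -/
theorem closedPoint_mem_smallCosupport_iff {A : Type u} [CommRing A] [IsLocalRing A]
    [IsNoetherianRing A] (Y : CochainComplex (ModuleCat.{u} A) ℤ) :
    IsLocalRing.closedPoint A ∈ smallCosupport Y ↔
      ¬ HomVanish (Q.obj (asComplex (ModuleCat.of A (IsLocalRing.ResidueField A)))) (Q.obj Y) := by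
  obtain ⟨e⟩ := nonempty_residueModule_closedPoint_iso (A := A)
  rw [mem_smallCosupport_iff, ← HomVanish.iff_of_iso (Iso.refl (Q.obj (dual Y)))
    (Q.mapIso ((HomologicalComplex.single _ _ 0).mapIso e)), ← homVanish_residueField_comm,
    homVanish_field_dual_iff, homVanish_residueField_comm]

theorem smallCosupport_tfae (M : CochainComplex (ModuleCat.{u} R) ℤ) (p : PrimeSpectrum R) :
    List.TFAE [
      p ∈ smallCosupport M,
      ¬ (RHom (dual M) (asComplex (residueModule p))).Acyclic,
      p ∈ smallSupport (dual M),
      ¬ (derivedTensor (residueModuleAt p) (colocalizeAt p M)).Acyclic,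
      IsLocalRing.closedPoint (Localization.AtPrime p.asIdeal) ∈
        smallCosupport (colocalizeAt p M)] := by
  have : IsNoetherianRing (Localization.AtPrime p.asIdeal) :=
    IsLocalization.isNoetherianRing p.asIdeal.primeCompl _ inferInstance
  -- The co-localization is by definition the dual of the localized D(M), so conditions 4 and 5 are
  -- matched by `rfl`.
  have h := homVanish_residueModuleAt_dual_localize_iff p (dual M)
  tfae_have 1 ↔ 2 := by rw [mem_smallCosupport_iff, acyclic_RHom_iff]
  tfae_have 1 ↔ 3 := by rw [mem_smallCosupport_iff, mem_smallSupport_iff]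
  tfae_have 1 ↔ 4 := by
    rw [mem_smallCosupport_iff, acyclic_derivedTensor_residueModuleAt_iff, ← h]
    rfl
  tfae_have 1 ↔ 5 := by
    rw [mem_smallCosupport_iff, closedPoint_mem_smallCosupport_iff, ← h]
    rfl
  tfae_finish

end Cosupport

end DerivedModule

namespace DerivedModule

/-! ### Residue fields detect acyclicity: statement (C) -/

section Detection

variable {R : Type u} [CommRing R]

attribute [local instance] HasDerivedCategory.standard

open DerivedCategory CochainComplex.HomComplex

/-- Since P is K-projective, a factorization through φ in the derived category lifts to cocycles, up
to a coboundary. -/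
theorem exists_eq_precomp_add_δ {P Y : CochainComplex (ModuleCat.{u} R) ℤ} [P.IsKProjective]
    (φ : P ⟶ P) {m n : ℤ} (hm : m + 1 = n)
    (h : ∀ f : Q.obj P ⟶ (Q.obj Y)⟦n⟧, ∃ g, f = Q.map φ ≫ g) (z : Cocycle P Y n) :
    ∃ (w : Cocycle P Y n) (t : Cochain P Y m),
      z.1 = (Cochain.ofHom φ).comp w.1 (zero_add n) + δ m n t := by
  let q := HomotopyCategory.quotient (ModuleCat.{u} R) (.up ℤ)
  let e := (quotientCompQhIso (ModuleCat.{u} R)).app P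
  let e' := (quotientCompQhIso (ModuleCat.{u} R)).app (Y⟦n⟧) ≪≫ (Q.commShiftIso n).app Y
  obtain ⟨g, hg⟩ := h (e.inv ≫ Qh.map (CohomologyClass.toHom (CohomologyClass.mk z)) ≫ e'.hom)
  obtain ⟨k, hk⟩ := (CochainComplex.IsKProjective.Qh_map_bijective P (q.obj (Y⟦n⟧))).2
    (e.hom ≫ g ≫ e'.inv)
  obtain ⟨c, rfl⟩ := (CohomologyClass.toHom_bijective P Y n).2 k
  obtain ⟨w, rfl⟩ := c.mk_surjective
  have hpre : CohomologyClass.toHom (CohomologyClass.mk (w.precomp φ)) =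
      q.map φ ≫ CohomologyClass.toHom (CohomologyClass.mk w) := by
    rw [CohomologyClass.toHom_mk, CohomologyClass.toHom_mk, Cocycle.equivHomShift_symm_precomp,
      Functor.map_comp]
  have h1 : Qh.map (CohomologyClass.toHom (CohomologyClass.mk z)) =
      Qh.map (CohomologyClass.toHom (CohomologyClass.mk (w.precomp φ))) := by
    rw [hpre, Functor.map_comp, hk]
    have h2 : Qh.map (q.map φ) ≫ e.hom = e.hom ≫ Q.map φ :=
      (quotientCompQhIso (ModuleCat.{u} R)).hom.naturality φ
    rw [← Category.assoc, h2, Category.assoc, ← Category.assoc (Q.map φ), ← hg]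
    simp
  have h3 := (CochainComplex.IsKProjective.Qh_map_bijective _ _).1 h1
  rw [← sub_eq_zero, ← map_sub, ← CohomologyClass.mk_sub,
    CohomologyClass.toHom_mk_eq_zero_iff, mem_coboundaries_iff _ m hm] at h3
  obtain ⟨t, ht⟩ := h3
  refine ⟨w, t, ?_⟩
  rw [ht]
  exact (add_sub_cancel _ _).symm

/-- The adjunction between the tensor product of complexes and the Hom complex. -/
noncomputable def tensorHomCochainEquiv (P X : CochainComplex (ModuleCat.{u} R) ℤ)
    (E : ModuleCat.{u} R) (n : ℤ) :
    Cochain (HomologicalComplex.tensorObj P X) (asComplex E) n ≃ₗ[R]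
      Cochain P (homComplex X (asComplex E)) n :=
  (tensorCochainEquiv n).trans (homCochainEquiv n).symm

theorem tensorHomCochainEquiv_δ {P X : CochainComplex (ModuleCat.{u} R) ℤ}
    {E : ModuleCat.{u} R} {n m : ℤ} (hm : n + 1 = m)
    (z : Cochain (HomologicalComplex.tensorObj P X) (asComplex E) n) :
    tensorHomCochainEquiv P X E m (δ n m z) = δ n m (tensorHomCochainEquiv P X E n z) := by
  refine (homCochainEquiv m).symm_apply_eq.2 ?_
  exact (tensorCochainEquiv_δ hm z).trans ((congrArg (bilinearδ hm)
    ((homCochainEquiv n).apply_symm_apply _).symm).trans (homCochainEquiv_δ hm _).symm)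

theorem ofHom_smul_id_comp {P Y : CochainComplex (ModuleCat.{u} R) ℤ} (x : R) {n : ℤ}
    (w : Cochain P Y n) : (Cochain.ofHom (x • 𝟙 P)).comp w (zero_add n) = x • w := by
  refine Cochain.ext _ _ fun p q hpq => ?_
  rw [Cochain.zero_cochain_comp_v, Cochain.ofHom_v, Cochain.smul_v,
    HomologicalComplex.smul_f_apply, HomologicalComplex.id_f, Linear.smul_comp, Category.id_comp]

/-- Multiplication by `x` is injective on the homology of `P ⊗ X` if it is surjective on the
morphisms from `P` to shifts of the dual of `X`. -/
theorem exists_eq_d_of_smul_eq_d {E : ModuleCat.{u} R} (hE : IsCogenerator E)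
    {P X : CochainComplex (ModuleCat.{u} R) ℤ} [P.IsKProjective] (x : R)
    (h : ∀ (n : ℤ) (f : Q.obj P ⟶ (Q.obj (homComplex X (asComplex E)))⟦n⟧), ∃ g, f = x • g)
    {i j k : ℤ} (hij : i + 1 = j) (hjk : j + 1 = k)
    (c : (HomologicalComplex.tensorObj P X).X j)
    (hc : (HomologicalComplex.tensorObj P X).d j k c = 0)
    (b : (HomologicalComplex.tensorObj P X).X i)
    (hb : x • c = (HomologicalComplex.tensorObj P X).d i j b) :
    ∃ b', c = (HomologicalComplex.tensorObj P X).d i j b' := by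
  by_contra! hne
  -- If c is not a boundary, some f kills the boundaries but not c. Its adjoint cocycle is x times a
  -- cocycle plus a coboundary; transported back and evaluated at c, both terms vanish.
  obtain ⟨f, hf, hfc⟩ := hE.exists_of_notMem (LinearMap.range ((HomologicalComplex.tensorObj P X).d i j).hom) c
    (fun ⟨y, hy⟩ => hne y hy.symm)
  let f' : Cochain (HomologicalComplex.tensorObj P X) (asComplex E) (-j) := mkCochain fun p hp =>
    f ∘ₗ (((HomologicalComplex.tensorObj P X).XIsoOfEq (show p = j by omega)).hom).hom
  have hf' : evalCochain j (by omega) f' = f := by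
    rw [evalCochain_mkCochain]
    simp
  have hδ : δ (-j) (-i) f' = 0 := by
    refine evalCochain_ext fun p hp => ?_
    obtain rfl : p = i := by omega
    rw [evalCochain_δ (by omega) _ _ j _ (by omega), hf', map_zero]
    have : f ∘ₗ ((HomologicalComplex.tensorObj P X).d p j).hom = 0 := LinearMap.ext fun y => hf _ ⟨y, rfl⟩
    rw [this, smul_zero]
  let z : Cocycle P (homComplex X (asComplex E)) (-j) :=
    Cocycle.mk (tensorHomCochainEquiv P X E _ f') (-i) (by omega) (by
      rw [← tensorHomCochainEquiv_δ (by omega), hδ, map_zero])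
  obtain ⟨w, t, hw⟩ := exists_eq_precomp_add_δ (x • 𝟙 P) (m := -k) (n := -j) (by omega) (fun g => by
    obtain ⟨g', rfl⟩ := h _ g
    refine ⟨g', ?_⟩
    rw [Functor.map_smul, Q.map_id, Linear.smul_comp, Category.id_comp]) z
  rw [ofHom_smul_id_comp] at hw
  obtain ⟨w', hw'⟩ := (tensorHomCochainEquiv P X E (-j)).surjective w.1
  obtain ⟨t', ht'⟩ := (tensorHomCochainEquiv P X E (-k)).surjective t
  have hδw : δ (-j) (-i) w' = 0 := by
    rw [← (tensorHomCochainEquiv P X E _).map_eq_zero_iff, tensorHomCochainEquiv_δ (by omega), hw']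
    exact w.δ_eq_zero _
  have h1 : f' = x • w' + δ (-k) (-j) t' := by
    apply (tensorHomCochainEquiv P X E (-j)).injective
    rw [map_add, map_smul, tensorHomCochainEquiv_δ (by omega), hw', ht']
    exact hw
  apply hfc
  -- The value of x • w' at c is w' (x • c) = w' (d b), which is zero because w' is a cocycle.
  have h2 := LinearMap.congr_fun (congrArg (evalCochain i (by omega)) hδw) b
  rw [evalCochain_δ (by omega) _ _ j _ (by omega), map_zero] at h2
  have h3 : evalCochain j (by omega) w' ((HomologicalComplex.tensorObj P X).d i j b) = 0 := by
    rwa [LinearMap.smul_apply, ← Units.smul_def, LinearMap.zero_apply, smul_eq_zero_iff_eq] at h2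
  rw [← hf', h1, map_add, map_smul, LinearMap.add_apply, LinearMap.smul_apply, ← map_smul, hb, h3,
    evalCochain_δ (by omega) _ _ k _ (by omega), zero_add]
  change ((-j).negOnePow : ℤ) • (evalCochain k (by omega) t') ((HomologicalComplex.tensorObj P X).d j k c) = 0
  rw [hc, map_zero, smul_zero]

theorem isUnit_algebraMap_end_restrictScalars (S : Submonoid R) (E : ModuleCat.{u} (Localization S))
    (s : S) : IsUnit (algebraMap R (Module.End R
      ((ModuleCat.restrictScalars (algebraMap R (Localization S))).obj E)) s) :=
  have h : Function.Bijective fun y : E => algebraMap R (Localization S) s • y :=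
    (Module.End.isUnit_iff _).1 ((IsLocalization.map_units (Localization S) s).map (algebraMap
      (Localization S) (Module.End (Localization S) E)))
  (Module.End.isUnit_iff _).2 h

/-- An injective module over the localization at `q`, restricted to `R`. -/
noncomputable abbrev residueEnvelope (q : PrimeSpectrum R) : ModuleCat.{u} R :=
  (ModuleCat.restrictScalars (algebraMap R (Localization.AtPrime q.asIdeal))).obj
    (injectiveEnvelope (residueModuleAt q))

theorem injective_residueEnvelope (q : PrimeSpectrum R) : Module.Injective R (residueEnvelope q) :=
  injective_restrictScalars_localization _ (injective_injectiveEnvelope _)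

theorem exists_linearMap_residueEnvelope (q : PrimeSpectrum R) :
    ∃ f : q.asIdeal.ResidueField →ₗ[R] residueEnvelope q, f 1 ≠ 0 := by
  refine ⟨
    { toFun := fun x => toInjectiveEnvelope (residueModuleAt q) x
      map_add' := fun x y => map_add (toInjectiveEnvelope (residueModuleAt q)) x y
      map_smul' := fun r x => by
        rw [← algebraMap_smul (Localization.AtPrime q.asIdeal) r x]
        exact map_smul (toInjectiveEnvelope (residueModuleAt q)) _ x }, fun h => ?_⟩
  exact one_ne_zero (α := q.asIdeal.ResidueField)
    ((isInjectiveEnvelope_toInjectiveEnvelope _).injective (h.trans (map_zero _).symm))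

/-- Elements outside q act invertibly on the envelope, so maps from R/q to it extend uniquely to the
localization k(q). The resulting Hom is a nonzero k(q)-vector space. -/
theorem homVanish_linearMap_residueEnvelope {q : PrimeSpectrum R}
    {X : CochainComplex (ModuleCat.{u} R) ℤ}
    (h : HomVanish (Q.obj X) (Q.obj (asComplex (residueModule q)))) :
    HomVanish (Q.obj X) (Q.obj (asComplex (ModuleCat.of R
      ((R ⧸ q.asIdeal) →ₗ[R] residueEnvelope q)))) := by
  obtain ⟨f, hf⟩ := exists_linearMap_residueEnvelope q
  have : Nontrivial (q.asIdeal.ResidueField →ₗ[R] residueEnvelope q) :=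
    ⟨f, 0, fun h => hf (by rw [h, LinearMap.zero_apply])⟩
  have h1 := (homVanish_linearMap_field_iff q.asIdeal.ResidueField (residueEnvelope q) X).2 h
  let φ := (IsScalarTower.toAlgHom R (R ⧸ q.asIdeal) q.asIdeal.ResidueField).toLinearMap
  have hu := isUnit_algebraMap_end_restrictScalars q.asIdeal.primeCompl
    (injectiveEnvelope (residueModuleAt q))
  let e : (q.asIdeal.ResidueField →ₗ[R] residueEnvelope q) ≃ₗ[R]
      ((R ⧸ q.asIdeal) →ₗ[R] residueEnvelope q) :=
    LinearEquiv.ofBijective (LinearMap.lcomp R (residueEnvelope q) φ)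
      ⟨fun g g' hg => IsLocalizedModule.ext q.asIdeal.primeCompl φ hu hg,
        fun g => ⟨IsLocalizedModule.lift q.asIdeal.primeCompl φ g hu,
          IsLocalizedModule.lift_comp q.asIdeal.primeCompl φ g hu⟩⟩
  exact homVanish_asComplex_of_retract
    (N' := ModuleCat.of R (q.asIdeal.ResidueField →ₗ[R] residueEnvelope q))
    e.symm.toLinearMap e.toLinearMap (LinearMap.ext e.apply_symm_apply) h1

theorem exists_homVanish_homComplex {q : PrimeSpectrum R} {X : CochainComplex (ModuleCat.{u} R) ℤ}
    (h : HomVanish (Q.obj X) (Q.obj (asComplex (residueModule q)))) :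
    ∃ F : ModuleCat.{u} R, Module.Injective R F ∧ ∃ e : F, e ≠ 0 ∧ (∀ r ∈ q.asIdeal, r • e = 0) ∧
      HomVanish (Q.obj (asComplex (ModuleCat.of R (R ⧸ q.asIdeal))))
        (Q.obj (homComplex X (asComplex F))) := by
  have h1 := homVanish_linearMap_residueEnvelope h
  have h2 := injective_residueEnvelope q
  obtain ⟨f, hf⟩ := exists_linearMap_residueEnvelope q
  generalize residueEnvelope q = F at h1 h2 f hf
  refine ⟨F, h2, f 1, hf, fun r hr => ?_, ?_⟩
  · rw [← map_smul, Algebra.smul_def, Ideal.algebraMap_residueField_eq_zero.2 hr, zero_mul,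
      map_zero]
  · exact (homVanish_linearMap_iff h2 (ModuleCat.of R (R ⧸ q.asIdeal)) X).1 h1

/-- If every r for which r • c is a boundary kills e, then the class of c modulo boundaries can be
sent to e by a map into F. Acyclicity of the dual factors this cocycle through d, so its value e at
c would be zero. -/
theorem exists_eq_d_of_smul_eq_zero {T : CochainComplex (ModuleCat.{u} R) ℤ} {F : ModuleCat.{u} R}
    (hF : Module.Injective R F) (hT : (homComplex T (asComplex F)).Acyclic) {e : F} (he : e ≠ 0)
    {i j k : ℤ} (hij : i + 1 = j) (hjk : j + 1 = k) (c : T.X j) (hc : T.d j k c = 0)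
    (h : ∀ (r : R) (b : T.X i), r • c = T.d i j b → r • e = 0) : ∃ b, c = T.d i j b := by
  rw [acyclic_homComplex_asComplex_iff] at hT
  by_contra! hne
  let B := LinearMap.range (T.d i j).hom
  obtain ⟨f, hf⟩ := exists_linearMap_apply_eq hF (B.mkQ c) e fun r hr => by
    rw [← map_smul, Submodule.mkQ_apply, Submodule.Quotient.mk_eq_zero] at hr
    obtain ⟨b, hb⟩ := hr
    exact h r b hb.symm
  obtain ⟨g, hg⟩ := hT i j k hij hjk (f ∘ₗ B.mkQ) (LinearMap.ext fun b => by
    change f (B.mkQ (T.d i j b)) = 0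
    have : B.mkQ (T.d i j b) = 0 := (Submodule.Quotient.mk_eq_zero _).2 ⟨b, rfl⟩
    rw [this, map_zero])
  apply he
  rw [← hf]
  refine (LinearMap.congr_fun hg c).symm.trans ?_
  change g (T.d j k c) = 0
  rw [hc, map_zero]

/-- Dévissage on RHom(R/q, D(X)). By induction each r outside q acts surjectively there, hence
injectively on the homology of R/q ⊗ᴸ X. So only elements of q can kill a nonzero class, and the
test module F for k(q) excludes such a class. -/
theorem acyclic_of_forall_homVanish_residueModule [IsNoetherianRing R]
    {X : CochainComplex (ModuleCat.{u} R) ℤ}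
    (hX : ∀ q : PrimeSpectrum R, HomVanish (Q.obj X) (Q.obj (asComplex (residueModule q)))) :
    X.Acyclic := by
  have hE := injective_cogenerator (R := R)
  have hE' := isCogenerator_cogenerator (R := R)
  rw [← acyclic_homComplex_asComplex_iff_acyclic hE hE']
  refine acyclic_of_homVanish_quotient_bot (forall_ideal_of_isOka (isOka_homVanish_quotient _)
    (fun q hq ih => ?_) ⊥)
  rw [← acyclic_derivedTensor_iff hE hE']
  obtain ⟨F, hF, e, he, hqe, hprime⟩ := exists_homVanish_homComplex (hX ⟨q, hq⟩)
  rw [homVanish_asComplex_iff, ← acyclic_homComplex_tensorObj_iff] at hprime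
  have hsmul (r : R) (hr : r ∉ q) (n : ℤ)
      (f : Q.obj (projectiveResolution (ModuleCat.of R (R ⧸ q))).cochainComplex ⟶
        (Q.obj (homComplex X (asComplex (cogenerator R))))⟦n⟧) : ∃ g, f = r • g := by
    let π := asIso (Q.map (ofProjectiveResolution (ModuleCat.of R (R ⧸ q))))
    obtain ⟨g, hg⟩ := exists_eq_smul_of_homVanish_quotient hr (ih r hr) (π.inv ≫ f)
    refine ⟨π.hom ≫ g, ?_⟩
    rw [← Linear.comp_smul, ← hg, Iso.hom_inv_id_assoc]
  rw [derivedTensor, acyclic_iff]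
  intro i j k hij hjk c hc
  by_contra! hne
  obtain ⟨b', hb'⟩ := exists_eq_d_of_smul_eq_zero hF hprime he hij hjk c hc fun r b hb => hqe r (by
    by_contra hr
    obtain ⟨b', hb'⟩ := exists_eq_d_of_smul_eq_d hE' r (hsmul r hr) hij hjk c hc b hb
    exact hne b' hb'.symm)
  exact hne b' hb'.symm

theorem not_acyclic_iff_nonempty_smallCosupport [IsNoetherianRing R]
    (M : CochainComplex (ModuleCat.{u} R) ℤ) : ¬ M.Acyclic ↔ (smallCosupport M).Nonempty := by
  have h : (dual M).Acyclic ↔ M.Acyclic :=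
    acyclic_homComplex_asComplex_iff_acyclic injective_cogenerator isCogenerator_cogenerator
  rw [← h]
  constructor
  · intro hM
    by_contra hne
    refine hM (acyclic_of_forall_homVanish_residueModule fun q => ?_)
    by_contra hq
    exact hne ⟨q, (mem_smallCosupport_iff q M).2 hq⟩
  · rintro ⟨p, hp⟩ hM
    exact (mem_smallCosupport_iff p M).1 hp (homVanish_of_acyclic_left hM _)

end Detection

end DerivedModule

namespace DerivedModule

/-! ### Finite biproducts and functoriality of the Hom complex -/

section FiniteProducts

variable {R : Type u} [CommRing R]

attribute [local instance] HasDerivedCategory.standard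

open DerivedCategory CochainComplex.HomComplex

theorem homVanish_piObj_iff {ι : Type u} [Finite ι] (X : CochainComplex (ModuleCat.{u} R) ℤ)
    (Y : ι → CochainComplex (ModuleCat.{u} R) ℤ) :
    HomVanish (Q.obj X) (Q.obj (∏ᶜ Y)) ↔ ∀ j, HomVanish (Q.obj X) (Q.obj (Y j)) := by
  classical
  have := Fintype.ofFinite ι
  have := HasBiproduct.of_hasProduct Y
  rw [← HomVanish.iff_of_iso (Iso.refl (Q.obj X)) (Q.mapIso (biproduct.isoProduct Y))]
  refine HomVanish.iff_forall_right (fun j => Q.map (biproduct.ι Y j))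
    (fun j => Q.map (biproduct.π Y j)) (fun j => ?_) ?_
  · rw [← Q.map_comp, biproduct.ι_π_self, Q.map_id]
  · simp only [← Q.map_comp]
    rw [← Functor.map_sum, ← Q.map_id]
    exact congrArg Q.map (IsBilimit.total (biproduct.isBilimit Y))

theorem homVanish_sigmaObj_iff {ι : Type u} [Finite ι] (X : ι → CochainComplex (ModuleCat.{u} R) ℤ)
    (Y : DerivedCategory (ModuleCat.{u} R)) :
    HomVanish (Q.obj (∐ X)) Y ↔ ∀ j, HomVanish (Q.obj (X j)) Y := by
  classical
  have := Fintype.ofFinite ι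
  have := HasBiproduct.of_hasProduct X
  rw [← HomVanish.iff_of_iso (Q.mapIso (biproduct.isoCoproduct X)) (Iso.refl Y)]
  refine HomVanish.iff_forall_left (fun j => Q.map (biproduct.ι X j))
    (fun j => Q.map (biproduct.π X j)) (fun j => ?_) ?_
  · rw [← Q.map_comp, biproduct.ι_π_self, Q.map_id]
  · simp only [← Q.map_comp]
    rw [← Functor.map_sum, ← Q.map_id]
    exact congrArg Q.map (IsBilimit.total (biproduct.isBilimit X))

/-- Postcomposition with a morphism of complexes, as a morphism of Hom complexes. -/
noncomputable def homComplexPostcomp (X : CochainComplex (ModuleCat.{u} R) ℤ)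
    {Y Y' : CochainComplex (ModuleCat.{u} R) ℤ} (f : Y ⟶ Y') :
    homComplex X Y ⟶ homComplex X Y' where
  f n := ModuleCat.ofHom
    { toFun := fun z : Cochain X Y n => z.comp (Cochain.ofHom f) (add_zero n)
      map_add' := fun _ _ => Cochain.add_comp _ _ _ _
      map_smul' := fun _ _ => Cochain.smul_comp _ _ _ _ }
  comm' _ j _ := ModuleCat.hom_ext (LinearMap.ext fun z => δ_comp_ofHom z f j)

theorem homComplex_hom_ext {X Y Y' : CochainComplex (ModuleCat.{u} R) ℤ}
    {f g : homComplex X Y ⟶ Y'} (h : ∀ (n : ℤ) (z : Cochain X Y n), (f.f n).hom z = (g.f n).hom z) :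
    f = g :=
  HomologicalComplex.hom_ext _ _ fun n => ModuleCat.hom_ext (LinearMap.ext (h n))

/-- The functor `N ↦ Hom(M, N)` from modules to complexes. -/
noncomputable def homComplexFunctor (M : CochainComplex (ModuleCat.{u} R) ℤ) :
    ModuleCat.{u} R ⥤ CochainComplex (ModuleCat.{u} R) ℤ where
  obj N := homComplex M (asComplex N)
  map g := homComplexPostcomp M ((HomologicalComplex.single _ _ 0).map g)
  map_id N := by
    rw [(HomologicalComplex.single _ _ 0).map_id]
    exact homComplex_hom_ext fun n z => Cochain.comp_id z
  map_comp g g' := by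
    rw [(HomologicalComplex.single _ _ 0).map_comp]
    refine homComplex_hom_ext fun n z => ?_
    exact (congrArg (fun t => z.comp t (add_zero n)) (Cochain.ofHom_comp _ _)).trans
      (Cochain.comp_assoc_of_third_is_zero_cochain _ _ _ _).symm

instance (M : CochainComplex (ModuleCat.{u} R) ℤ) : (homComplexFunctor M).Additive where
  map_add {N N' g g'} := by
    refine homComplex_hom_ext fun n z => ?_
    refine (congrArg (fun t => z.comp (Cochain.ofHom t) (add_zero n))
      ((HomologicalComplex.single _ _ 0).map_add)).trans ?_
    exact (congrArg (fun t => z.comp t (add_zero n)) (Cochain.ofHom_add _ _)).trans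
      (Cochain.comp_add _ _ _ _)

theorem homComplexFunctor_map_smul_id (M : CochainComplex (ModuleCat.{u} R) ℤ) (x : R)
    (N : ModuleCat.{u} R) : (homComplexFunctor M).map (x • 𝟙 N) = x • 𝟙 _ := by
  refine homComplex_hom_ext fun n z => ?_
  refine (congrArg (fun t => z.comp (Cochain.ofHom t) (add_zero n))
    (single_map_smul_id x N)).trans (Cochain.ext _ _ fun p q hpq => ?_)
  refine Eq.trans ?_ (congrArg (x • ·) (Category.comp_id (z.v p q hpq)))
  rw [Cochain.comp_zero_cochain_v, Cochain.ofHom_v, HomologicalComplex.smul_f_apply,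
    HomologicalComplex.id_f, Linear.comp_smul]

end FiniteProducts

/-! ### Semi-local rings: conditions 6–9 -/

section SemiLocal

variable {R : Type u} [CommRing R]

attribute [local instance] HasDerivedCategory.standard

open DerivedCategory

open scoped DirectSum in
-- For finitely many m the cogenerator is a biproduct of the envelopes, and the additive functor N ↦
-- Hom(M, N) carries this decomposition to D(M).
theorem homVanish_dual_iff [Finite (MaximalSpectrum R)] (M : CochainComplex (ModuleCat.{u} R) ℤ)
    (Y : DerivedCategory (ModuleCat.{u} R)) :
    HomVanish (Q.obj (dual M)) Y ↔ ∀ m, HomVanish (Q.obj (localDual m M)) Y := by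
  classical
  have := Fintype.ofFinite (MaximalSpectrum R)
  let E (m : MaximalSpectrum R) : ModuleCat.{u} R := localEnvelope m
  let i (m : MaximalSpectrum R) : E m ⟶ cogenerator R :=
    ModuleCat.ofHom (DirectSum.lof R (MaximalSpectrum R) (fun m => E m) m)
  let π (m : MaximalSpectrum R) : cogenerator R ⟶ E m :=
    ModuleCat.ofHom (DirectSum.component R (MaximalSpectrum R) (fun m => E m) m)
  let F := homComplexFunctor M ⋙ Q
  have hiπ (m) : F.map (i m) ≫ F.map (π m) = 𝟙 (F.obj (E m)) := by
    rw [← F.map_comp, ← F.map_id]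
    congr 1
    exact ModuleCat.hom_ext (LinearMap.ext fun x => 
      DirectSum.component.lof_self R (M := fun m => E m) m x)
  have hsum : ∑ m, F.map (π m) ≫ F.map (i m) = 𝟙 (F.obj (cogenerator R)) := by
    simp only [← F.map_comp]
    rw [← Functor.map_sum, ← F.map_id]
    congr 1
    refine ModuleCat.hom_ext (LinearMap.ext fun x => ?_)
    rw [ModuleCat.hom_sum, LinearMap.sum_apply]
    exact DirectSum.sum_univ_of x
  exact HomVanish.iff_forall_left (Y := fun m => F.obj (E m)) (B := F.obj (cogenerator R))
    (fun m => F.map (i m)) (fun m => F.map (π m)) hiπ hsum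

theorem exists_mem_notMem_of_not_le {p m : Ideal R} (h : ¬ p ≤ m) : ∃ x ∈ p, x ∉ m :=
  Set.not_subset.1 h

/-- An x in p but not in m acts invertibly on E(R/m), hence on its dual of M, and acts as zero on
k(p). -/
theorem homVanish_localDual_of_not_le {p : PrimeSpectrum R} {m : MaximalSpectrum R}
    (h : ¬ p.asIdeal ≤ m.asIdeal) (M : CochainComplex (ModuleCat.{u} R) ℤ) :
    HomVanish (Q.obj (localDual m M)) (Q.obj (asComplex (residueModule p))) := by
  obtain ⟨x, hxp, hxm⟩ := exists_mem_notMem_of_not_le h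
  let θ : localEnvelope m ≃ₗ[R] localEnvelope m :=
    LinearEquiv.ofBijective (x • LinearMap.id) (bijective_smul_localEnvelope m hxm)
  let A := (homComplexFunctor M).obj (localEnvelope m)
  let t : localEnvelope m ⟶ localEnvelope m := ModuleCat.ofHom θ.symm.toLinearMap
  have h1 : (homComplexFunctor M).map t ≫
      (x • 𝟙 _) = 𝟙 ((homComplexFunctor M).obj (localEnvelope m)) := by
    rw [← homComplexFunctor_map_smul_id, ← Functor.map_comp,
      ← (homComplexFunctor M).map_id]
    congr 1
    exact ModuleCat.hom_ext (LinearMap.ext fun e => θ.apply_symm_apply e)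
  have h2 : x • 𝟙 (Q.obj (asComplex (residueModule p))) = 0 := by
    refine (Q_map_single_smul_id x (residueModule p)).symm.trans ?_
    have : x • (LinearMap.id : p.asIdeal.ResidueField →ₗ[R] p.asIdeal.ResidueField) = 0 := by
      refine LinearMap.ext fun y => ?_
      change x • y = 0
      rw [Algebra.smul_def, Ideal.algebraMap_residueField_eq_zero.2 hxp, zero_mul]
    refine (congrArg (fun t => Q.map ((HomologicalComplex.single (ModuleCat.{u} R) (.up ℤ) 0).map
      (ModuleCat.ofHom t))) this).trans ?_
    rw [ModuleCat.ofHom_zero, Functor.map_zero, Functor.map_zero]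
  have h3 : Q.map ((homComplexFunctor M).map t) ≫ (x • 𝟙 (Q.obj A)) = 𝟙 (Q.obj A) := by
    rw [← Q.map_id, ← Functor.map_smul, ← Q.map_comp, h1]
  suffices HomVanish (Q.obj A) (Q.obj (asComplex (residueModule p))) from this
  intro n f
  rw [← Category.id_comp f, ← h3, Category.assoc, Linear.smul_comp, Category.id_comp,
    ← Category.comp_id f, ← Linear.comp_smul, smul_id_shift_eq_zero h2, comp_zero, comp_zero]

theorem nontrivial_linearMap_localEnvelope {p : PrimeSpectrum R} {m : MaximalSpectrum R}
    (h : p.asIdeal ≤ m.asIdeal) :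
    Nontrivial (p.asIdeal.ResidueField →ₗ[R] localEnvelope m) := by
  obtain ⟨e, he, hme⟩ := exists_localEnvelope_ne_zero m
  obtain ⟨f, hf⟩ := exists_linearMap_apply_eq (injective_injectiveEnvelope _)
    (1 : p.asIdeal.ResidueField) e fun r hr => hme r (h (by
      rwa [Algebra.smul_def, mul_one, Ideal.algebraMap_residueField_eq_zero] at hr))
  exact ⟨f, 0, fun h => he (by rw [← hf, h, LinearMap.zero_apply])⟩

/-- If p ⊆ m, then Hom(k(p), E(R/m)) is nonzero and field duality applies. Otherwise this Hom is
zero and both sides vanish. -/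
theorem homVanish_residueModule_localDual_iff (p : PrimeSpectrum R) (m : MaximalSpectrum R)
    (M : CochainComplex (ModuleCat.{u} R) ℤ) :
    HomVanish (Q.obj (asComplex (residueModule p))) (Q.obj (localDual m (localDual m M))) ↔
      HomVanish (Q.obj (localDual m M)) (Q.obj (asComplex (residueModule p))) := by
  by_cases h : p.asIdeal ≤ m.asIdeal
  · have := nontrivial_linearMap_localEnvelope h
    exact (homVanish_field_iff p.asIdeal.ResidueField (injective_injectiveEnvelope _) _).symm
  · refine iff_of_true ?_ (homVanish_localDual_of_not_le h M)
    refine (homVanish_linearMap_iff (injective_injectiveEnvelope _) (residueModule p) _).1 ?_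
    obtain ⟨x, hxp, hxm⟩ := exists_mem_notMem_of_not_le h
    have : Subsingleton (residueModule p →ₗ[R] localEnvelope m) := by
      refine subsingleton_of_forall_eq 0 fun f => LinearMap.ext fun y =>
        (bijective_smul_localEnvelope m hxm).1 ?_
      change x • f y = x • (0 : localEnvelope m)
      rw [← map_smul, smul_zero]
      have : x • y = 0 := by
        refine (Algebra.smul_def (A := p.asIdeal.ResidueField) x y).trans ?_
        rw [Ideal.algebraMap_residueField_eq_zero.2 hxp, zero_mul]
      rw [this, map_zero]
    have : Subsingleton (ModuleCat.of R (residueModule p →ₗ[R] localEnvelope m)) := this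
    exact fun _ _ => ((shiftFunctor _ _).map_isZero (isZero_Q_obj_asComplex _)).eq_of_tgt _ _

/-- Coextension of scalars is right adjoint to restriction, so RHom over R_p from k(p) into
RHom_R(R_p, Y) is RHom_R(k(p), Y). -/
theorem acyclic_derivedTensor_RHomAlgebra_iff [IsNoetherianRing R] (p : PrimeSpectrum R)
    (Y : CochainComplex (ModuleCat.{u} R) ℤ) :
    (derivedTensor (residueModuleAt p)
      (RHomAlgebra (Localization.AtPrime p.asIdeal) Y)).Acyclic ↔
      HomVanish (Q.obj (asComplex (residueModule p))) (Q.obj Y) := by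
  obtain ⟨e⟩ := nonempty_restrict_residueModuleAt_iso p
  rw [acyclic_derivedTensor_residueModuleAt_iff, RHomAlgebra, homVanish_map_iff_of_isKInjective
    (ModuleCat.restrictCoextendScalarsAdj (algebraMap R (Localization.AtPrime p.asIdeal))),
    homVanish_iff_of_quasiIso (𝟙 (asComplex (residueModule p))) (toKInjectiveResolution Y)]
  exact HomVanish.iff_of_iso (Q.mapIso e) (Iso.refl _)

theorem smallCosupport_tfae_of_finite [IsNoetherianRing R] [Finite (MaximalSpectrum R)]
    (M : CochainComplex (ModuleCat.{u} R) ℤ) (p : PrimeSpectrum R) :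
    List.TFAE [
      p ∈ smallCosupport M,
      ¬ (RHom (asComplex (residueModule p)) (tilde M)).Acyclic,
      ¬ (RHom (∐ fun m : MaximalSpectrum R => localDual m M)
          (asComplex (residueModule p))).Acyclic,
      ∃ m : MaximalSpectrum R, p.asIdeal ≤ m.asIdeal ∧ p ∈ smallSupport (localDual m M),
      ¬ (derivedTensor (residueModuleAt p)
          (RHomAlgebra (Localization.AtPrime p.asIdeal) (tilde M))).Acyclic] := by
  have h6 : HomVanish (Q.obj (asComplex (residueModule p))) (Q.obj (tilde M)) ↔
      ∀ m, HomVanish (Q.obj (localDual m M)) (Q.obj (asComplex (residueModule p))) := by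
    simp only [← homVanish_residueModule_localDual_iff]
    exact homVanish_piObj_iff _ _
  tfae_have 1 ↔ 2 := by rw [mem_smallCosupport_iff, acyclic_RHom_iff, h6, homVanish_dual_iff]
  tfae_have 1 ↔ 3 := by
    rw [mem_smallCosupport_iff, acyclic_RHom_iff, homVanish_sigmaObj_iff, homVanish_dual_iff]
  tfae_have 1 ↔ 4 := by
    rw [mem_smallCosupport_iff, homVanish_dual_iff, not_forall]
    refine exists_congr fun m => ?_
    rw [mem_smallSupport_iff]
    -- The containment p ⊆ m is automatic, since otherwise the local dual has no morphisms to shifts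
    -- of k(p).
    exact ⟨fun h => ⟨by_contra fun hpm => h (homVanish_localDual_of_not_le hpm M), h⟩, And.right⟩
  tfae_have 1 ↔ 5 := by
    rw [mem_smallCosupport_iff, acyclic_derivedTensor_RHomAlgebra_iff, h6, homVanish_dual_iff]
  tfae_finish

end SemiLocal

end DerivedModule

theorem theorem3p2 {R : Type u} [CommRing R] [IsNoetherianRing R]
    (M : CochainComplex (ModuleCat.{u} R) ℤ) :
    (∀ p : PrimeSpectrum R, List.TFAE [
      p ∈ smallCosupport M,
      ¬ (RHom (dual M) (asComplex (residueModule p))).Acyclic,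
      p ∈ smallSupport (dual M),
      ¬ (derivedTensor (residueModuleAt p) (colocalizeAt p M)).Acyclic,
      IsLocalRing.closedPoint (Localization.AtPrime p.asIdeal) ∈
        smallCosupport (colocalizeAt p M)]) ∧
    (Finite (MaximalSpectrum R) → ∀ p : PrimeSpectrum R, List.TFAE [
      p ∈ smallCosupport M,
      ¬ (RHom (dual M) (asComplex (residueModule p))).Acyclic,
      p ∈ smallSupport (dual M),
      ¬ (derivedTensor (residueModuleAt p) (colocalizeAt p M)).Acyclic,
      IsLocalRing.closedPoint (Localization.AtPrime p.asIdeal) ∈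
        smallCosupport (colocalizeAt p M),
      ¬ (RHom (asComplex (residueModule p)) (tilde M)).Acyclic,
      ¬ (RHom (∐ fun m : MaximalSpectrum R => localDual m M)
          (asComplex (residueModule p))).Acyclic,
      ∃ m : MaximalSpectrum R, p.asIdeal ≤ m.asIdeal ∧ p ∈ smallSupport (localDual m M),
      ¬ (derivedTensor (residueModuleAt p)
          (RHomAlgebra (Localization.AtPrime p.asIdeal) (tilde M))).Acyclic]) ∧
    (¬ M.Acyclic ↔ (smallCosupport M).Nonempty) := by
  refine ⟨fun p => smallCosupport_tfae M p, fun _ p => ?_, not_acyclic_iff_nonempty_smallCosupport M⟩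
  have h₁ := smallCosupport_tfae M p
  have h₂ := smallCosupport_tfae_of_finite M p
  tfae_have 1 ↔ 2 := h₁.out 0 1
  tfae_have 1 ↔ 3 := h₁.out 0 2
  tfae_have 1 ↔ 4 := h₁.out 0 3
  tfae_have 1 ↔ 5 := h₁.out 0 4
  tfae_have 1 ↔ 6 := h₂.out 0 1
  tfae_have 1 ↔ 7 := h₂.out 0 2
  tfae_have 1 ↔ 8 := h₂.out 0 3
  tfae_have 1 ↔ 9 := h₂.out 0 4
  tfae_finish
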